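/- Definitions. A dag is a finite digraph without directed cycles; $m=m(G)$ denotes its number of edges. It is connected if its underlying undirected graph is connected, and a (maximum) clique of $G$ is a (maximum) clique of the underlying undirected graph. For thresholds $0<t_1\le t_2$, a satisfying utility function of $G$ is a map $\alpha:V(G)\to\mathbb R$ with $\alpha(v)-\alpha(u)\ge t_1$ whenever $(u,v)$ is an edge and $\alpha(v)-\alpha(u)\le t_2$ whenever $(u,v)$ is not an edge. The dag $G$ is degenerate if it models a weak order, i.e. if there is $\alpha:V(G)\to\mathbb R$ such that $(u,v)$ is an edge if and only if $\alpha(u)<\alpha(v)$; otherwise $G$ is nondegenerate. For nondegenerate $G$, $\lambda=\lambda(G)$ denotes the minimum of $t_2/t_1$ over all $0<t_1\le t_2$ for which $G$ has a satisfying utility function. Statement. There is an algorithm that, given any connected nondegenerate dag $G$ as a list of its edges in any order (and not given $\lambda(G)$), finds a maximum clique of $G$ in time $$O\!\left(\lambda\, m^{\lfloor \lambda+1\rfloor/2}\right),$$ where the implied constant is absolute (independent of $G$ and of $\lambda$). Here time is the number of steps of a random access machine with unit-cost addition, subtraction, comparison and indirect addressing, all of whose stored numbers and addresses are bounded by a fixed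 polynomial in the time bound $\lambda\, m^{\lfloor \lambda+1\rfloor/2}$ (i.e. the words have length logarithmic in the time bound). -/

import Mathlib

/-! ### Double-threshold digraphs -/

namespace DoubleThreshold

/-- A dag: a digraph without directed cycles (in particular without loops and 2-cycles). -/
def IsDag {V : Type*} (G : Digraph V) : Prop :=
  ∀ v, ¬ Relation.TransGen G.Adj v v

/-- The number `m(G)` of (directed) edges. -/
noncomputable def numEdges {V : Type*} (G : Digraph V) : ℕ :=
  Set.ncard {p : V × V | G.Adj p.1 p.2}

/-- `α` is a satisfying utility function of `G` for the thresholds `(t₁, t₂)`. -/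
def IsSatisfying {V : Type*} (G : Digraph V) (t₁ t₂ : ℝ) (α : V → ℝ) : Prop :=
  (∀ u v, G.Adj u v → t₁ ≤ α v - α u) ∧ (∀ u v, ¬ G.Adj u v → α v - α u ≤ t₂)

/-- `G` is degenerate if it models a weak order: every vertex has a utility value such that
`(u, v)` is an edge if and only if the value of `v` is greater than that of `u`. -/
def IsDegenerate {V : Type*} (G : Digraph V) : Prop :=
  ∃ α : V → ℝ, ∀ u v, G.Adj u v ↔ α u < α v

/-- The ratios `t₂ / t₁`, over thresholds `0 < t₁ ≤ t₂`, for which `G` has a satisfying utility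
function. -/
def satisfiableRatios {V : Type*} (G : Digraph V) : Set ℝ :=
  {r | ∃ t₁ t₂ : ℝ, 0 < t₁ ∧ t₁ ≤ t₂ ∧ r = t₂ / t₁ ∧ ∃ α : V → ℝ, IsSatisfying G t₁ t₂ α}

open scoped Classical in
/-- `λ(G)`: the minimum satisfiable ratio `t₂ / t₁`, and `0` by convention if `G` is degenerate.
(For a finite dag the set of satisfiable ratios is nonempty, closed and bounded below by `1`, so
the infimum is a minimum.) -/
noncomputable def lam {V : Type*} (G : Digraph V) : ℝ :=
  if IsDegenerate G then 0 else sInf (satisfiableRatios G)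

end DoubleThreshold

/-! ### Random access machine

Programs have finitely many scalar registers and finitely many arrays of natural numbers.  They
use additions, truncated subtractions, indirect (array) access, conditionals and loops.  Every
elementary operation costs one step, and all the numbers that are stored, as well as the addresses
at which they are stored, have to be at most `W`: this bounds the word length. -/

namespace WordRAM

/-- A memory: scalar register `x` holds `var x`, and cell `i` of array `a` holds `arr a i`. -/
structure State where
  var : ℕ → ℕ
  arr : ℕ → ℕ → ℕ

/-- Write `v` into scalar register `x`. -/
def State.setVar (s : State) (x v : ℕ) : State :=
  { s with var := Function.update s.var x v }

/-- Write `v` into cell `i` of array `a`. -/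
def State.setArr (s : State) (a i v : ℕ) : State :=
  { s with arr := Function.update s.arr a (Function.update (s.arr a) i v) }

/-- Expressions.  Register names and array names are fixed in the program; the cell of an array
is addressed by the value of an expression. -/
inductive Expr where
  | const (c : ℕ)
  | var (x : ℕ)
  | get (a : ℕ) (i : Expr)
  | add (e₁ e₂ : Expr)
  | sub (e₁ e₂ : Expr)

/-- The value of an expression (`sub` is truncated subtraction). -/
def Expr.eval (s : State) : Expr → ℕ
  | .const c => c
  | .var x => s.var x
  | .get a i => s.arr a (i.eval s)
  | .add e₁ e₂ => e₁.eval s + e₂.eval s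
  | .sub e₁ e₂ => e₁.eval s - e₂.eval s

/-- The number of steps for evaluating an expression: one for each operation and operand. -/
def Expr.cost : Expr → ℕ
  | .const _ => 1
  | .var _ => 1
  | .get _ i => i.cost + 1
  | .add e₁ e₂ => e₁.cost + e₂.cost + 1
  | .sub e₁ e₂ => e₁.cost + e₂.cost + 1

/-- Programs; the tests of `ite` and `while` succeed if the value of `e` is nonzero. -/
inductive Prog where
  | skip
  | setVar (x : ℕ) (e : Expr)
  | setArr (a : ℕ) (i e : Expr)
  | seq (p q : Prog)
  | ite (e : Expr) (p q : Prog)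
  | while (e : Expr) (p : Prog)

/-- `Exec W p s t s'`: on a machine whose words hold the numbers `0, …, W`, the program `p`,
started in state `s`, halts in state `s'` after exactly `t` steps. -/
inductive Exec (W : ℕ) : Prog → State → ℕ → State → Prop where
  | skip (s : State) : Exec W .skip s 1 s
  | setVar (x : ℕ) (e : Expr) (s : State) (he : e.eval s ≤ W) :
      Exec W (.setVar x e) s (e.cost + 1) (s.setVar x (e.eval s))
  | setArr (a : ℕ) (i e : Expr) (s : State) (hi : i.eval s ≤ W) (he : e.eval s ≤ W) :
      Exec W (.setArr a i e) s (i.cost + e.cost + 1) (s.setArr a (i.eval s) (e.eval s))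
  | seq {p q : Prog} {s s₁ s₂ : State} {t₁ t₂ : ℕ}
      (hp : Exec W p s t₁ s₁) (hq : Exec W q s₁ t₂ s₂) : Exec W (.seq p q) s (t₁ + t₂) s₂
  | ite_true {e : Expr} {p q : Prog} {s s₁ : State} {t : ℕ}
      (he : e.eval s ≠ 0) (hp : Exec W p s t s₁) : Exec W (.ite e p q) s (e.cost + 1 + t) s₁
  | ite_false {e : Expr} {p q : Prog} {s s₁ : State} {t : ℕ}
      (he : e.eval s = 0) (hq : Exec W q s t s₁) : Exec W (.ite e p q) s (e.cost + 1 + t) s₁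
  | while_true {e : Expr} {p : Prog} {s s₁ s₂ : State} {t₁ t₂ : ℕ}
      (he : e.eval s ≠ 0) (hp : Exec W p s t₁ s₁) (hw : Exec W (.while e p) s₁ t₂ s₂) :
      Exec W (.while e p) s (e.cost + 1 + t₁ + t₂) s₂
  | while_false {e : Expr} {p : Prog} {s : State}
      (he : e.eval s = 0) : Exec W (.while e p) s (e.cost + 1) s

/-- The input of a digraph with vertices `0, …, n - 1` as a list of edges `(u, v)`: register `0`
holds `n`, register `1` holds the number of edges, arrays `0` and `1` hold the tails `u` and the
heads `v` of the edges; everything else is `0`. -/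
def edgeListInput (n : ℕ) (es : List (Fin n × Fin n)) : State where
  var := fun x => if x = 0 then n else if x = 1 then es.length else 0
  arr := fun a i =>
    if a = 0 then (es.map fun e => (e.1 : ℕ)).getD i 0
    else if a = 1 then (es.map fun e => (e.2 : ℕ)).getD i 0
    else 0

/-- The output in state `s` is the vertex set `K`: register `0` holds its size, and the first
cells of array `0` list its elements, each once. -/
def OutputsSet {n : ℕ} (s : State) (K : Finset (Fin n)) : Prop :=
  s.var 0 = K.card ∧
    ∃ l : List (Fin n), l.Nodup ∧ l.toFinset = K ∧
      (List.range (s.var 0)).map (s.arr 0) = l.map fun v => (v : ℕ)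

end WordRAM

/-! Let `K = ⌊λ⌋`, and call a walk a `k`-walk if any `k + 1` consecutive vertices form a clique
(`KW`). Every clique, listed along its edges, is a `k`-walk for all `k`. Conversely every `K`-walk
is a clique: vertices at most `K` steps apart share a window, and over more steps the utility rises
by at least `(K + 1) t₁ > t₂`, which is impossible for a non-edge (`KW.isCl_of_satisfying`). So for
`k = 1, 2, …` the algorithm finds a `k`-walk that is at least as long as every clique, and stops as
soon as this walk is itself a clique, hence a maximum one. This happens at `k = K` at the latest,
and `λ` need not be known (`wp_output`).

The walks come from a dynamic program on the `k`-cliques ("windows"). A `(k + 1)`-clique is an arc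
from the window without its last vertex to the window without its first vertex. The windows are
processed with their first vertices in a topological order of `G` (`Before`). Along an arc the first
vertex is replaced by an out-neighbour, so the walk of a window is final when the window is
processed (`Stage.not_mem_done`). Extending a clique by a last vertex keeps its first vertex, so the
`(k + 1)`-cliques come out in a suitable order by themselves (`Stage.snoc`); only stage 1 needs a
topological sort.

To extend a `k`-clique, `k ≥ 2`, the candidates are the known extensions either of its first vertex
or of the clique without its first vertex, whichever are fewer. For `k = 2` this costs a sum of
smaller out-degrees over the edges, which is `O(m^{3/2})` (`sum_min_nch_le`); for `k ≥ 3` the second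
choice alone costs at most `m` times the number of `(k - 1)`-cliques (`sum_nch_dropLast_le`). As
there are at most `2 m^{k/2}` `k`-cliques (`card_cliq_le`), stage `k` takes `O(m^{(k+1)/2})` steps
(`stageCost_le`), and the stages add up geometrically, with ratio `√m ≥ √2`.

Cliques are lists with the last vertex first, so `dropLast` removes the first vertex of the clique
and `w :: c` is an extension of `c`. In memory each clique is a tree node that owns `n` consecutive
addresses, where 0 is the null address. Arrays 7 to 10 hold its last vertex and its links to the
first vertex, to the clique without its first vertex, and to the clique without its last vertex.
Array 11 is the table of children, 12 and 13 hold the length and the predecessor of the walk of a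
window, and 14 and 15 delimit the children of a node. -/

namespace WordRAM

/-! ### Weakest preconditions with a clock. -/

/-- Started in `s` at time `τ`, the program halts with words of size `W`, and the final state and
the final time satisfy `Q`. -/
def WP (W : ℕ) (p : Prog) (Q : State → ℕ → Prop) (s : State) (τ : ℕ) : Prop :=
  ∃ t s', Exec W p s t s' ∧ Q s' (τ + t)

variable {W : ℕ} {Q R : State → ℕ → Prop} {s : State} {τ : ℕ}

theorem WP.skip (h : Q s (τ + 1)) : WP W .skip Q s τ := ⟨1, s, .skip s, h⟩

theorem WP.setVar {x : ℕ} {e : Expr} (he : e.eval s ≤ W)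
    (h : Q (s.setVar x (e.eval s)) (τ + (e.cost + 1))) : WP W (.setVar x e) Q s τ :=
  ⟨_, _, .setVar x e s he, h⟩

theorem WP.setArr {a : ℕ} {i e : Expr} (hi : i.eval s ≤ W) (he : e.eval s ≤ W)
    (h : Q (s.setArr a (i.eval s) (e.eval s)) (τ + (i.cost + e.cost + 1))) :
    WP W (.setArr a i e) Q s τ :=
  ⟨_, _, .setArr a i e s hi he, h⟩

theorem WP.seq {p q : Prog} (h : WP W p (WP W q Q) s τ) : WP W (.seq p q) Q s τ := by
  obtain ⟨t, s', he, t', s'', he', hq⟩ := h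
  exact ⟨_, _, .seq he he', by rwa [← add_assoc]⟩

theorem WP.ite {e : Expr} {p q : Prog}
    (h₁ : e.eval s ≠ 0 → WP W p Q s (τ + (e.cost + 1)))
    (h₂ : e.eval s = 0 → WP W q Q s (τ + (e.cost + 1))) : WP W (.ite e p q) Q s τ := by
  by_cases h : e.eval s = 0
  · obtain ⟨t, s', he, hq⟩ := h₂ h
    exact ⟨_, _, .ite_false h he, by rwa [← add_assoc]⟩
  · obtain ⟨t, s', he, hq⟩ := h₁ h
    exact ⟨_, _, .ite_true h he, by rwa [← add_assoc]⟩

/-- The rule for loops: the invariant `I r` says in particular that at most `r` iterations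
remain. -/
theorem WP.while {e : Expr} {p : Prog} (I : ℕ → State → ℕ → Prop)
    (h₀ : ∀ r s τ, I r s τ → e.eval s = 0 → Q s (τ + (e.cost + 1)))
    (h₁ : ∀ r s τ, I r s τ → e.eval s ≠ 0 →
      WP W p (fun s' τ' => ∃ r' < r, I r' s' τ') s (τ + (e.cost + 1)))
    (r : ℕ) (h : I r s τ) : WP W (.while e p) Q s τ := by
  induction r using Nat.strong_induction_on generalizing s τ with
  | _ r ih =>
    by_cases h' : e.eval s = 0
    · exact ⟨_, _, .while_false h', h₀ r s τ h h'⟩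
    · obtain ⟨t, s', he, r', hr, hi⟩ := h₁ r s τ h h'
      obtain ⟨t', s'', he', hq⟩ := ih r' hr hi
      exact ⟨_, _, .while_true h' he he', by simpa [add_assoc] using hq⟩

@[simp] theorem State.setVar_var (s : State) (x v : ℕ) :
    (s.setVar x v).var = Function.update s.var x v := rfl

@[simp] theorem State.setVar_arr (s : State) (x v : ℕ) : (s.setVar x v).arr = s.arr := rfl

@[simp] theorem State.setArr_var (s : State) (a i v : ℕ) : (s.setArr a i v).var = s.var := rfl

@[simp] theorem State.setArr_arr (s : State) (a i v : ℕ) :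
    (s.setArr a i v).arr = Function.update s.arr a (Function.update (s.arr a) i v) := rfl

end WordRAM

/-! ### Cliques, `k`-walks and their relation to `λ`. -/

namespace MaxClique

open DoubleThreshold

section Graph

set_option linter.unusedSectionVars false

variable {V : Type*} [Fintype V] {G : Digraph V}

/-- A list of vertices in which every vertex has edges to all the preceding ones: a clique, with
its last vertex first. -/
def IsCl (G : Digraph V) (c : List V) : Prop := c.Pairwise fun a b => G.Adj b a

/-- A walk, with its last vertex first, each of whose windows of `k + 1` vertices is a clique. -/
def KW (G : Digraph V) (k : ℕ) : List V → Prop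
  | [] => True
  | w :: q => (∀ x ∈ q.take k, G.Adj x w) ∧ KW G k q

theorem isCl_cons {w : V} {c : List V} : IsCl G (w :: c) ↔ (∀ x ∈ c, G.Adj x w) ∧ IsCl G c :=
  List.pairwise_cons

theorem IsCl.sublist {c d : List V} (h : IsCl G d) (hs : c.Sublist d) : IsCl G c :=
  List.Pairwise.sublist hs h

theorem IsDag.irrefl (hG : IsDag G) (v : V) : ¬ G.Adj v v := fun h => hG v (.single h)

open scoped Classical in
/-- The number of ancestors of a vertex. -/
noncomputable def rk (G : Digraph V) (v : V) : ℕ :=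
  (Finset.univ.filter fun u => Relation.TransGen G.Adj u v).card

theorem rk_lt (hG : IsDag G) {u v : V} (h : G.Adj u v) : rk G u < rk G v := by
  classical
  refine Finset.card_lt_card ⟨?_, ?_⟩
  · intro x hx
    simp only [Finset.mem_filter, Finset.mem_univ, true_and] at hx ⊢
    exact hx.tail h
  · intro hs
    have := @hs u (by simpa using Relation.TransGen.single h)
    simp only [Finset.mem_filter, Finset.mem_univ, true_and] at this
    exact hG u this

theorem IsCl.kw {k : ℕ} {c : List V} (h : IsCl G c) : KW G k c := by
  induction c with
  | nil => trivial
  | cons w q ih =>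
    rw [isCl_cons] at h
    exact ⟨fun x hx => h.1 x (List.mem_of_mem_take hx), ih h.2⟩

theorem KW.isCl {k : ℕ} {c : List V} (h : KW G k c) (hc : c.length ≤ k + 1) : IsCl G c := by
  induction c with
  | nil => exact List.Pairwise.nil
  | cons w q ih =>
    have hq : q.length ≤ k := by simpa using hc
    have := h.1
    rw [List.take_of_length_le hq] at this
    exact isCl_cons.2 ⟨this, ih h.2 (by omega)⟩

theorem KW.take {k : ℕ} {c : List V} (h : KW G k c) (j : ℕ) : KW G k (c.take j) := by
  induction c generalizing j with
  | nil => simpa using h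
  | cons w q ih =>
    cases j with
    | zero => trivial
    | succ j =>
      refine ⟨fun x hx => h.1 x ?_, ih h.2 j⟩
      rw [List.take_take] at hx
      exact List.take_subset_take_left q (min_le_left _ _) hx

/-- For `k ≥ 1` consecutive vertices are joined by edges, along which the rank grows. Consequently
walks have no repetitions and at most `n` vertices, which keeps stored walk lengths within a word.
-/
theorem KW.pairwise_rk (hG : IsDag G) {k : ℕ} (hk : 1 ≤ k) {q : List V} (h : KW G k q) :
    q.Pairwise fun a b => rk G b < rk G a := by
  induction q with
  | nil => exact List.Pairwise.nil
  | cons w q ih =>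
    refine List.pairwise_cons.2 ⟨?_, ih h.2⟩
    have ih := ih h.2
    cases q with
    | nil => simp
    | cons x q =>
      have hx : rk G x < rk G w := rk_lt hG (h.1 x (by
        obtain ⟨k, rfl⟩ := Nat.exists_eq_add_of_le' hk
        simp))
      intro y hy
      rcases List.mem_cons.1 hy with rfl | hy
      · exact hx
      · exact ((List.pairwise_cons.1 ih).1 y hy).trans hx

theorem KW.nodup (hG : IsDag G) {k : ℕ} (hk : 1 ≤ k) {q : List V} (h : KW G k q) : q.Nodup :=
  (h.pairwise_rk hG hk).imp fun h' => by rintro rfl; exact lt_irrefl _ h'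

theorem KW.length_le (hG : IsDag G) {k : ℕ} (hk : 1 ≤ k) {q : List V} (h : KW G k q) :
    q.length ≤ Fintype.card V := (h.nodup hG hk).length_le_card

theorem IsCl.nodup (hG : IsDag G) {c : List V} (h : IsCl G c) : c.Nodup :=
  KW.nodup hG le_rfl h.kw

/-- The longest `k`-walk that ends with a given clique is at least as long as the clique. -/
theorem IsCl.length_le_of_step {k : ℕ} (hk : 1 ≤ k) {f : List V → ℕ}
    (h₀ : ∀ c, IsCl G c → c.length = k → k ≤ f c)
    (h₁ : ∀ w c, IsCl G (w :: c) → c.length = k → f c + 1 ≤ f (w :: c.dropLast))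
    {q : List V} (hq : IsCl G q) (hl : k ≤ q.length) : q.length ≤ f (q.take k) := by
  induction q with
  | nil => simp at hl; omega
  | cons w q ih =>
    rcases hl.eq_or_lt with h | h
    · rw [List.take_of_length_le h.symm.le, ← h]
      exact h₀ _ hq h.symm
    · have hl' : k ≤ q.length := by simp at h; omega
      have h2 := ih (isCl_cons.1 hq).2 hl'
      have hlen : (q.take k).length = k := by simp [hl']
      have h3 := h₁ w (q.take k) (hq.sublist (by simpa using List.take_sublist k q)) hlen
      -- Appending `w` slides the window: `w` enters and the oldest of the `k` vertices leaves. The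
      -- first `k + 1` entries of `w :: q` are the `(k + 1)`-clique to which `h₁` is applied.
      have : (w :: q).take k = w :: (q.take k).dropLast := by
        obtain ⟨k, rfl⟩ := Nat.exists_eq_add_of_le' hk
        rw [List.take_succ_cons, List.dropLast_eq_take, List.take_take, hlen]
        simp
      rw [this]
      simp only [List.length_cons]
      omega

theorem KW.utility {k : ℕ} (hk : 1 ≤ k) {α : V → ℝ} {t : ℝ}
    (hα : ∀ u v, G.Adj u v → t ≤ α v - α u) {w : V} {q : List V} (h : KW G k (w :: q))
    (i : ℕ) (hi : i < q.length) : (i + 1) * t ≤ α w - α q[i] := by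
  induction q generalizing w i with
  | nil => simp at hi
  | cons x q ih =>
    have hx : t ≤ α w - α x := hα _ _ (h.1 x (by
      obtain ⟨k, rfl⟩ := Nat.exists_eq_add_of_le' hk
      simp))
    cases i with
    | zero => simpa using hx
    | succ i =>
      have := ih h.2 i (by simpa using hi)
      simp only [List.getElem_cons_succ]
      push_cast
      linarith

/-- This is the only place where the thresholds matter. A vertex within the last `k` is joined to
`w` by the definition of a `k`-walk; an older one is at least `k + 1` edges away, so its utility is
more than `t₂` below that of `w`, and the pair must be an edge. -/
theorem KW.isCl_of_satisfying {k : ℕ} (hk : 1 ≤ k) {α : V → ℝ} {t₁ t₂ : ℝ} (ht : 0 < t₁)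
    (hα : IsSatisfying G t₁ t₂ α) (hkt : t₂ < (k + 1) * t₁) {q : List V} (h : KW G k q) :
    IsCl G q := by
  induction q with
  | nil => exact List.Pairwise.nil
  | cons w q ih =>
    refine isCl_cons.2 ⟨fun x hx => ?_, ih h.2⟩
    obtain ⟨i, hi, rfl⟩ := List.getElem_of_mem hx
    by_cases hik : i < k
    · exact h.1 _ (List.mem_take_iff_getElem.2 ⟨i, by omega, rfl⟩)
    · by_contra hn
      have h1 := hα.2 _ _ hn
      have h2 := h.utility hk hα.1 i hi
      have : (k : ℝ) ≤ i := by exact_mod_cast not_lt.1 hik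
      nlinarith

/-- The rank is a utility function: it grows by at least 1 along edges and never exceeds the number
of vertices. -/
theorem satisfiableRatios_nonempty (hG : IsDag G) : (satisfiableRatios G).Nonempty := by
  refine ⟨_, 1, (Fintype.card V : ℝ) + 1, one_pos, by linarith [Nat.cast_nonneg (α := ℝ) (Fintype.card V)],
    rfl, fun v => rk G v, ?_, ?_⟩
  · intro u v h
    have := rk_lt hG h
    have : (rk G u : ℝ) + 1 ≤ rk G v := by exact_mod_cast this
    linarith
  · intro u v _
    have : rk G v ≤ Fintype.card V := Finset.card_le_univ _
    have h1 : (rk G v : ℝ) ≤ Fintype.card V := by exact_mod_cast this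
    have h2 := Nat.cast_nonneg (α := ℝ) (rk G u)
    linarith

theorem one_le_lam (hG : IsDag G) (hd : ¬ IsDegenerate G) : 1 ≤ lam G := by
  rw [lam, if_neg hd]
  refine le_csInf (satisfiableRatios_nonempty hG) ?_
  rintro r ⟨t₁, t₂, h, hle, rfl, -⟩
  rwa [one_le_div h]

/-- That the infimum `λ` is attained is not needed: the argument only uses a ratio below `⌊λ⌋ + 1`,
and this number exceeds the infimum. -/
theorem exists_satisfying (hG : IsDag G) (hd : ¬ IsDegenerate G) :
    ∃ (α : V → ℝ) (t₁ t₂ : ℝ), 0 < t₁ ∧ IsSatisfying G t₁ t₂ α ∧ t₂ < (⌊lam G⌋₊ + 1) * t₁ := by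
  have h := Nat.lt_floor_add_one (lam G)
  conv_lhs at h => rw [lam, if_neg hd]
  obtain ⟨r, ⟨t₁, t₂, h1, -, rfl, α, hα⟩, hlt⟩ :=
    exists_lt_of_csInf_lt (satisfiableRatios_nonempty hG) h
  exact ⟨α, t₁, t₂, h1, hα, (div_lt_iff₀ h1).1 hlt⟩

/-- Every clique can be listed along its edges. -/
theorem exists_isCl_of_isClique (hG : IsDag G) {s : Finset V}
    (hs : G.toSimpleGraphInclusive.IsClique s) : ∃ q : List V, IsCl G q ∧ q.length = s.card := by
  classical
  let r : V → V → Prop := fun a b => rk G b ≤ rk G a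
  have : Std.Total r := ⟨fun a b => le_total _ _⟩
  have : IsTrans V r := ⟨fun a b c h1 h2 => le_trans h2 h1⟩
  refine ⟨s.toList.insertionSort r, ?_, by simp⟩
  have h1 : (s.toList.insertionSort r).Pairwise r := List.pairwise_insertionSort r _
  have h2 : (s.toList.insertionSort r).Nodup :=
    (List.perm_insertionSort r _).nodup_iff.2 s.nodup_toList
  refine List.Pairwise.imp_of_mem ?_ (h1.and h2)
  rintro a b ha hb ⟨hab, hne⟩
  simp only [List.mem_insertionSort, Finset.mem_toList] at ha hb
  have := hs ha hb hne
  rcases this.2 with h | h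
  · have := rk_lt hG h
    simp only [r] at hab
    omega
  · exact h

theorem IsCl.isClique [DecidableEq V] {q : List V} (hq : IsCl G q) :
    G.toSimpleGraphInclusive.IsClique (q.toFinset : Set V) := by
  have : q.Pairwise fun a b => a ≠ b → G.toSimpleGraphInclusive.Adj a b :=
    hq.imp fun h hne => ⟨hne, .inr h⟩
  intro a ha b hb hne
  have hs : Std.Symm fun a b => a ≠ b → G.toSimpleGraphInclusive.Adj a b :=
    ⟨fun a b h hne => (h hne.symm).symm⟩
  exact this.forall_of_forall (fun _ _ h => absurd rfl h) (by simpa using ha) (by simpa using hb) hne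

theorem numEdges_eq [DecidableEq V] {es : List (V × V)} (hn : es.Nodup)
    (h : ∀ u v, (u, v) ∈ es ↔ G.Adj u v) : numEdges G = es.length := by
  rw [numEdges, ← List.toFinset_card_of_nodup hn, ← Set.ncard_coe_finset]
  congr 1
  ext ⟨u, v⟩
  simp [h]

/-- Each ordered pair of distinct vertices of a clique is an edge or a reversed edge. This bounds
the quadratic number of tests in `check` by `O(n + m)`. -/
theorem IsCl.length_mul_le (hG : IsDag G) {q : List V} (hq : IsCl G q) :
    q.length * q.length ≤ q.length + 2 * numEdges G := by
  classical
  let E : Finset (V × V) := Finset.univ.filter fun p => G.Adj p.1 p.2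
  have hE : E.card = numEdges G := by
    rw [numEdges, ← Set.ncard_coe_finset]; congr 1; ext; simp [E]
  have h1 : q.toFinset.offDiag ⊆ E ∪ E.image Prod.swap := by
    rintro ⟨a, b⟩ hab
    simp only [Finset.mem_offDiag] at hab
    have := hq.isClique (by simpa using hab.1) (by simpa using hab.2.1) hab.2.2
    rcases this.2 with h | h
    · exact Finset.mem_union_left _ (by simpa [E] using h)
    · exact Finset.mem_union_right _ (Finset.mem_image.2 ⟨(b, a), by simpa [E] using h, rfl⟩)
  have h2 := (Finset.card_le_card h1).trans (Finset.card_union_le _ _)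
  have h3 : (E.image Prod.swap).card ≤ E.card := Finset.card_image_le
  rw [Finset.offDiag_card, List.toFinset_card_of_nodup (hq.nodup hG)] at h2
  omega

theorem card_le_numEdges (hc : G.toSimpleGraphInclusive.Connected) :
    Fintype.card V ≤ numEdges G + 1 := by
  classical
  have h := hc.card_vert_le_card_edgeSet_add_one
  rw [Nat.card_eq_fintype_card] at h
  refine h.trans (Nat.add_le_add_right ?_ 1)
  have : G.toSimpleGraphInclusive.edgeSet ⊆
      (fun p : V × V => s(p.1, p.2)) '' {p : V × V | G.Adj p.1 p.2} := by
    intro e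
    induction e with
    | _ a b =>
      intro h
      rcases h.2 with h | h
      · exact ⟨(a, b), h, rfl⟩
      · exact ⟨(b, a), h, Sym2.eq_swap⟩
  rw [Nat.card_coe_set_eq]
  exact (Set.ncard_le_ncard this (Set.toFinite _)).trans (Set.ncard_image_le (Set.toFinite _))

/-- A connected dag with at most one edge is degenerate. -/
theorem two_le_numEdges (hG : IsDag G) (hc : G.toSimpleGraphInclusive.Connected)
    (hd : ¬ IsDegenerate G) : 2 ≤ numEdges G := by
  by_contra hlt
  apply hd
  -- With at most one edge there are at most two vertices, and the rank is a utility for a weak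
  -- order: a vertex of larger rank has a predecessor, which can only be the other vertex.
  refine ⟨fun v => rk G v, fun u v => ⟨fun h => Nat.cast_lt.2 (rk_lt hG h), fun h => ?_⟩⟩
  have hcard := card_le_numEdges hc
  have h : rk G u < rk G v := Nat.cast_lt.1 h
  have huv : u ≠ v := by rintro rfl; exact lt_irrefl _ h
  have hV : ∀ w, w = u ∨ w = v := by
    classical
    intro w
    by_contra! hw
    have : ({w, u, v} : Finset V).card = 3 := by
      rw [Finset.card_eq_three]; exact ⟨w, u, v, hw.1, hw.2, huv, rfl⟩
    have := Finset.card_le_univ ({w, u, v} : Finset V)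
    omega
  have hpos : 0 < rk G v := by omega
  obtain ⟨x, hx⟩ := Finset.card_pos.1 hpos
  simp only [Finset.mem_filter, Finset.mem_univ, true_and] at hx
  obtain ⟨y, -, hy⟩ := Relation.TransGen.tail'_iff.1 hx
  rcases hV y with rfl | rfl
  · exact hy
  · exact absurd hy (IsDag.irrefl hG _)

end Graph

end MaxClique

/-! ### Counting cliques and extension candidates. -/

namespace MaxClique

open DoubleThreshold

section Counting

set_option linter.unusedSectionVars false

open scoped Classical

variable {V : Type*} [Fintype V] {G : Digraph V}

/-- The cliques with `k` vertices. -/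
noncomputable def cliq (G : Digraph V) (k : ℕ) : Finset (List V) :=
  (List.finite_length_eq V k).toFinset.filter fun c => IsCl G c

/-- The number of cliques that extend the clique `c` by a new last vertex. -/
noncomputable def nch (G : Digraph V) (c : List V) : ℕ :=
  (Finset.univ.filter fun w => IsCl G (w :: c)).card

/-- The clique that consists of the first vertex of `c` alone. -/
def fst (c : List V) : List V := c.drop (c.length - 1)

/-- The number of candidates that are tried when the `k`-cliques are extended. -/
noncomputable def stageCost (G : Digraph V) (k : ℕ) : ℕ :=
  ∑ c ∈ cliq G k, (1 + min (nch G (fst c)) (nch G c.dropLast))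

noncomputable def edges (G : Digraph V) : Finset (V × V) := Finset.univ.filter fun p => G.Adj p.1 p.2

theorem card_edges : (edges G).card = numEdges G := by
  rw [numEdges, ← Set.ncard_coe_finset]; congr 1; ext; simp [edges]

@[simp] theorem mem_edges {u v : V} : (u, v) ∈ edges G ↔ G.Adj u v := by simp [edges]

@[simp] theorem mem_cliq {k : ℕ} {c : List V} : c ∈ cliq G k ↔ c.length = k ∧ IsCl G c := by
  simp [cliq]

theorem isCl_pair {u v : V} : IsCl G [v, u] ↔ G.Adj u v := by simp [IsCl]

theorem fst_cons {w : V} {c : List V} (hc : c ≠ []) : fst (w :: c) = fst c := by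
  obtain ⟨x, c, rfl⟩ := List.exists_cons_of_ne_nil hc
  simp [fst]

theorem fst_concat (c : List V) (u : V) : fst (c ++ [u]) = [u] := by
  simp [fst]

theorem nch_le_fst (c : List V) : nch G c ≤ nch G (fst c) := by
  refine Finset.card_le_card fun w hw => ?_
  simp only [Finset.mem_filter, Finset.mem_univ, true_and] at hw ⊢
  exact hw.sublist (List.cons_sublist_cons.2 (List.drop_sublist _ _))

theorem nch_le_dropLast (c : List V) : nch G c ≤ nch G c.dropLast := by
  refine Finset.card_le_card fun w hw => ?_
  simp only [Finset.mem_filter, Finset.mem_univ, true_and] at hw ⊢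
  exact hw.sublist (List.cons_sublist_cons.2 (List.dropLast_sublist _))

theorem card_cliq_succ_le (k : ℕ) : (cliq G (k + 1)).card ≤ ∑ c ∈ cliq G k, nch G c := by
  rw [show ∑ c ∈ cliq G k, nch G c = ((cliq G k).sigma fun c =>
    Finset.univ.filter fun w => IsCl G (w :: c)).card by rw [Finset.card_sigma]; rfl]
  refine Finset.card_le_card_of_surjOn (fun p => p.2 :: p.1) ?_
  rintro (_ | ⟨w, c⟩) hc
  · simp at hc
  · simp only [Finset.mem_coe, mem_cliq, List.length_cons, Nat.add_right_cancel_iff] at hc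
    refine ⟨⟨c, w⟩, ?_, rfl⟩
    simp [hc.1, hc.2, (isCl_cons.1 hc.2).2]

/-- A clique is determined by all but its last two vertices together with the edge that joins these
two. -/
theorem card_cliq_add_two_le (k : ℕ) :
    (cliq G (k + 2)).card ≤ (cliq G k).card * numEdges G := by
  rw [← card_edges, ← Finset.card_product]
  refine Finset.card_le_card_of_surjOn (fun p => p.2.2 :: p.2.1 :: p.1) ?_
  rintro (_ | ⟨w, _ | ⟨u, c⟩⟩) hc
  · simp at hc
  · simp at hc
  · simp only [Finset.mem_coe, mem_cliq, List.length_cons, Nat.add_right_cancel_iff,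
      isCl_cons] at hc
    refine ⟨⟨c, u, w⟩, ?_, rfl⟩
    simp [hc.1, hc.2.2.2, hc.2.1 u]

/-- Let `w` be a candidate for `c = x :: y :: d`. Since `x` survives in `c.dropLast`, it has an edge
to `w`. The pair of `c` and `w` is therefore determined by the clique `y :: d` and the edge from `x`
to `w`. -/
theorem sum_nch_dropLast_le (k : ℕ) :
    ∑ c ∈ cliq G (k + 2), nch G c.dropLast ≤ (cliq G (k + 1)).card * numEdges G := by
  rw [show ∑ c ∈ cliq G (k + 2), nch G c.dropLast = ((cliq G (k + 2)).sigma fun c =>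
    Finset.univ.filter fun w => IsCl G (w :: c.dropLast)).card by rw [Finset.card_sigma]; rfl,
    ← card_edges, ← Finset.card_product]
  refine Finset.card_le_card_of_surjOn
    (fun p => (⟨p.2.1 :: p.1, p.2.2⟩ : (_ : List V) × V)) ?_
  rintro ⟨_ | ⟨x, _ | ⟨y, c⟩⟩, w⟩ hc
  · simp at hc
  · simp at hc
  · simp only [Finset.coe_sigma, Set.mem_sigma_iff, Finset.mem_coe, mem_cliq, List.length_cons,
    Nat.add_right_cancel_iff, Finset.mem_filter, Finset.mem_univ, true_and,
      List.dropLast_cons_cons] at hc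
    refine ⟨⟨y :: c, x, w⟩, ?_, rfl⟩
    simp [hc.1.1, (isCl_cons.1 hc.1.2).2, (isCl_cons.1 hc.2).1 x]

theorem sum_cliq_two {M : Type*} [AddCommMonoid M] (f : List V → M) :
    ∑ c ∈ cliq G 2, f c = ∑ p ∈ edges G, f [p.2, p.1] := by
  symm
  refine Finset.sum_bij (fun p _ => [p.2, p.1]) ?_ ?_ ?_ ?_
  · rintro ⟨u, v⟩ h
    simpa [isCl_pair] using h
  · rintro ⟨u, v⟩ _ ⟨u', v'⟩ _ h
    simpa [and_comm] using h
  · intro c hc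
    rw [mem_cliq] at hc
    obtain ⟨v, u, rfl⟩ := List.length_eq_two.1 hc.1
    exact ⟨(u, v), by simpa [isCl_pair] using hc.2, rfl⟩
  · intros; rfl

theorem card_cliq_two : (cliq G 2).card = numEdges G := by
  rw [Finset.card_eq_sum_ones, sum_cliq_two, ← Finset.card_eq_sum_ones, card_edges]

theorem sum_edges {M : Type*} [AddCommMonoid M] (f : V × V → M) :
    ∑ p ∈ edges G, f p = ∑ u, ∑ v ∈ Finset.univ.filter (fun v => G.Adj u v), f (u, v) := by
  rw [edges, ← Finset.univ_product_univ, Finset.sum_filter, Finset.sum_product]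
  simp_rw [Finset.sum_filter]

theorem nch_singleton (u : V) : nch G [u] = (Finset.univ.filter fun v => G.Adj u v).card := by
  simp [nch, isCl_pair]

theorem sum_nch_singleton : ∑ u, nch G [u] = numEdges G := by
  rw [← card_edges, Finset.card_eq_sum_ones, sum_edges]
  simp [nch_singleton]

/-- The sum over all edges of the smaller out-degree of the two ends. -/
theorem sum_min_nch_le {s : ℝ} (hs : 0 < s) (hm : s ^ 2 = numEdges G) :
    ∑ p ∈ edges G, (min (nch G [p.1]) (nch G [p.2]) : ℝ) ≤ 2 * s ^ 3 := by
  -- With `s = √m`, the out-degrees sum to `s²`, so at most `s` vertices have out-degree above `s`.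
  -- An edge whose head is not among these contributes at most `s`, in total at most `s³`. The
  -- others contribute at most the out-degree of their tail, and each tail has at most `s` such
  -- edges: again `s³`.
  let H : Finset V := Finset.univ.filter fun v => s < nch G [v]
  have hsum : ∑ u, (nch G [u] : ℝ) = s ^ 2 := by
    rw [hm, ← sum_nch_singleton]; push_cast; rfl
  have hH : (H.card : ℝ) ≤ s := by
    have h1 : H.card * s ≤ ∑ u, (nch G [u] : ℝ) := by
      calc H.card * s = ∑ u ∈ H, s := by simp
        _ ≤ ∑ u ∈ H, (nch G [u] : ℝ) := Finset.sum_le_sum fun u hu => by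
            simp only [H, Finset.mem_filter] at hu; exact hu.2.le
        _ ≤ _ := Finset.sum_le_sum_of_subset_of_nonneg (Finset.subset_univ _)
            fun _ _ _ => Nat.cast_nonneg _
    rw [hsum, sq] at h1
    exact le_of_mul_le_mul_right h1 hs
  have h1 : ∀ p ∈ edges G, (min (nch G [p.1]) (nch G [p.2]) : ℝ) ≤
      s + if p.2 ∈ H then (nch G [p.1] : ℝ) else 0 := by
    intro p _
    split_ifs with h
    · exact (min_le_left _ _).trans (by linarith)
    · simp only [H, Finset.mem_filter, Finset.mem_univ, true_and, not_lt] at h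
      exact (min_le_right _ _).trans (by linarith)
  refine (Finset.sum_le_sum h1).trans ?_
  rw [Finset.sum_add_distrib, Finset.sum_const, card_edges, nsmul_eq_mul, ← hm, sum_edges]
  have h2 : ∀ u ∈ Finset.univ, ∑ v ∈ Finset.univ.filter (fun v => G.Adj u v),
      (if v ∈ H then (nch G [u] : ℝ) else 0) ≤ s * nch G [u] := by
    intro u _
    rw [← Finset.sum_filter, Finset.sum_const, nsmul_eq_mul]
    refine mul_le_mul_of_nonneg_right (le_trans ?_ hH) (Nat.cast_nonneg _)
    exact_mod_cast Finset.card_le_card fun v hv => (Finset.mem_filter.1 hv).2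
  have h3 := Finset.sum_le_sum h2
  rw [← Finset.mul_sum, hsum] at h3
  simp only at h3 ⊢
  nlinarith

theorem stageCost_two_le {s : ℝ} (hs : 1 ≤ s) (hm : s ^ 2 = numEdges G) :
    (stageCost G 2 : ℝ) ≤ 3 * s ^ 3 := by
  have h := sum_min_nch_le (by linarith) hm
  rw [stageCost, sum_cliq_two, Finset.sum_add_distrib, ← Finset.card_eq_sum_ones, card_edges]
  simp only [fst, List.length_cons, List.length_nil, List.dropLast_cons_cons, List.dropLast_singleton]
  simp only [zero_add, Nat.reduceAdd, Nat.add_one_sub_one, List.drop_succ_cons, List.drop_zero]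
  push_cast
  rw [← hm]
  nlinarith [mul_nonneg (sq_nonneg s) (sub_nonneg.2 hs)]

/-- Adding two vertices costs a factor `m = s²`, so the two parities need separate starting points:
the edges for `k = 2`, and for `k = 3` the triangles, counted by the smaller out-degree along an
edge. -/
theorem card_cliq_le {s : ℝ} (hs : 1 ≤ s) (hm : s ^ 2 = numEdges G) :
    ∀ k, 2 ≤ k → ((cliq G k).card : ℝ) ≤ 2 * s ^ k
  | 0, h => by omega
  | 1, h => by omega
  | 2, _ => by rw [card_cliq_two, ← hm]; nlinarith [sq_nonneg s]
  | 3, _ => by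
    refine le_trans ?_ (sum_min_nch_le (by linarith) hm)
    have h1 : (cliq G 3).card ≤ ∑ c ∈ cliq G 2, min (nch G (fst c)) (nch G c.dropLast) := by
      exact (card_cliq_succ_le 2).trans (Finset.sum_le_sum fun c _ => le_min (nch_le_fst c)
        (nch_le_dropLast c))
    rw [sum_cliq_two] at h1
    simp only [fst, List.length_cons, List.length_nil, List.dropLast_cons_cons,
      List.dropLast_singleton] at h1
    exact_mod_cast h1
  | k + 4, _ => by
    have h1 := card_cliq_le hs hm (k + 2) (by omega)
    have h2 : ((cliq G (k + 4)).card : ℝ) ≤ (cliq G (k + 2)).card * s ^ 2 := by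
      rw [hm]; exact_mod_cast card_cliq_add_two_le (k + 2)
    calc _ ≤ _ := h2
      _ ≤ 2 * s ^ (k + 2) * s ^ 2 := by gcongr
      _ = _ := by ring

/-- For `k ≥ 3` the cliques themselves and their candidates each contribute `2 s ^ (k + 1)`. For `k
= 2` the same argument would involve the 1-cliques, whose number is not bounded by a multiple of
`s`, and the minimum of the two candidate sets is really needed. -/
theorem stageCost_le {s : ℝ} (hs : 1 ≤ s) (hm : s ^ 2 = numEdges G) (k : ℕ) (hk : 2 ≤ k) :
    (stageCost G k : ℝ) ≤ 4 * s ^ (k + 1) := by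
  obtain ⟨k, rfl⟩ := Nat.exists_eq_add_of_le' hk
  rcases k with _ | k
  · refine (stageCost_two_le hs hm).trans ?_
    have : 0 ≤ s ^ 3 := by positivity
    simp only [zero_add, Nat.reduceAdd]
    linarith
  · have h1 : stageCost G (k + 3) ≤ (cliq G (k + 3)).card + (cliq G (k + 2)).card * numEdges G := by
      rw [stageCost, Finset.sum_add_distrib, ← Finset.card_eq_sum_ones]
      exact Nat.add_le_add_left ((Finset.sum_le_sum fun c _ => min_le_right _ _).trans
        (sum_nch_dropLast_le (k + 1))) _
    have h2 := card_cliq_le hs hm (k + 2) (by omega)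
    have h3 := card_cliq_le hs hm (k + 3) (by omega)
    have h4 : (stageCost G (k + 3) : ℝ) ≤ (cliq G (k + 3)).card + (cliq G (k + 2)).card * s ^ 2 := by
      rw [hm]; exact_mod_cast h1
    have h5 : s ^ (k + 3) ≤ s ^ (k + 4) := pow_le_pow_right₀ hs (by omega)
    have h6 : ((cliq G (k + 2)).card : ℝ) * s ^ 2 ≤ 2 * s ^ (k + 2) * s ^ 2 := by gcongr
    have h7 : s ^ (k + 4) = s ^ (k + 2) * s ^ 2 := by ring
    simp only [show k + 1 + 2 + 1 = k + 4 by ring, show k + 1 + 2 = k + 3 by ring]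
    linarith

end Counting

end MaxClique

/-! ### The clique tree in memory and the invariants of a stage. -/

namespace MaxClique

open DoubleThreshold WordRAM

section Invariants

variable {n : ℕ} {G : Digraph (Fin n)}

/-- The address of the clique `c` in a memory that holds the list `nd` of cliques, each of which
occupies a block of `n` cells; `0` if `c` is not in the list. -/
def code (nd : List (List (Fin n))) (c : List (Fin n)) : ℕ :=
  if c ∈ nd then (nd.idxOf c + 1) * n else 0

theorem code_of_not_mem {nd : List (List (Fin n))} {c : List (Fin n)} (h : c ∉ nd) :
    code nd c = 0 := if_neg h

theorem code_append {nd l : List (List (Fin n))} {c : List (Fin n)} (h : c ∈ nd) :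
    code (nd ++ l) c = code nd c := by
  rw [code, code, if_pos h, if_pos (List.mem_append_left _ h), List.idxOf_append_of_mem h]

theorem code_concat_of_ne {nd : List (List (Fin n))} {c e : List (Fin n)} (h : c ≠ e) :
    code (nd ++ [e]) c = code nd c := by
  by_cases hc : c ∈ nd
  · exact code_append hc
  · rw [code_of_not_mem hc, code_of_not_mem (by simp [hc, h])]

theorem code_split {l₁ l₂ : List (List (Fin n))} {c : List (Fin n)} (h : (l₁ ++ c :: l₂).Nodup) :
    code (l₁ ++ c :: l₂) c = (l₁.length + 1) * n := by
  have : c ∉ l₁ := fun hc => (List.disjoint_of_nodup_append h) hc (by simp)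
  rw [code, if_pos (by simp), List.idxOf_append_of_notMem this]
  simp

theorem code_concat_self {nd : List (List (Fin n))} {e : List (Fin n)} (h : e ∉ nd) :
    code (nd ++ [e]) e = (nd.length + 1) * n := by
  rw [code, if_pos (by simp), List.idxOf_append_of_notMem h]
  simp

/-- Distinct nodes own disjoint blocks of `n` cells; quotient and remainder by `n` recover the node
and the offset. -/
theorem code_inj {nd : List (List (Fin n))} {c c' : List (Fin n)} (hc : c ∈ nd) (hc' : c' ∈ nd)
    {w w' : Fin n} (h : code nd c + w = code nd c' + w') : c = c' ∧ w = w' := by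
  rw [code, code, if_pos hc, if_pos hc'] at h
  have hn : 0 < n := w.pos
  have h1 : ∀ (i : ℕ) (w : Fin n), (i * n + w) / n = i := fun i w => by
    rw [mul_comm, Nat.mul_add_div hn, Nat.div_eq_of_lt w.2, add_zero]
  have h2 : nd.idxOf c + 1 = nd.idxOf c' + 1 := by
    have h3 := congrArg (· / n) h
    simpa only [h1] using h3
  rw [h2] at h
  exact ⟨(List.idxOf_inj hc).1 (by omega), Fin.ext (by omega)⟩

theorem code_inj' (hn : 0 < n) {nd : List (List (Fin n))} {c c' : List (Fin n)} (hc : c ∈ nd)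
    (hc' : c' ∈ nd) (h : code nd c = code nd c') : c = c' :=
  (code_inj hc hc' (w := ⟨0, hn⟩) (w' := ⟨0, hn⟩) (by simpa using h)).1

theorem code_add_le {nd : List (List (Fin n))} {c : List (Fin n)} (hc : c ∈ nd) :
    code nd c + n ≤ (nd.length + 1) * n := by
  rw [code, if_pos hc, ← Nat.succ_mul]
  exact Nat.mul_le_mul_right _ (Nat.succ_le_succ (List.idxOf_lt_length_of_mem hc))

theorem code_lt (hn : 0 < n) {nd : List (List (Fin n))} {c : List (Fin n)} (hc : c ∈ nd) :
    code nd c < (nd.length + 1) * n := by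
  have := code_add_le hc
  omega

theorem code_eq_zero (hn : 0 < n) {nd : List (List (Fin n))} {c : List (Fin n)} :
    code nd c = 0 ↔ c ∉ nd := by
  refine ⟨fun h hc => ?_, code_of_not_mem⟩
  rw [code, if_pos hc] at h
  have := Nat.mul_pos (Nat.succ_pos (nd.idxOf c)) hn
  simp at h
  omega

theorem code_le (nd : List (List (Fin n))) (c : List (Fin n)) :
    code nd c ≤ (nd.length + 1) * n := by
  by_cases hc : c ∈ nd
  · have := code_add_le hc
    omega
  · simp [code_of_not_mem hc]

/-- The memory holds the cliques in `nd`, with their links. -/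
structure Tree (G : Digraph (Fin n)) (nd : List (List (Fin n))) (s : State) : Prop where
  nodup : nd.Nodup
  isCl : ∀ c ∈ nd, IsCl G c
  ne_nil : ∀ c ∈ nd, c ≠ []
  tail_mem : ∀ w c, w :: c ∈ nd → c ≠ [] → c ∈ nd
  suffix_mem : ∀ w c, c ≠ [] → w :: c ∈ nd → w :: c.dropLast ∈ nd
  mem_single : ∀ u, [u] ∈ nd
  code_single : ∀ u : Fin n, code nd [u] = (u + 1) * n
  stride : s.var 0 = n
  fresh : s.var 3 = (nd.length + 1) * n
  base : ∀ u : Fin n, s.arr 2 u = (u + 1) * n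
  last : ∀ w c, w :: c ∈ nd → s.arr 7 (code nd (w :: c)) = w
  first : ∀ w c, c ≠ [] → w :: c ∈ nd → s.arr 8 (code nd (w :: c)) = code nd (fst c)
  suffix : ∀ w c, c ≠ [] → w :: c ∈ nd → s.arr 9 (code nd (w :: c)) = code nd (w :: c.dropLast)
  parent : ∀ w c, w :: c ∈ nd → s.arr 10 (code nd (w :: c)) = code nd c
  child : ∀ c ∈ nd, ∀ w : Fin n, s.arr 11 (code nd c + w) = code nd (w :: c)
  -- Memory is initially 0, so the child table of a new node is already empty, and a node is
  -- allocated in constant time although its table has `n` entries.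
  child_fresh : ∀ i, (nd.length + 1) * n ≤ i → s.arr 11 i = 0

theorem Tree.congr {nd : List (List (Fin n))} {s s' : State} (h : Tree G nd s)
    (h₀ : s'.var 0 = s.var 0) (h₃ : s'.var 3 = s.var 3)
    (ha : ∀ a ∈ [2, 7, 8, 9, 10, 11], s'.arr a = s.arr a) : Tree G nd s' where
  nodup := h.nodup
  isCl := h.isCl
  ne_nil := h.ne_nil
  tail_mem := h.tail_mem
  suffix_mem := h.suffix_mem
  mem_single := h.mem_single
  code_single := h.code_single
  stride := h₀.trans h.stride
  fresh := h₃.trans h.fresh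
  base := by rw [ha 2 (by simp)]; exact h.base
  last := by rw [ha 7 (by simp)]; exact h.last
  first := by rw [ha 8 (by simp)]; exact h.first
  suffix := by rw [ha 9 (by simp)]; exact h.suffix
  parent := by rw [ha 10 (by simp)]; exact h.parent
  child := by rw [ha 11 (by simp)]; exact h.child
  child_fresh := by rw [ha 11 (by simp)]; exact h.child_fresh

theorem fst_mem {nd : List (List (Fin n))} {s : State} (h : Tree G nd s) {c : List (Fin n)}
    (hc : c ≠ []) : fst c ∈ nd := by
  rw [← List.dropLast_append_getLast hc, fst_concat]
  exact h.mem_single _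

/-- Appending to `nd` leaves the addresses of the old nodes unchanged. Apart from cells at the fresh
address, only the entry `w` in the child table of `c` is written, and by `code_inj` it belongs to no
other pair. -/
theorem Tree.snoc {nd : List (List (Fin n))} {s s' : State} (h : Tree G nd s) {w : Fin n}
    {c : List (Fin n)} (hc : c ∈ nd) (hw : w :: c ∉ nd) (hcl : IsCl G (w :: c))
    (hd : w :: c.dropLast ∈ nd)
    (h₀ : s'.var 0 = s.var 0) (h₃ : s'.var 3 = s.var 3 + n) (h₂ : s'.arr 2 = s.arr 2)
    (h₇ : s'.arr 7 = Function.update (s.arr 7) (s.var 3) w)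
    (h₈ : s'.arr 8 = Function.update (s.arr 8) (s.var 3) (code nd (fst c)))
    (h₉ : s'.arr 9 = Function.update (s.arr 9) (s.var 3) (code nd (w :: c.dropLast)))
    (h₁₀ : s'.arr 10 = Function.update (s.arr 10) (s.var 3) (code nd c))
    (h₁₁ : s'.arr 11 = Function.update (s.arr 11) (code nd c + w) (s.var 3)) :
    Tree G (nd ++ [w :: c]) s' := by
  have hn : 0 < n := w.pos
  have hcn : c ≠ [] := h.ne_nil c hc
  have hlt : ∀ d ∈ nd, code nd d ≠ s.var 3 := fun d hd => by
    rw [h.fresh]; exact (code_lt hn hd).ne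
  have hself : code (nd ++ [w :: c]) (w :: c) = s.var 3 := by rw [code_concat_self hw, h.fresh]
  have hmem : ∀ d, d ∈ nd ++ [w :: c] → d ∈ nd ∨ d = w :: c := by simp
  have hnil : ∀ d ∈ nd ++ [w :: c], d ≠ [] := by
    intro d hd
    rcases hmem d hd with hd | rfl
    · exact h.ne_nil d hd
    · simp
  have hne : ∀ d, d ∈ nd → d ≠ w :: c := fun d hd he => hw (he ▸ hd)
  refine ⟨?_, ?_, hnil, ?_, ?_, ?_, ?_, h₀.trans h.stride, ?_, ?_, ?_, ?_, ?_, ?_, ?_, ?_⟩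
  · exact List.nodup_append.2 ⟨h.nodup, List.nodup_singleton _, by simpa using hne⟩
  · intro d hd
    rcases hmem d hd with hd | rfl
    · exact h.isCl d hd
    · exact hcl
  · intro x d hx hdn
    rcases hmem _ hx with hx | hx
    · exact List.mem_append_left _ (h.tail_mem x d hx hdn)
    · cases hx; exact List.mem_append_left _ hc
  · intro x d hdn hx
    rcases hmem _ hx with hx | hx
    · exact List.mem_append_left _ (h.suffix_mem x d hdn hx)
    · cases hx; exact List.mem_append_left _ hd
  · exact fun u => List.mem_append_left _ (h.mem_single u)
  · exact fun u => by rw [code_append (h.mem_single u), h.code_single]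
  · rw [h₃, h.fresh]; simp; ring
  · rw [h₂]; exact h.base
  · intro x d hx
    rw [h₇]
    rcases hmem _ hx with hx | hx
    · rw [code_append hx, Function.update_of_ne (hlt _ hx), h.last x d hx]
    · rw [hx, hself, Function.update_self]; cases hx; rfl
  · intro x d hdn hx
    rw [h₈]
    rcases hmem _ hx with hx | hx
    · rw [code_append hx, Function.update_of_ne (hlt _ hx), h.first x d hdn hx,
        code_append (fst_mem h hdn)]
    · rw [hx, hself, Function.update_self]; cases hx; rw [code_append (fst_mem h hdn)]
  · intro x d hdn hx
    rw [h₉]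
    rcases hmem _ hx with hx | hx
    · rw [code_append hx, Function.update_of_ne (hlt _ hx), h.suffix x d hdn hx]
      rw [code_append (h.suffix_mem x d hdn hx)]
    · rw [hx, hself, Function.update_self]; cases hx; rw [code_append hd]
  · intro x d hx
    rw [h₁₀]
    rcases hmem _ hx with hx | hx
    · rw [code_append hx, Function.update_of_ne (hlt _ hx), h.parent x d hx]
      rcases eq_or_ne d [] with rfl | hdn
      · rw [code_of_not_mem fun h' => h.ne_nil _ h' rfl, code_of_not_mem fun h' => hnil _ h' rfl]
      · rw [code_append (h.tail_mem x d hx hdn)]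
    · rw [hx, hself, Function.update_self]; cases hx; rw [code_append hc]
  · intro d hd x
    rw [h₁₁]
    rcases hmem _ hd with hd | rfl
    · rw [code_append hd]
      by_cases he : x :: d = w :: c
      · cases he
        rw [Function.update_self, hself]
      · rw [Function.update_of_ne, h.child d hd, code_concat_of_ne he]
        intro h'
        obtain ⟨rfl, rfl⟩ := code_inj hd hc h'
        exact he rfl
    -- The new node has no children yet: a stored child would force the node itself to be in `nd`
    -- already, by `tail_mem`.
    · have h1 := code_add_le hc
      rw [hself, Function.update_of_ne, h.child_fresh, code_of_not_mem]
      · simp only [List.mem_append, List.mem_singleton, not_or]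
        refine ⟨fun h' => hw (h.tail_mem x _ h' (by simp)), fun h' => ?_⟩
        simpa using congrArg List.length h'
      · rw [h.fresh]; omega
      · rw [h.fresh]; omega
  · intro i hi
    have h1 := code_add_le hc
    simp only [List.length_append, List.length_singleton] at hi
    have h2 : (nd.length + 1) * n ≤ i := le_trans (Nat.mul_le_mul_right _ (by omega)) hi
    rw [h₁₁, Function.update_of_ne, h.child_fresh i h2]
    omega

/-- The state of the search for longest `k`-walks: `wk b` is the walk that has been found for the
window `b`, and the windows that satisfy `pr` have been processed. -/
structure Walks (G : Digraph (Fin n)) (k : ℕ) (nd : List (List (Fin n)))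
    (pr : List (Fin n) → Prop) (wk : List (Fin n) → List (Fin n)) (s : State) : Prop where
  len : ∀ b ∈ nd, b.length = k → s.arr 12 (code nd b) = (wk b).length
  walk : ∀ b ∈ nd, b.length = k → KW G k (wk b)
  window : ∀ b ∈ nd, b.length = k → (wk b).take k = b
  -- A walk is stored only through its last window and the predecessor of this window. The
  -- predecessor is required to be processed, so that its own walk no longer changes.
  trace : ∀ b ∈ nd, b.length = k → (wk b = b ∧ s.arr 13 (code nd b) = 0) ∨
    ∃ c ∈ nd, pr c ∧ c.length = k ∧ s.arr 13 (code nd b) = code nd c ∧ ∃ w, wk b = w :: wk c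
  kids : ∀ w c, w :: c ∈ nd → c.length = k → pr c
  -- The dynamic programming inequality along each arc found so far. It suffices for comparing with
  -- cliques in `IsCl.length_le_of_step`; that `wk b` is the longest `k`-walk ending in `b` is never
  -- proved.
  step : ∀ w c, w :: c ∈ nd → c.length = k → (wk c).length + 1 ≤ (wk (w :: c.dropLast)).length
  next_len : ∀ e ∈ nd, e.length = k + 1 → s.arr 12 (code nd e) = k + 1
  next_trace : ∀ e ∈ nd, e.length = k + 1 → s.arr 13 (code nd e) = 0
  trace_fresh : ∀ i, (nd.length + 1) * n ≤ i → s.arr 13 i = 0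

theorem Walks.congr {k : ℕ} {nd : List (List (Fin n))} {pr pr' : List (Fin n) → Prop}
    {wk : List (Fin n) → List (Fin n)} {s s' : State} (h : Walks G k nd pr wk s)
    (hp : ∀ c, pr c → pr' c) (h₁₂ : s'.arr 12 = s.arr 12) (h₁₃ : s'.arr 13 = s.arr 13) :
    Walks G k nd pr' wk s' where
  len := by rw [h₁₂]; exact h.len
  walk := h.walk
  window := h.window
  trace := by
    rw [h₁₃]
    intro b hb hk
    exact (h.trace b hb hk).imp_right fun ⟨c, hc, hpr, hr⟩ => ⟨c, hc, hp c hpr, hr⟩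
  kids w c hw hk := hp c (h.kids w c hw hk)
  step := h.step
  next_len := by rw [h₁₂]; exact h.next_len
  next_trace := by rw [h₁₃]; exact h.next_trace
  trace_fresh := by rw [h₁₃]; exact h.trace_fresh

/-- Relaxation of the arc from `c` to `b = w :: c.dropLast`: the walk of `b` is replaced by `w :: wk
c` if this is longer. Since `b` is not processed, no trace refers to it and no arc found so far
leaves it, so lengthening its walk breaks none of the earlier relations. -/
theorem Walks.snoc {k : ℕ} (hk : 1 ≤ k) {nd : List (List (Fin n))} {pr : List (Fin n) → Prop}
    {wk : List (Fin n) → List (Fin n)} {s s' : State} (hT : Tree G nd s)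
    (h : Walks G k nd pr wk s)
    {w : Fin n} {c : List (Fin n)} (hc : c ∈ nd) (hck : c.length = k) (hpc : pr c)
    (hw : w :: c ∉ nd) (hcl : IsCl G (w :: c))
    (hd : w :: c.dropLast ∈ nd) (hpd : ¬ pr (w :: c.dropLast))
    (h₁₂ : s'.arr 12 = Function.update
      (if s.arr 12 (code nd (w :: c.dropLast)) < s.arr 12 (code nd c) + 1 then
        Function.update (s.arr 12) (code nd (w :: c.dropLast)) (s.arr 12 (code nd c) + 1)
        else s.arr 12) (s.var 3) (k + 1))
    (h₁₃ : s'.arr 13 =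
      if s.arr 12 (code nd (w :: c.dropLast)) < s.arr 12 (code nd c) + 1 then
        Function.update (s.arr 13) (code nd (w :: c.dropLast)) (code nd c) else s.arr 13) :
    ∃ wk', (∀ d, pr d → wk' d = wk d) ∧ Walks G k (nd ++ [w :: c]) pr wk' s' := by
  have hn : 0 < n := w.pos
  set b := w :: c.dropLast with hb
  have hbk : b.length = k := by simp [hb, hck]; omega
  have hbc : c ≠ b := fun he => hpd (he ▸ hpc)
  have hlt : ∀ d ∈ nd, code nd d ≠ s.var 3 := fun d hd => by
    rw [hT.fresh]; exact (code_lt hn hd).ne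
  have hself : code (nd ++ [w :: c]) (w :: c) = s.var 3 := by rw [code_concat_self hw, hT.fresh]
  have hmem : ∀ d, d ∈ nd ++ [w :: c] → d ∈ nd ∨ d = w :: c := by simp
  have hmemk : ∀ d, d ∈ nd ++ [w :: c] → d.length = k → d ∈ nd := by
    intro d hd hdk
    rcases hmem d hd with hd | rfl
    · exact hd
    · simp at hdk; omega
  have hbc' : ∀ d ∈ nd, d ≠ b → code nd d ≠ code nd b := fun d hd' hne he =>
    hne (code_inj' hn hd' hd he)
  rw [h.len b hd hbk, h.len c hc hck] at h₁₂ h₁₃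
  have hnext : ∀ e ∈ nd ++ [w :: c], e.length = k + 1 →
      s'.arr 12 (code (nd ++ [w :: c]) e) = k + 1 ∧ s'.arr 13 (code (nd ++ [w :: c]) e) = 0 := by
    intro e he hek
    rcases hmem e he with he | rfl
    · have heb : e ≠ b := fun h' => by rw [h'] at hek; omega
      rw [code_append he, h₁₂, h₁₃, Function.update_of_ne (hlt e he)]
      split_ifs
      · rw [Function.update_of_ne (hbc' e he heb), Function.update_of_ne (hbc' e he heb)]
        exact ⟨h.next_len e he hek, h.next_trace e he hek⟩
      · exact ⟨h.next_len e he hek, h.next_trace e he hek⟩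
    · rw [hself, h₁₂, h₁₃, Function.update_self]
      refine ⟨rfl, ?_⟩
      have := h.trace_fresh (s.var 3) hT.fresh.ge
      split_ifs
      · rwa [Function.update_of_ne (hlt b hd).symm]
      · exact this
  have hfresh : ∀ i, ((nd ++ [w :: c]).length + 1) * n ≤ i → s'.arr 13 i = 0 := by
    intro i hi
    have h2 : (nd.length + 1) * n ≤ i :=
      le_trans (Nat.mul_le_mul_right _ (by simp)) hi
    have h3 := code_lt hn hd
    rw [h₁₃]
    split_ifs
    · rw [Function.update_of_ne (by omega), h.trace_fresh i h2]
    · exact h.trace_fresh i h2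
  have hkids : ∀ x d, x :: d ∈ nd ++ [w :: c] → d.length = k → pr d := by
    intro x d hx hdk
    rcases hmem _ hx with hx | hx
    · exact h.kids x d hx hdk
    · cases hx; exact hpc
  by_cases hlen : (wk b).length < (wk c).length + 1
  · rw [if_pos hlen] at h₁₂ h₁₃
    have hwk : ∀ d, pr d → Function.update wk b (w :: wk c) d = wk d := fun d hpr =>
      Function.update_of_ne (fun he => hpd (by rw [← he]; exact hpr)) _ _
    refine ⟨Function.update wk b (w :: wk c), hwk, ?_, ?_, ?_, ?_, hkids, ?_,
      fun e he hek => (hnext e he hek).1, fun e he hek => (hnext e he hek).2, hfresh⟩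
    · intro d hd' hdk
      have hd' := hmemk d hd' hdk
      rw [code_append hd', h₁₂, Function.update_of_ne (hlt d hd')]
      rcases eq_or_ne d b with rfl | hdb
      · simp
      · rw [Function.update_of_ne (hbc' d hd' hdb), Function.update_of_ne hdb, h.len d hd' hdk]
    · intro d hd' hdk
      have hd' := hmemk d hd' hdk
      rcases eq_or_ne d b with rfl | hdb
      · rw [Function.update_self]
        refine ⟨?_, h.walk c hc hck⟩
        rw [h.window c hc hck]
        exact (isCl_cons.1 hcl).1
      · rw [Function.update_of_ne hdb]
        exact h.walk d hd' hdk
    · intro d hd' hdk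
      have hd' := hmemk d hd' hdk
      rcases eq_or_ne d b with rfl | hdb
      · rw [Function.update_self]
        obtain ⟨k, rfl⟩ := Nat.exists_eq_add_of_le' hk
        rw [List.take_succ_cons, hb, List.dropLast_eq_take, hck]
        conv_rhs => rw [← h.window c hc hck, List.take_take]
        simp
      · rw [Function.update_of_ne hdb]
        exact h.window d hd' hdk
    · intro d hd' hdk
      have hd' := hmemk d hd' hdk
      rw [code_append hd', h₁₃]
      rcases eq_or_ne d b with rfl | hdb
      · rw [Function.update_self, Function.update_self]
        exact .inr ⟨c, by simp [hc], hpc, hck, (code_append hc).symm, w, by rw [hwk c hpc]⟩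
      · rw [Function.update_of_ne (hbc' d hd' hdb), Function.update_of_ne hdb]
        refine (h.trace d hd' hdk).imp_right ?_
        rintro ⟨x, hx, hpx, hxk, hx', y, hy⟩
        exact ⟨x, by simp [hx], hpx, hxk, by rw [hx', code_append hx], y, by rw [hwk x hpx, hy]⟩
    · intro x d hx hdk
      rw [hwk d (hkids x d hx hdk)]
      rcases hmem _ hx with hx | hx
      · have h1 := h.step x d hx hdk
        rcases eq_or_ne (x :: d.dropLast) b with he | he
        · rw [he, Function.update_self]
          rw [he] at h1
          simp only [List.length_cons]
          omega
        · rwa [Function.update_of_ne he]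
      · cases hx
        rw [← hb, Function.update_self]
        simp
  · rw [if_neg hlen] at h₁₂ h₁₃
    refine ⟨wk, fun _ _ => rfl, ?_, ?_, ?_, ?_, hkids, ?_,
      fun e he hek => (hnext e he hek).1, fun e he hek => (hnext e he hek).2, hfresh⟩
    · intro d hd' hdk
      have hd' := hmemk d hd' hdk
      rw [code_append hd', h₁₂, Function.update_of_ne (hlt d hd'), h.len d hd' hdk]
    · exact fun d hd' hdk => h.walk d (hmemk d hd' hdk) hdk
    · exact fun d hd' hdk => h.window d (hmemk d hd' hdk) hdk
    · intro d hd' hdk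
      have hd' := hmemk d hd' hdk
      rw [code_append hd', h₁₃]
      refine (h.trace d hd' hdk).imp_right ?_
      rintro ⟨x, hx, hpx, hxk, hx', y, hy⟩
      exact ⟨x, by simp [hx], hpx, hxk, by rw [hx', code_append hx], y, hy⟩
    · intro x d hx hdk
      rcases hmem _ hx with hx | hx
      · exact h.step x d hx hdk
      · cases hx
        rw [← hb]
        omega

/-- The first vertex of the clique `b` has no edge to that of `a`. -/
def Before (G : Digraph (Fin n)) (a b : List (Fin n)) : Prop :=
  ∀ u ∈ fst a, ∀ v ∈ fst b, ¬ G.Adj v u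

/-- The children of the processed clique `x` are stored consecutively. -/
def Closed (G : Digraph (Fin n)) (nd : List (List (Fin n))) (s : State) (x : List (Fin n)) : Prop :=
  ∃ l₁ ch l₂, nd = l₁ ++ ch ++ l₂ ∧ s.arr 14 (code nd x) = (l₁.length + 1) * n ∧
    s.arr 15 (code nd x) = (l₁.length + ch.length + 1) * n ∧
    (∀ e ∈ ch, ∃ w, e = w :: x) ∧ ∀ w, IsCl G (w :: x) → w :: x ∈ ch

/-- The state of stage `k`: `base` lists the cliques with at most `k` vertices, the cliques in
`done` have been or are being processed, and `new` lists the extensions found so far. -/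
structure Stage (G : Digraph (Fin n)) (k : ℕ) (base done new : List (List (Fin n)))
    (wk : List (Fin n) → List (Fin n)) (s : State) : Prop where
  tree : Tree G (base ++ new) s
  walks : Walks G k (base ++ new) (· ∈ done) wk s
  mem_base : ∀ c, c ∈ base ↔ IsCl G c ∧ c ≠ [] ∧ c.length ≤ k
  done_isCl : ∀ c ∈ done, IsCl G c
  done_length : ∀ c ∈ done, c.length = k
  done_before : done.Pairwise (Before G)
  new_isCl : ∀ c ∈ new, IsCl G c
  new_length : ∀ c ∈ new, c.length = k + 1
  new_tail : ∀ w c, w :: c ∈ new → c ∈ done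
  new_before : new.Pairwise (Before G)
  level : s.var 11 = k
  pos : 1 ≤ k

theorem Stage.congr {k : ℕ} {base done new : List (List (Fin n))}
    {wk : List (Fin n) → List (Fin n)} {s s' : State} (h : Stage G k base done new wk s)
    (h₀ : s'.var 0 = s.var 0) (h₃ : s'.var 3 = s.var 3) (h₁₁ : s'.var 11 = s.var 11)
    (ha : ∀ a ∈ [2, 7, 8, 9, 10, 11, 12, 13], s'.arr a = s.arr a) :
    Stage G k base done new wk s' :=
  { h with
    tree := h.tree.congr h₀ h₃ fun a h' => ha a (by simp at h' ⊢; tauto)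
    walks := h.walks.congr (fun _ h => h) (ha 12 (by simp)) (ha 13 (by simp))
    level := h₁₁.trans h.level }

theorem adj_of_mem_fst {w : Fin n} {c : List (Fin n)} (hcl : IsCl G (w :: c)) {u v : Fin n}
    (hv : v ∈ fst c) (hu : u ∈ w :: c.dropLast) : G.Adj v u := by
  have hc : c ≠ [] := by rintro rfl; simp [fst] at hv
  have h2 := List.dropLast_append_getLast hc
  rw [← h2, fst_concat, List.mem_singleton] at hv
  rw [isCl_cons] at hcl
  rcases List.mem_cons.1 hu with rfl | hu
  · exact hcl.1 v (by rw [hv]; exact List.getLast_mem hc)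
  · have h3 := hcl.2
    rw [← h2, IsCl, List.pairwise_append] at h3
    exact h3.2.2 u hu v (by simp [hv])

theorem exists_mem_fst {c : List (Fin n)} (hc : c ≠ []) : ∃ v, v ∈ fst c ∧ v ∈ c := by
  refine ⟨c.getLast hc, ?_, List.getLast_mem hc⟩
  have h : fst c = [c.getLast hc] := by
    conv_lhs => rw [← List.dropLast_append_getLast hc, fst_concat]
  simp [h]

/-- `fst` has at most one element and a dag has no loops. Hence cliques with a common first vertex,
such as the children of one node, may be listed in any order. -/
theorem not_before_self (hG : IsDag G) {a c : List (Fin n)} (h : fst a = fst c) : Before G a c := by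
  intro u hu v hv hadj
  rw [h] at hu
  have hl : (fst c).length ≤ 1 := by simp [fst]; omega
  match hf : fst c, hl with
  | [], _ => simp [hf] at hu
  | [x], _ =>
    rw [hf, List.mem_singleton] at hu hv
    subst hu hv
    exact IsDag.irrefl hG _ hadj

/-- The first vertex of `c` has an edge to every vertex of the next window, in particular to its
first vertex. A window listed up to `c` cannot have this property, by `Before`. So arcs never lead
back to processed windows. -/
theorem Stage.not_mem_done (hG : IsDag G) {k : ℕ} {base done new : List (List (Fin n))}
    {wk : List (Fin n) → List (Fin n)} {s : State} {w : Fin n} {c : List (Fin n)}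
    (h : Stage G k base (done ++ [c]) new wk s) (hcl : IsCl G (w :: c)) :
    w :: c.dropLast ∉ done ++ [c] := by
  have hc : c ≠ [] := by
    rintro rfl
    have := h.done_length [] (by simp)
    have := h.pos
    simp at *
    omega
  have key : ¬ Before G (w :: c.dropLast) c := by
    intro hb
    obtain ⟨v, hv, -⟩ := exists_mem_fst hc
    obtain ⟨u, hu, hu'⟩ := exists_mem_fst (c := w :: c.dropLast) (by simp)
    exact hb u hu v hv (adj_of_mem_fst hcl hv hu')
  intro hmem
  rcases List.mem_append.1 hmem with hm | hm
  · exact key ((List.pairwise_append.1 h.done_before).2.2 _ hm c (by simp))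
  · rw [List.mem_singleton] at hm
    exact key (not_before_self hG (by rw [hm]))

theorem Stage.suffix_mem {k : ℕ} {base done new : List (List (Fin n))}
    {wk : List (Fin n) → List (Fin n)} {s : State} {w : Fin n} {c : List (Fin n)}
    (h : Stage G k base done new wk s) (hc : c ∈ done) (hcl : IsCl G (w :: c)) :
    w :: c.dropLast ∈ base := by
  rw [h.mem_base]
  have := h.done_length c hc
  have := h.pos
  refine ⟨hcl.sublist (List.cons_sublist_cons.2 (List.dropLast_sublist c)), by simp, ?_⟩
  simp
  omega

theorem Stage.done_mem {k : ℕ} {base done new : List (List (Fin n))}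
    {wk : List (Fin n) → List (Fin n)} {s : State} {c : List (Fin n)}
    (h : Stage G k base done new wk s) (hc : c ∈ done) : c ∈ base := by
  have h1 := h.done_length c hc
  have := h.pos
  exact (h.mem_base c).2 ⟨h.done_isCl c hc, by rintro rfl; simp at h1; omega, h1.le⟩

/-- The extension `w :: c` has the same first vertex as `c`, and the cliques already in `new` extend
cliques listed no later than `c`. Therefore `new` inherits the order `Before` from `done` and needs
no sorting before the next stage. -/
theorem Stage.snoc (hG : IsDag G) {k : ℕ} {base done new : List (List (Fin n))}
    {wk : List (Fin n) → List (Fin n)} {s s' : State} {w : Fin n} {c : List (Fin n)}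
    (h : Stage G k base (done ++ [c]) new wk s) (hcl : IsCl G (w :: c)) (hw : w :: c ∉ new)
    (hv : s'.var = Function.update s.var 3 (s.var 3 + n)) (h₂ : s'.arr 2 = s.arr 2)
    (h₇ : s'.arr 7 = Function.update (s.arr 7) (s.var 3) w)
    (h₈ : s'.arr 8 = Function.update (s.arr 8) (s.var 3) (code (base ++ new) (fst c)))
    (h₉ : s'.arr 9 =
      Function.update (s.arr 9) (s.var 3) (code (base ++ new) (w :: c.dropLast)))
    (h₁₀ : s'.arr 10 = Function.update (s.arr 10) (s.var 3) (code (base ++ new) c))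
    (h₁₁ : s'.arr 11 = Function.update (s.arr 11) (code (base ++ new) c + w) (s.var 3))
    (h₁₂ : s'.arr 12 = Function.update
      (if s.arr 12 (code (base ++ new) (w :: c.dropLast)) <
          s.arr 12 (code (base ++ new) c) + 1 then
        Function.update (s.arr 12) (code (base ++ new) (w :: c.dropLast))
          (s.arr 12 (code (base ++ new) c) + 1)
        else s.arr 12) (s.var 3) (k + 1))
    (h₁₃ : s'.arr 13 =
      if s.arr 12 (code (base ++ new) (w :: c.dropLast)) <
          s.arr 12 (code (base ++ new) c) + 1 then
        Function.update (s.arr 13) (code (base ++ new) (w :: c.dropLast)) (code (base ++ new) c)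
        else s.arr 13) :
    ∃ wk', (∀ d ∈ done ++ [c], wk' d = wk d) ∧
      Stage G k base (done ++ [c]) (new ++ [w :: c]) wk' s' := by
  have hcd : c ∈ done ++ [c] := by simp
  have hcb : c ∈ base ++ new := List.mem_append_left _ (h.done_mem hcd)
  have hck := h.done_length c hcd
  have hd : w :: c.dropLast ∈ base ++ new := List.mem_append_left _ (h.suffix_mem hcd hcl)
  have hwn : w :: c ∉ base ++ new := by
    rw [List.mem_append, not_or]
    refine ⟨fun h' => ?_, hw⟩
    have := ((h.mem_base _).1 h').2.2
    simp at this
    omega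
  obtain ⟨wk', hwd, hwk'⟩ := h.walks.snoc h.pos h.tree hcb hck hcd hwn hcl hd (h.not_mem_done hG hcl)
    h₁₂ h₁₃
  have hT := h.tree.snoc hcb hwn hcl hd (by simp [hv]) (by simp [hv]) h₂ h₇ h₈ h₉ h₁₀ h₁₁
  have hmem : ∀ d, d ∈ new ++ [w :: c] → d ∈ new ∨ d = w :: c := by simp
  refine ⟨wk', hwd, by rwa [← List.append_assoc], by rwa [← List.append_assoc], h.mem_base,
    h.done_isCl, h.done_length, h.done_before, ?_, ?_, ?_, ?_, by simpa [hv] using h.level, h.pos⟩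
  · intro d hd
    rcases hmem d hd with hd | rfl
    exacts [h.new_isCl d hd, hcl]
  · intro d hd
    rcases hmem d hd with hd | rfl
    exacts [h.new_length d hd, by simpa using hck]
  · intro x d hd
    rcases hmem _ hd with hd | hd
    · exact h.new_tail x d hd
    · cases hd; exact hcd
  · refine List.pairwise_append.2 ⟨h.new_before, List.pairwise_singleton _ _, ?_⟩
    intro a ha e he
    rw [List.mem_singleton] at he
    subst he
    have hpos := h.pos
    have hal := h.new_length a ha
    obtain ⟨x, d, rfl⟩ := List.exists_cons_of_ne_nil (l := a) (by rintro rfl; simp at hal)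
    have hd' := h.new_tail x d ha
    have hdn : d ≠ [] := by rintro rfl; simp at hal; omega
    have hcn : c ≠ [] := by rintro rfl; simp at hck; omega
    have key : Before G d c := by
      rcases List.mem_append.1 hd' with h1 | h1
      · exact (List.pairwise_append.1 h.done_before).2.2 d h1 c (by simp)
      · rw [List.mem_singleton] at h1
        exact not_before_self hG (by rw [h1])
    rw [Before, fst_cons hdn, fst_cons hcn]
    exact key

theorem Closed.congr {nd : List (List (Fin n))} {s s' : State} {x : List (Fin n)}
    (h : Closed G nd s x) (h₁₄ : s'.arr 14 = s.arr 14) (h₁₅ : s'.arr 15 = s.arr 15) :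
    Closed G nd s' x := by
  unfold Closed
  rwa [h₁₄, h₁₅]

theorem Closed.append {nd l : List (List (Fin n))} {s : State} {x : List (Fin n)}
    (h : Closed G nd s x) (hx : x ∈ nd) : Closed G (nd ++ l) s x := by
  obtain ⟨l₁, ch, l₂, rfl, h1, h2, h3⟩ := h
  exact ⟨l₁, ch, l₂ ++ l, by simp, by rwa [code_append hx], by rwa [code_append hx], h3⟩

theorem Closed.update (hn : 0 < n) {nd : List (List (Fin n))} {s s' : State} {x y : List (Fin n)}
    (h : Closed G nd s x) (hx : x ∈ nd) (hy : y ∈ nd) (hne : x ≠ y) {i j : ℕ}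
    (h₁₄ : s'.arr 14 = Function.update (s.arr 14) (code nd y) i)
    (h₁₅ : s'.arr 15 = Function.update (s.arr 15) (code nd y) j) : Closed G nd s' x := by
  have hc : code nd x ≠ code nd y := fun he => hne (code_inj' hn hx hy he)
  unfold Closed
  rwa [h₁₄, h₁₅, Function.update_of_ne hc, Function.update_of_ne hc]

/-- The stored block of children consists of distinct extensions of `x`. This turns the length of a
scan of the block into the quantity `nch` that is counted in `stageCost`. -/
theorem Closed.exists_length_le {nd : List (List (Fin n))} {s : State} {x : List (Fin n)}
    (h : Closed G nd s x) (hd : nd.Nodup) (hcl : ∀ c ∈ nd, IsCl G c) :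
    ∃ l₁ ch l₂, nd = l₁ ++ ch ++ l₂ ∧ s.arr 14 (code nd x) = (l₁.length + 1) * n ∧
    s.arr 15 (code nd x) = (l₁.length + ch.length + 1) * n ∧
    (∀ e ∈ ch, ∃ w, e = w :: x) ∧ (∀ w, IsCl G (w :: x) → w :: x ∈ ch) ∧
    ch.length ≤ nch G x := by
  classical
  obtain ⟨l₁, ch, l₂, rfl, h1, h2, h3, h4⟩ := h
  refine ⟨l₁, ch, l₂, rfl, h1, h2, h3, h4, ?_⟩
  have hch : ch.Nodup := hd.sublist (by simp)
  rw [← List.toFinset_card_of_nodup hch]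
  refine Finset.card_le_card_of_surjOn (fun w => w :: x) ?_
  intro e he
  simp only [Finset.mem_coe, List.mem_toFinset] at he
  obtain ⟨w, rfl⟩ := h3 e he
  exact ⟨w, by simpa using hcl _ (by simp [he]), rfl⟩

end Invariants

end MaxClique

/-! ### Creating a node and recording the best walk. -/

namespace MaxClique

open DoubleThreshold WordRAM

local infixr:60 " ;; " => Prog.seq

attribute [local simp] Expr.eval Expr.cost

section Create

variable {n : ℕ} {G : Digraph (Fin n)} {K W : ℕ} {Q : State → ℕ → Prop} {s : State} {τ : ℕ}

/-- The words are long enough for the cliques with at most `K + 1` vertices. -/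
structure Room (G : Digraph (Fin n)) (K W : ℕ) : Prop where
  nodes : ∀ l : List (List (Fin n)), l.Nodup → (∀ c ∈ l, IsCl G c ∧ c.length ≤ K + 1) →
    (l.length + 2) * n ≤ W
  card : n + 1 ≤ W
  edges : numEdges G + 1 ≤ W
  level : K + 2 ≤ W

theorem Room.fresh_le {k : ℕ} {base done new : List (List (Fin n))}
    {wk : List (Fin n) → List (Fin n)} (hR : Room G K W) (hk : k ≤ K)
    (h : Stage G k base done new wk s) : s.var 3 + n ≤ W := by
  have := hR.nodes (base ++ new) h.tree.nodup (fun c hc => ⟨h.tree.isCl c hc, by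
    rcases List.mem_append.1 hc with hc | hc
    · have := ((h.mem_base c).1 hc).2.2
      omega
    · have := h.new_length c hc
      omega⟩)
  rw [h.tree.fresh]
  linarith [add_mul (List.length (base ++ new) + 1) 1 n]

/-- Append vertex 9 to the clique 7, whose first vertex is 8; 10 is the resulting window. -/
def create : Prog :=
  .ite (.sub (.add (.get 12 (.var 7)) (.const 1)) (.get 12 (.var 10)))
    (.setArr 12 (.var 10) (.add (.get 12 (.var 7)) (.const 1)) ;; .setArr 13 (.var 10) (.var 7))
    .skip ;;
  .setArr 7 (.var 3) (.var 9) ;;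
  .setArr 8 (.var 3) (.var 8) ;;
  .setArr 9 (.var 3) (.var 10) ;;
  .setArr 10 (.var 3) (.var 7) ;;
  .setArr 12 (.var 3) (.add (.var 11) (.const 1)) ;;
  .setArr 11 (.add (.var 7) (.var 9)) (.var 3) ;;
  .setVar 3 (.add (.var 3) (.var 0))

theorem wp_create (hG : IsDag G) (hR : Room G K W) {k : ℕ} (hk : k ≤ K)
    {base done new : List (List (Fin n))} {wk : List (Fin n) → List (Fin n)} {w : Fin n}
    {c : List (Fin n)} (h : Stage G k base (done ++ [c]) new wk s) (hcl : IsCl G (w :: c))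
    (hw : w :: c ∉ new) (h7 : s.var 7 = code (base ++ new) c)
    (h8 : s.var 8 = code (base ++ new) (fst c)) (h9 : s.var 9 = w)
    (h10 : s.var 10 = code (base ++ new) (w :: c.dropLast))
    (hQ : ∀ s' τ' wk', Stage G k base (done ++ [c]) (new ++ [w :: c]) wk' s' →
      (∀ d ∈ done ++ [c], wk' d = wk d) → (∀ x, x ≠ 3 → s'.var x = s.var x) →
      (∀ a ∈ [0, 1, 2, 3, 4, 5, 6, 14, 15], s'.arr a = s.arr a) → τ' ≤ τ + 50 → Q s' τ') :
    WP W create Q s τ := by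
  have hn : 0 < n := w.pos
  have hcd : c ∈ done ++ [c] := by simp
  have hcb : c ∈ base ++ new := List.mem_append_left _ (h.done_mem hcd)
  have hck := h.done_length c hcd
  have hd : w :: c.dropLast ∈ base ++ new := List.mem_append_left _ (h.suffix_mem hcd hcl)
  have hfresh := hR.fresh_le hk h
  have h3 := h.tree.fresh
  have h0 := h.tree.stride
  have hlev := hR.level
  have h11 := h.level
  have hle1 := code_add_le hcb
  have hle2 := code_add_le hd
  have hle3 := code_le (base ++ new) (fst c)
  have hlenc : s.arr 12 (code (base ++ new) c) ≤ n := by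
    rw [h.walks.len c hcb hck]
    simpa using (h.walks.walk c hcb hck).length_le hG h.pos
  have hcard := hR.card
  have hw' := w.2
  refine WP.seq ?_
  -- The writes that allocate the node are the same whether or not the walk of the next window has
  -- been improved; `key` treats them once for both branches.
  have key : ∀ s' : State, ∀ τ', s'.var = s.var →
      (∀ a, a ≠ 12 → a ≠ 13 → s'.arr a = s.arr a) →
      (s'.arr 12 = if s.arr 12 (code (base ++ new) (w :: c.dropLast)) <
          s.arr 12 (code (base ++ new) c) + 1 then
        Function.update (s.arr 12) (code (base ++ new) (w :: c.dropLast))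
          (s.arr 12 (code (base ++ new) c) + 1)
        else s.arr 12) →
      (s'.arr 13 = if s.arr 12 (code (base ++ new) (w :: c.dropLast)) <
          s.arr 12 (code (base ++ new) c) + 1 then
        Function.update (s.arr 13) (code (base ++ new) (w :: c.dropLast)) (code (base ++ new) c)
        else s.arr 13) → τ' ≤ τ + 20 →
      WP W (.setArr 7 (.var 3) (.var 9) ;;
        .setArr 8 (.var 3) (.var 8) ;;
        .setArr 9 (.var 3) (.var 10) ;;
        .setArr 10 (.var 3) (.var 7) ;;
        .setArr 12 (.var 3) (.add (.var 11) (.const 1)) ;;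
        .setArr 11 (.add (.var 7) (.var 9)) (.var 3) ;;
        .setVar 3 (.add (.var 3) (.var 0))) Q s' τ' := by
    intro s' τ' hv ha h12 h13 hτ
    refine WP.seq (WP.setArr (by simp [hv]; omega) (by simp [hv]; omega) ?_)
    refine WP.seq (WP.setArr (by simp [hv]; omega) (by simp [hv]; omega) ?_)
    refine WP.seq (WP.setArr (by simp [hv]; omega) (by simp [hv]; omega) ?_)
    refine WP.seq (WP.setArr (by simp [hv]; omega) (by simp [hv]; omega) ?_)
    refine WP.seq (WP.setArr (by simp [hv]; omega) (by simp [hv]; omega) ?_)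
    refine WP.seq (WP.setArr (by simp [hv]; omega) (by simp [hv]; omega) ?_)
    refine WP.setVar (by simp [hv]; omega) ?_
    obtain ⟨wk', hwd, hS⟩ := h.snoc hG hcl hw
      (s' := ((((((s'.setArr 7 (s.var 3) w).setArr 8 (s.var 3) (code (base ++ new) (fst c))).setArr
        9 (s.var 3) (code (base ++ new) (w :: c.dropLast))).setArr 10 (s.var 3)
        (code (base ++ new) c)).setArr 12 (s.var 3) (k + 1)).setArr 11
        (code (base ++ new) c + w) (s.var 3)).setVar 3 (s.var 3 + n))
      (by simp [hv]) (by simp [ha]) (by simp [ha]) (by simp [ha]) (by simp [ha]) (by simp [ha])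
      (by simp [ha]) (by simp [h12]) (by simp [h13])
    simp only [Expr.eval, State.setArr_var, hv, h7, h8, h9, h10, h11, h0]
    refine hQ _ _ wk' hS hwd ?_ ?_ ?_
    · intro x hx
      simp [hv, hx]
    · intro a ha'
      simp only [List.mem_cons, List.not_mem_nil, or_false] at ha'
      rcases ha' with rfl | rfl | rfl | rfl | rfl | rfl | rfl | rfl | rfl <;> simp [ha]
    · simp only [Expr.cost]
      omega
  refine WP.ite (fun hne => ?_) (fun he => ?_)
  · have hlt : s.arr 12 (code (base ++ new) (w :: c.dropLast)) <
        s.arr 12 (code (base ++ new) c) + 1 := by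
      simp only [Expr.eval, h7, h10] at hne; omega
    refine WP.seq (WP.setArr (by simp; omega) (by simp [h7]; omega) ?_)
    refine WP.setArr (by simp; omega) (by simp; omega) ?_
    refine key _ _ (by simp) (fun a h1 h2 => by simp [h1, h2]) ?_ ?_ (by simp)
    · rw [if_pos hlt]; simp [h7, h10]
    · rw [if_pos hlt]; simp [h7, h10]
  · have hlt : ¬ s.arr 12 (code (base ++ new) (w :: c.dropLast)) <
        s.arr 12 (code (base ++ new) c) + 1 := by
      simp only [Expr.eval, h7, h10] at he; omega
    refine WP.skip (key _ _ rfl (fun a h1 h2 => rfl) ?_ ?_ (by simp))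
    · rw [if_neg hlt]
    · rw [if_neg hlt]

/-- If the walk of the window 7 is longer than the best one so far, record it. -/
def updateBest : Prog :=
  .ite (.sub (.get 12 (.var 7)) (.var 12))
    (.setVar 12 (.get 12 (.var 7)) ;; .setVar 13 (.var 7)) .skip

/-- The longest walk of the windows in `done` is recorded. -/
def Best (nd done : List (List (Fin n))) (wk : List (Fin n) → List (Fin n)) (s : State) : Prop :=
  (∀ c ∈ done, (wk c).length ≤ s.var 12) ∧
    (done = [] ∧ s.var 12 = 0 ∨ ∃ b ∈ done, s.var 13 = code nd b ∧ s.var 12 = (wk b).length)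

theorem wp_updateBest (hG : IsDag G) (hR : Room G K W) {k : ℕ} (hk : k ≤ K)
    {base done new : List (List (Fin n))} {wk : List (Fin n) → List (Fin n)}
    {c : List (Fin n)} (h : Stage G k base (done ++ [c]) new wk s)
    (h7 : s.var 7 = code (base ++ new) c) (hb : Best (base ++ new) done wk s)
    (hQ : ∀ s' τ', s'.arr = s.arr → (∀ x, x ≠ 12 → x ≠ 13 → s'.var x = s.var x) →
      Best (base ++ new) (done ++ [c]) wk s' → τ' ≤ τ + 10 → Q s' τ') :
    WP W updateBest Q s τ := by
  have hcd : c ∈ done ++ [c] := by simp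
  have hcb : c ∈ base ++ new := List.mem_append_left _ (h.done_mem hcd)
  have hck := h.done_length c hcd
  have hlen := h.walks.len c hcb hck
  have hle := (h.walks.walk c hcb hck).length_le hG h.pos
  have hcard := hR.card
  have hfresh := hR.fresh_le hk h
  have h3 := h.tree.fresh
  have hle1 := code_le (base ++ new) c
  simp only [Fintype.card_fin] at hle
  refine WP.ite (fun hne => ?_) (fun he => ?_)
  · simp only [Expr.eval, h7, hlen] at hne
    refine WP.seq (WP.setVar (by simp [h7, hlen]; omega) ?_)
    refine WP.setVar (by simp [h7]; omega) ?_
    refine hQ _ _ (by simp) (fun x h1 h2 => by simp [h1, h2]) ?_ (by simp)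
    refine ⟨?_, .inr ⟨c, hcd, by simp [h7], by simp [h7, hlen]⟩⟩
    intro d hd
    simp only [State.setVar_var, Expr.eval, h7, hlen]
    simp only [ne_eq, show (12 : ℕ) ≠ 13 by decide, not_false_eq_true, Function.update_of_ne,
      Function.update_self]
    rcases List.mem_append.1 hd with hd | hd
    · have := hb.1 d hd
      omega
    · simp at hd; rw [hd]
  · simp only [Expr.eval, h7, hlen] at he
    refine WP.skip (hQ _ _ rfl (fun _ _ _ => rfl) ⟨?_, .inr ?_⟩ (by simp))
    · intro d hd
      rcases List.mem_append.1 hd with hd | hd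
      · exact hb.1 d hd
      · simp at hd; rw [hd]; omega
    -- If nothing has been recorded, register 12 is 0 and the test cannot fail, because the walk of
    -- a window has at least `k ≥ 1` vertices.
    · rcases hb.2 with ⟨-, h0⟩ | ⟨b, hb1, hb2⟩
      · exfalso
        have h1 := h.walks.window c hcb hck
        have h2 := congrArg List.length h1
        have h3 := h.pos
        rw [List.length_take] at h2
        omega
      · exact ⟨b, by simp [hb1], hb2⟩

end Create

/-! ### Writing out a walk and testing whether it is a clique. -/

section Output

variable {n : ℕ} {G : Digraph (Fin n)} {K W : ℕ} {Q : State → ℕ → Prop} {s : State} {τ : ℕ}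

/-- Array 0 holds the list `l`, and register 20 its length. -/
def Holds (l : List (Fin n)) (s : State) : Prop :=
  s.var 20 = l.length ∧ (List.range l.length).map (s.arr 0) = l.map fun v : Fin n => (v : ℕ)

theorem Holds.get {l : List (Fin n)} (h : Holds l s) {i : ℕ} (hi : i < l.length) :
    s.arr 0 i = l[i] := by
  have := congrArg (fun l => l[i]?) h.2
  simpa [hi] using this

theorem Holds.snoc {l : List (Fin n)} {s' : State} (h : Holds l s) {w : Fin n}
    (hv : s'.var 20 = l.length + 1) (ha : s'.arr 0 = Function.update (s.arr 0) l.length w) :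
    Holds (l ++ [w]) s' := by
  refine ⟨by simp [hv], ?_⟩
  rw [List.length_append, List.length_singleton, List.range_succ, List.map_append, List.map_append,
    ha, ← h.2]
  congr 1
  · refine List.map_congr_left fun i hi => ?_
    rw [Function.update_of_ne]
    have := List.mem_range.1 hi
    omega
  · simp

/-- Output the longest walk that has been found, last vertex first. -/
def extract : Prog :=
  .setVar 7 (.var 13) ;;
  .setVar 20 (.const 0) ;;
  .while (.get 13 (.var 7))
    (.setArr 0 (.var 20) (.get 7 (.var 7)) ;;
     .setVar 20 (.add (.var 20) (.const 1)) ;;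
     .setVar 7 (.get 13 (.var 7))) ;;
  .while (.var 7)
    (.setArr 0 (.var 20) (.get 7 (.var 7)) ;;
     .setVar 20 (.add (.var 20) (.const 1)) ;;
     .setVar 7 (.get 10 (.var 7)))

theorem wp_extract (hG : IsDag G) (hR : Room G K W) {k : ℕ} (hk : k ≤ K)
    {base done new : List (List (Fin n))} {wk : List (Fin n) → List (Fin n)}
    {b : List (Fin n)} (h : Stage G k base done new wk s)
    (hb : b ∈ base ++ new) (hbk : b.length = k) (h13 : s.var 13 = code (base ++ new) b)
    (hQ : ∀ s' τ', (∀ a, a ≠ 0 → s'.arr a = s.arr a) →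
      (∀ x, x ≠ 7 → x ≠ 20 → s'.var x = s.var x) → Holds (wk b) s' → τ' ≤ τ + 20 * n + 20 →
      Q s' τ') :
    WP W extract Q s τ := by
  have hT := h.tree
  have hS := h.walks
  have hcard := hR.card
  have hfresh := hR.fresh_le hk h
  generalize base ++ new = nd at hb h13 hT hS
  have hwn := (hS.walk b hb hbk).length_le hG h.pos
  rw [Fintype.card_fin] at hwn
  have h3 := hT.fresh
  have hcode : ∀ c, code nd c ≤ W := fun c => by have := code_le nd c; omega
  refine WP.seq (WP.setVar (by simp [h13, hcode]) ?_)
  refine WP.seq (WP.setVar (by simp) ?_)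
  -- The first loop follows the predecessors of the windows and emits the last vertex of each; what
  -- remains to be written is the walk of the current window `x`. It stops when `wk x = x`.
  refine WP.seq (WP.while (fun r s' τ' => ∃ l x, x ∈ nd ∧ x.length = k ∧ wk b = l ++ wk x ∧
    (wk x).length = r ∧ s'.var 7 = code nd x ∧ Holds l s' ∧ (∀ a, a ≠ 0 → s'.arr a = s.arr a) ∧
    (∀ y, y ≠ 7 → y ≠ 20 → s'.var y = s.var y) ∧ τ' ≤ τ + 10 + 20 * l.length) ?_ ?_ (wk b).length
    ⟨[], b, hb, hbk, rfl, rfl, by simp [h13], by simp [Holds], by simp, ?_, by simp⟩)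
  · rintro r s' τ' ⟨l, x, hx, hxk, hl, -, h7, hH, ha, hv, hτ⟩ h0
    have hwx : wk x = x := by
      rcases hS.trace x hx hxk with h1 | ⟨c, hc, -, -, h1, -⟩
      · exact h1.1
      · exfalso
        have hne : code nd c ≠ 0 := by
          have hxn := hT.ne_nil x hx
          rw [Ne, code_eq_zero (x.head hxn).pos]
          exact fun hh => hh hc
        simp only [Expr.eval, h7, ha 13 (by decide), h1] at h0
        exact hne h0
    -- The second loop emits the vertices of the initial window by climbing the parents in the tree.
    -- The parent of a single vertex has address 0, which ends the loop.
    refine WP.while (fun r s' τ' => ∃ l x, (x = [] ∨ x ∈ nd) ∧ wk b = l ++ x ∧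
      x.length = r ∧ s'.var 7 = code nd x ∧ Holds l s' ∧ (∀ a, a ≠ 0 → s'.arr a = s.arr a) ∧
      (∀ y, y ≠ 7 → y ≠ 20 → s'.var y = s.var y) ∧ τ' ≤ τ + 15 + 20 * l.length) ?_ ?_ x.length
      ⟨l, x, .inr hx, by rw [hl, hwx], rfl, h7, hH, ha, hv, by simp; omega⟩
    · rintro r s' τ' ⟨l, x, hx, hl, -, h7, hH, ha, hv, hτ⟩ h0
      have hx0 : x = [] := by
        rcases hx with hx | hx
        · exact hx
        · exfalso
          have hxn := hT.ne_nil x hx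
          simp only [Expr.eval, h7] at h0
          exact (code_eq_zero (x.head hxn).pos).1 h0 hx
      have hlb : wk b = l := by rw [hl, hx0, List.append_nil]
      refine hQ _ _ ha hv (by rwa [hlb]) ?_
      simp only [Expr.cost]
      rw [hlb] at hwn
      omega
    · rintro r s' τ' ⟨l, x, hx, hl, hr, h7, hH, ha, hv, hτ⟩ h0
      simp only [Expr.eval, h7] at h0
      have hx' : x ∈ nd := by
        by_contra hh
        exact h0 (code_of_not_mem hh)
      obtain ⟨w, x, rfl⟩ := List.exists_cons_of_ne_nil (hT.ne_nil x hx')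
      have hlw : l.length < n := by rw [hl] at hwn; simp at hwn; omega
      have hL := hT.last w x hx'
      have hP := hT.parent w x hx'
      have h20 := hH.1
      have hw := w.2
      refine WP.seq (WP.setArr (by simp [h20]; omega) (by simp [h7, ha, hL]; omega) ?_)
      refine WP.seq (WP.setVar (by simp [h20]; omega) ?_)
      refine WP.setVar (by simp [h7, ha, hP, hcode]) ?_
      refine ⟨x.length, by simp at hr; omega, l ++ [w], x, ?_, by simp [hl], rfl, ?_, ?_, ?_, ?_, ?_⟩
      · by_cases hx0 : x = []
        · exact .inl hx0
        · exact .inr (hT.tail_mem w x hx' hx0)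
      · simp [h7, ha, hP]
      · exact hH.snoc (by simp [h20]) (by simp [h7, ha, hL, h20])
      · intro a ha0; simp [ha0, ha]
      · intro y h1 h2; simp [h1, h2, hv]
      · simp; omega
  · rintro r s' τ' ⟨l, x, hx, hxk, hl, hr, h7, hH, ha, hv, hτ⟩ h0
    rcases hS.trace x hx hxk with h1 | ⟨c, hc, -, hck, h1, w, hw⟩
    · exfalso
      simp only [Expr.eval, h7, ha 13 (by decide), h1] at h0
      exact h0 rfl
    have hxc := hS.window x hx hxk
    obtain ⟨x', rfl⟩ : ∃ x', x = w :: x' := by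
      obtain ⟨k, rfl⟩ := Nat.exists_eq_add_of_le' h.pos
      rw [hw, List.take_succ_cons] at hxc
      exact ⟨_, hxc.symm⟩
    have hlw : l.length < n := by rw [hl, hw] at hwn; simp at hwn; omega
    have hL := hT.last w x' hx
    have h20 := hH.1
    have hwlt := w.2
    refine WP.seq (WP.setArr (by simp [h20]; omega) (by simp [h7, ha, hL]; omega) ?_)
    refine WP.seq (WP.setVar (by simp [h20]; omega) ?_)
    refine WP.setVar (by simp [h7, ha, h1, hcode]) ?_
    refine ⟨(wk c).length, by rw [hw] at hr; simp at hr; omega, l ++ [w], c, hc, hck,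
      by simp [hl, hw], rfl, ?_, ?_, ?_, ?_, ?_⟩
    · simp [h7, ha, h1]
    · exact hH.snoc (by simp [h20]) (by simp [h7, ha, hL, h20])
    · intro a ha0; simp [ha0, ha]
    · intro y h1 h2; simp [h1, h2, hv]
    · simp; omega
  · intro y h1 h2; simp [h1, h2]

/-- Set register 22 to 1 if the list in array 0 is a clique, and to 0 otherwise. -/
def check : Prog :=
  .setVar 22 (.const 1) ;;
  .setVar 2 (.const 0) ;;
  .while (.sub (.var 20) (.var 2))
    (.setVar 21 (.const 0) ;;
     .while (.sub (.var 2) (.var 21))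
      (.ite (.get 11 (.add (.get 2 (.get 0 (.var 2))) (.get 0 (.var 21))))
        (.setVar 21 (.add (.var 21) (.const 1)))
        (.setVar 22 (.const 0) ;; .setVar 2 (.var 20) ;; .setVar 21 (.var 20))) ;;
     .setVar 2 (.add (.var 2) (.const 1)))

theorem isCl_take_succ {q : List (Fin n)} {i : ℕ} (hi : i < q.length) :
    IsCl G (q.take (i + 1)) ↔ IsCl G (q.take i) ∧ ∀ j (hj : j < i), G.Adj q[i] q[j] := by
  rw [List.take_succ_eq_append_getElem hi, IsCl, List.pairwise_append]
  refine and_congr_right fun _ => ⟨fun h j hj => h.2 q[j] ?_ q[i] (by simp), fun h => ⟨?_, ?_⟩⟩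
  · exact List.mem_take_iff_getElem.2 ⟨j, by omega, rfl⟩
  · simp
  · intro a ha b hb
    rw [List.mem_singleton] at hb
    obtain ⟨j, hj, rfl⟩ := List.mem_take_iff_getElem.1 ha
    rw [hb]
    exact h j (by omega)

/-- A walk can have `n` vertices, so testing all its pairs would be too slow. But the test stops at
the first missing edge, and the vertices examined before the current one form a clique, so only `O(n
+ m)` pairs are tested. -/
theorem wp_check (hG : IsDag G) (hR : Room G K W)
    {nd : List (List (Fin n))} {q : List (Fin n)} (h : Tree G nd s)
    (hpair : ∀ u v, G.Adj u v → [v, u] ∈ nd) (hq : Holds q s) (hqn : q.length ≤ n)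
    (hQ : ∀ s' τ', s'.arr = s.arr → (∀ x, x ≠ 2 → x ≠ 21 → x ≠ 22 → s'.var x = s.var x) →
      (IsCl G q ∧ s'.var 22 = 1 ∨ ¬ IsCl G q ∧ s'.var 22 = 0) →
      τ' ≤ τ + 200 * (n + numEdges G + 1) → Q s' τ') :
    WP W check Q s τ := by
  have hcard := hR.card
  -- Once all edges are stored as nodes, the child tables of the single vertices form an adjacency
  -- matrix.
  have hT : ∀ u v : Fin n, s.arr 11 (s.arr 2 u + v) = 0 ↔ ¬ G.Adj u v := by
    intro u v
    rw [h.base, ← h.code_single, h.child _ (h.mem_single u), code_eq_zero u.pos, not_iff_not]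
    exact ⟨fun h' => isCl_pair.1 (h.isCl _ h'), hpair u v⟩
  refine WP.seq (WP.setVar (by simp; omega) ?_)
  refine WP.seq (WP.setVar (by simp) ?_)
  -- On failure both counters jump to `q.length`, and the increment at the end of the outer loop
  -- makes register 2 equal to `q.length + 1`; truncated subtraction still ends the loop.
  refine WP.while (fun r s' τ' => s'.arr = s.arr ∧
    (∀ x, x ≠ 2 → x ≠ 21 → x ≠ 22 → s'.var x = s.var x) ∧
    (r + s'.var 2 = q.length ∧ s'.var 22 = 1 ∧ IsCl G (q.take (s'.var 2)) ∧
      τ' ≤ τ + 10 + 30 * s'.var 2 + 40 * (s'.var 2 * s'.var 2) ∨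
    s'.var 2 = q.length + 1 ∧ s'.var 22 = 0 ∧ ¬ IsCl G q ∧
      τ' ≤ τ + 10 + 150 * (n + numEdges G + 1))) ?_ ?_ q.length
    ⟨by simp, fun x h1 h2 h3 => by simp [h1, h3], .inl ⟨by simp, by simp, by simp [IsCl], by simp⟩⟩
  · rintro r s' τ' ⟨ha, hv, h'⟩ h0
    simp only [Expr.eval, hv 20 (by decide) (by decide) (by decide), hq.1] at h0
    rcases h' with ⟨hr, h22, hcl, hτ⟩ | ⟨hr, h22, hcl, hτ⟩
    · have hi : s'.var 2 = q.length := by omega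
      rw [hi] at hτ hcl
      rw [List.take_length] at hcl
      have := hcl.length_mul_le hG
      exact hQ _ _ ha hv (.inl ⟨hcl, h22⟩) (by simp only [Expr.cost]; omega)
    · exact hQ _ _ ha hv (.inr ⟨hcl, h22⟩) (by simp only [Expr.cost]; omega)
  · rintro r s' τ' ⟨ha, hv, h'⟩ h0
    have hv20 := hv 20 (by decide) (by decide) (by decide)
    simp only [Expr.eval, hv20, hq.1] at h0
    rcases h' with ⟨hr, h22, hcl, hτ⟩ | ⟨hr, -⟩
    swap
    · omega
    obtain ⟨i, hi⟩ : ∃ i, i = s'.var 2 := ⟨_, rfl⟩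
    rw [← hi] at hr hcl hτ h0
    have hiq : i < q.length := by omega
    have hmul : i * i ≤ i + 2 * numEdges G := by
      have := hcl.length_mul_le hG
      rwa [List.length_take, min_eq_left hiq.le] at this
    refine WP.seq (WP.setVar (by simp) ?_)
    refine WP.seq (WP.while (fun r' s'' τ'' => s''.arr = s.arr ∧
      (∀ x, x ≠ 2 → x ≠ 21 → x ≠ 22 → s''.var x = s.var x) ∧
      (r' + s''.var 21 = i ∧ s''.var 22 = 1 ∧ s''.var 2 = i ∧
        (∀ j (_ : j < s''.var 21) (_ : j < i), G.Adj q[i] q[j]) ∧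
        τ'' ≤ τ' + 10 + 40 * s''.var 21 ∨
      s''.var 2 = q.length ∧ s''.var 21 = q.length ∧ s''.var 22 = 0 ∧ ¬ IsCl G q ∧
        τ'' ≤ τ' + 10 + 40 * i + 40)) ?_ ?_ i
      ⟨by simpa using ha, fun x h1 h2 h3 => by simp [h2, hv x h1 h2 h3], .inl
        ⟨by simp, by simpa using h22, by simpa using hi.symm, by simp, by simp⟩⟩)
    · rintro r' s'' τ'' ⟨ha, hv, h'⟩ h0
      simp only [Expr.eval] at h0
      rcases h' with ⟨hr', h22, h2, hadj, hτ'⟩ | ⟨h2, h21, h22, hncl, hτ'⟩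
      · have h21 : s''.var 21 = i := by omega
        refine WP.setVar (by simp [h2]; omega) ⟨r - 1, by omega, by simpa using ha,
          fun x h1 h2 h3 => by simp [h1, hv x h1 h2 h3], .inl ⟨?_, by simpa using h22, ?_, ?_⟩⟩
        · simp [h2]; omega
        · simp only [Expr.eval, State.setVar_var, Function.update_self, h2]
          exact (isCl_take_succ hiq).2 ⟨hcl, fun j hj => hadj j (by omega) hj⟩
        · simp only [Expr.eval, State.setVar_var, Function.update_self, h2, Expr.cost] at hτ' ⊢
          rw [h21] at hτ'
          have : (i + 1) * (i + 1) = i * i + 2 * i + 1 := by ring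
          omega
      · refine WP.setVar (by simp [h2]; omega) ⟨r - 1, by omega, by simpa using ha,
          fun x h1 h2 h3 => by simp [h1, hv x h1 h2 h3], .inr ⟨by simp [h2], by simpa using h22,
          hncl, ?_⟩⟩
        simp only [Expr.cost]
        omega
    · rintro r' s'' τ'' ⟨ha, hv, h'⟩ h0
      simp only [Expr.eval] at h0
      rcases h' with ⟨hr', h22, h2, hadj, hτ'⟩ | ⟨h2, h21, -⟩
      swap
      · omega
      have hv20 := hv 20 (by decide) (by decide) (by decide)
      have hji : s''.var 21 < i := by omega
      have hget : (Expr.get 11 (.add (.get 2 (.get 0 (.var 2))) (.get 0 (.var 21)))).eval s'' =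
          s.arr 11 (s.arr 2 (q[i] : Fin n) + (q[s''.var 21] : Fin n)) := by
        simp only [Expr.eval, ha, h2, hq.get hiq, hq.get (hji.trans hiq)]
      refine WP.ite (fun hne => ?_) (fun he => ?_)
      · rw [hget, Ne, hT, not_not] at hne
        refine WP.setVar (by simp; omega) ⟨r' - 1, by omega, by simpa using ha,
          fun x h1 h2 h3 => by simp [h2, hv x h1 h2 h3], .inl ⟨?_, by simpa using h22,
          by simpa using h2, ?_, ?_⟩⟩
        · simp; omega
        · intro j hj hji
          simp only [Expr.eval, State.setVar_var, Function.update_self] at hj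
          rcases Nat.lt_succ_iff_lt_or_eq.1 hj with hj | hj
          · exact hadj j hj hji
          · subst hj; exact hne
        · simp; omega
      · rw [hget, hT] at he
        refine WP.seq (WP.setVar (by simp) ?_)
        refine WP.seq (WP.setVar (by simp [hv20, hq.1]; omega) ?_)
        refine WP.setVar (by simp [hv20, hq.1]; omega) ⟨0, by omega, by simpa using ha,
          fun x h1 h2 h3 => by simp [h1, h2, h3, hv x h1 h2 h3], .inr ⟨by simp [hv20, hq.1],
          by simp [hv20, hq.1], by simp, fun hcl => he ?_, by simp; omega⟩⟩
        exact ((isCl_take_succ hiq).1 (hcl.sublist (List.take_sublist _ _))).2 _ hji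

end Output

end MaxClique

/-! ### From one stage to the next, and testing the candidates for one clique. -/

namespace MaxClique

open DoubleThreshold WordRAM

local infixr:60 " ;; " => Prog.seq

attribute [local simp] Expr.eval Expr.cost

section Extend

variable {n : ℕ} {G : Digraph (Fin n)} {K W : ℕ} {Q : State → ℕ → Prop} {s : State} {τ : ℕ}

/-- The state at the end of stage `k`. -/
structure Finished (G : Digraph (Fin n)) (k : ℕ) (base done new : List (List (Fin n)))
    (wk : List (Fin n) → List (Fin n)) (s : State) : Prop where
  stage : Stage G k base done new wk s
  all : ∀ c, IsCl G c → c.length = k → c ∈ done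
  closed : ∀ x ∈ base, Closed G (base ++ new) s x
  level_start : s.var 15 = (base.length + 1) * n
  best : Best (base ++ new) done wk s

theorem Finished.mem_new {k : ℕ} {base done new : List (List (Fin n))}
    {wk : List (Fin n) → List (Fin n)} (h : Finished G k base done new wk s) {c : List (Fin n)} :
    c ∈ new ↔ IsCl G c ∧ c.length = k + 1 := by
  refine ⟨fun hc => ⟨h.stage.new_isCl c hc, h.stage.new_length c hc⟩, fun ⟨h1, h2⟩ => ?_⟩
  obtain ⟨w, d, rfl⟩ := List.exists_cons_of_ne_nil (l := c) (by rintro rfl; simp at h2)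
  have hd := h.stage.done_mem (h.all d (isCl_cons.1 h1).2 (by simpa using h2))
  obtain ⟨l₁, ch, l₂, he, -, -, -, h3⟩ := h.closed d hd
  have : w :: d ∈ base ++ new := by rw [he]; simp [h3 w h1]
  rcases List.mem_append.1 this with h4 | h4
  · have := ((h.stage.mem_base _).1 h4).2.2
    omega
  · exact h4

theorem Finished.mem_iff {k : ℕ} {base done new : List (List (Fin n))}
    {wk : List (Fin n) → List (Fin n)} (h : Finished G k base done new wk s) {c : List (Fin n)} :
    c ∈ base ++ new ↔ IsCl G c ∧ c ≠ [] ∧ c.length ≤ k + 1 := by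
  rw [List.mem_append, h.stage.mem_base, h.mem_new]
  constructor
  · rintro (⟨h1, h2, h3⟩ | ⟨h1, h2⟩)
    · exact ⟨h1, h2, by omega⟩
    · exact ⟨h1, by rintro rfl; simp at h2, by omega⟩
  · rintro ⟨h1, h2, h3⟩
    rcases h3.lt_or_eq with h4 | h4
    · exact .inl ⟨h1, h2, by omega⟩
    · exact .inr ⟨h1, h4⟩

/-- The state at the beginning of stage `k + 1`. -/
theorem Finished.start {k : ℕ} {base done new : List (List (Fin n))}
    {wk : List (Fin n) → List (Fin n)} {s' : State} (h : Finished G k base done new wk s)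
    (ha : s'.arr = s.arr) (h0 : s'.var 0 = s.var 0) (h3 : s'.var 3 = s.var 3)
    (h11 : s'.var 11 = k + 1) : Stage G (k + 1) (base ++ new) [] [] id s' where
  tree := by
    rw [List.append_nil]
    exact h.stage.tree.congr h0 h3 (by simp [ha])
  walks := by
    have hlen : ∀ c ∈ base ++ new, c.length ≤ k + 1 := fun c hc => (h.mem_iff.1 hc).2.2
    rw [List.append_nil]
    refine ⟨?_, ?_, ?_, ?_, ?_, ?_, ?_, ?_, ?_⟩
    · intro b hb hk
      rw [ha, h.stage.walks.next_len b hb hk, id, hk]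
    · exact fun b hb hk => (h.mem_iff.1 hb).1.kw
    · exact fun b hb hk => List.take_of_length_le hk.le
    · exact fun b hb hk => .inl ⟨rfl, by rw [ha, h.stage.walks.next_trace b hb hk]⟩
    · intro w c hc hk
      have := hlen _ hc
      simp at this
      omega
    · intro w c hc hk
      have := hlen _ hc
      simp at this
      omega
    · intro e he hk
      have := hlen _ he
      omega
    · intro e he hk
      have := hlen _ he
      omega
    · rw [ha]; exact h.stage.walks.trace_fresh
  mem_base := fun c => h.mem_iff
  done_isCl := by simp
  done_length := by simp
  done_before := .nil
  new_isCl := by simp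
  new_length := by simp
  new_tail := by simp
  new_before := .nil
  level := h11
  pos := by omega

/-- Mark a window as being processed. -/
theorem Stage.pop {k : ℕ} {base done new : List (List (Fin n))}
    {wk : List (Fin n) → List (Fin n)} {c : List (Fin n)} (h : Stage G k base done new wk s)
    (hcl : IsCl G c) (hck : c.length = k) (hb : ∀ d ∈ done, Before G d c) :
    Stage G k base (done ++ [c]) new wk s :=
  { h with
    walks := h.walks.congr (fun d hd => List.mem_append_left _ hd) rfl rfl
    done_isCl := by
      intro d hd
      rcases List.mem_append.1 hd with hd | hd
      · exact h.done_isCl d hd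
      · rw [List.mem_singleton] at hd; rwa [hd]
    done_length := by
      intro d hd
      rcases List.mem_append.1 hd with hd | hd
      · exact h.done_length d hd
      · rw [List.mem_singleton] at hd; rwa [hd]
    done_before := List.pairwise_append.2 ⟨h.done_before, List.pairwise_singleton _ _, by simpa⟩
    new_tail := fun w d hd => List.mem_append_left _ (h.new_tail w d hd) }

/-- Try the vertex of the node 18 as an extension of the clique 7. -/
def tryChild : Prog :=
  .setVar 9 (.get 7 (.var 18)) ;;
  .ite (.get 11 (.add (.var 8) (.var 9)))
    (.setVar 10 (.get 11 (.add (.var 16) (.var 9))) ;; .ite (.var 10) create .skip)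
    .skip ;;
  .setVar 18 (.add (.var 18) (.var 0))

/-- A vertex `w` extends `c` if and only if it extends both `fst c` and `c.dropLast`. Hence the
children of either node contain all candidates, and two lookups decide each candidate. The second
lookup also yields the address of the next window, which `create` needs. -/
theorem wp_children (hG : IsDag G) (hR : Room G K W) {k : ℕ} (hk : k ≤ K)
    {base done new : List (List (Fin n))} {wk : List (Fin n) → List (Fin n)} {c x : List (Fin n)}
    (h : Stage G k base (done ++ [c]) new wk s)
    (hx : x = fst c ∨ x = c.dropLast) (hcn : c.dropLast ≠ [])
    {l₁ ch l₂ : List (List (Fin n))} (hnd : base ++ new = l₁ ++ ch ++ l₂)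
    (hch : ∀ e ∈ ch, ∃ w, e = w :: x) (hch' : ∀ w, IsCl G (w :: x) → w :: x ∈ ch)
    (hnew : ∀ w, w :: c ∉ new)
    (h7 : s.var 7 = code (base ++ new) c) (h8 : s.var 8 = code (base ++ new) (fst c))
    (h16 : s.var 16 = code (base ++ new) c.dropLast) (h18 : s.var 18 = (l₁.length + 1) * n)
    (h19 : s.var 19 = (l₁.length + ch.length + 1) * n)
    (hQ : ∀ s' τ' wk' added, Stage G k base (done ++ [c]) (new ++ added) wk' s' →
      (∀ d ∈ done ++ [c], wk' d = wk d) →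
      (∀ e ∈ added, ∃ w, e = w :: c) → (∀ w, IsCl G (w :: c) → w :: c ∈ added) →
      (∀ y, y ≠ 3 → y ≠ 9 → y ≠ 10 → y ≠ 18 → s'.var y = s.var y) →
      (∀ a ∈ [14, 15], s'.arr a = s.arr a) → τ' ≤ τ + 100 * ch.length + 10 → Q s' τ') :
    WP W (.while (.sub (.var 19) (.var 18)) tryChild) Q s τ := by
  have hcd : c ∈ done ++ [c] := by simp
  have hcb := h.done_mem hcd
  have hc0 : c ≠ [] := by rintro rfl; simp at hcn
  have hsplit := List.dropLast_append_getLast hc0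
  have hfst : fst c = [c.getLast hc0] := by
    conv_lhs => rw [← hsplit, fst_concat]
  have hxb : fst c ∈ base ∧ c.dropLast ∈ base := by
    have h1 := (h.mem_base c).1 hcb
    refine ⟨(h.mem_base _).2 ⟨h1.1.sublist (List.drop_sublist _ _), by simp [hfst], ?_⟩,
      (h.mem_base _).2 ⟨h1.1.sublist (List.dropLast_sublist _), hcn, ?_⟩⟩
    · simp [hfst, h.pos]
    · rw [List.length_dropLast]; omega
  have hcode : ∀ {d l}, d ∈ base → code (base ++ new ++ l) d = code (base ++ new) d := fun hd =>
    code_append (List.mem_append_left _ hd)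
  have hnodup := h.tree.nodup
  let I : ℕ → State → ℕ → Prop := fun r s' τ' => ∃ chd cht added wk', ch = chd ++ cht ∧ cht.length = r ∧
    Stage G k base (done ++ [c]) (new ++ added) wk' s' ∧ (∀ d ∈ done ++ [c], wk' d = wk d) ∧
    (∀ e ∈ added, ∃ w, e = w :: c ∧ w :: x ∈ chd) ∧
    (∀ w, IsCl G (w :: c) → w :: x ∈ chd → w :: c ∈ added) ∧
    (∀ y, y ≠ 3 → y ≠ 9 → y ≠ 10 → y ≠ 18 → s'.var y = s.var y) ∧
    (∀ a ∈ [14, 15], s'.arr a = s.arr a) ∧ s'.var 18 = (l₁.length + chd.length + 1) * n ∧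
    τ' ≤ τ + 100 * chd.length
  refine WP.while I ?_ ?_ ch.length
    ⟨[], ch, [], wk, rfl, rfl, by simpa using h, fun _ _ => rfl, by simp, by simp,
      fun _ _ _ _ _ => rfl, fun _ _ => rfl, by simpa using h18, by simp⟩
  · rintro r s' τ' ⟨chd, cht, added, wk', rfl, hr, hS, hwk, hadd, hadd', hv, ha, hv18, hτ⟩ h0
    have hn : 0 < n := (c.head hc0).pos
    simp only [Expr.eval, hv 19 (by decide) (by decide) (by decide) (by decide), h19, hv18] at h0
    have hcht : cht = [] := by
      by_contra hne
      have : 0 < cht.length := List.length_pos_iff.2 hne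
      have h1 : (l₁.length + chd.length + 1 + 1) * n ≤ (l₁.length + (chd ++ cht).length + 1) * n :=
        Nat.mul_le_mul_right _ (by simp; omega)
      rw [Nat.succ_mul] at h1
      omega
    subst hcht
    refine hQ _ _ wk' added hS hwk (fun e he => ?_) (fun w hw => ?_) hv ha (by simp; omega)
    · obtain ⟨w, rfl, -⟩ := hadd e he
      exact ⟨w, rfl⟩
    · refine hadd' w hw ?_
      have : IsCl G (w :: x) := by
        rcases hx with rfl | rfl
        · exact hw.sublist (List.cons_sublist_cons.2 (List.drop_sublist _ _))
        · exact hw.sublist (List.cons_sublist_cons.2 (List.dropLast_sublist _))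
      simpa using hch' w this
  · rintro r s' τ' ⟨chd, cht, added, wk', rfl, hr, hS, hwk, hadd, hadd', hv, ha, hv18, hτ⟩ h0
    simp only [Expr.eval, hv 19 (by decide) (by decide) (by decide) (by decide), h19, hv18] at h0
    obtain ⟨e, cht, rfl⟩ := List.exists_cons_of_ne_nil (l := cht) (by rintro rfl; simp at h0)
    obtain ⟨w, rfl⟩ := hch e (by simp)
    have hwlt := w.2
    have he : w :: x ∈ base ++ new := by rw [hnd]; simp
    have hcode18 : s'.var 18 = code (base ++ (new ++ added)) (w :: x) := by
      rw [hv18, ← List.append_assoc, code_append he]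
      have h1 : base ++ new = (l₁ ++ chd) ++ (w :: x) :: (cht ++ l₂) := by rw [hnd]; simp
      rw [h1] at hnodup ⊢
      rw [code_split hnodup, List.length_append]
    have hT := hS.tree
    have hL := hT.last w x (by rw [← List.append_assoc]; exact List.mem_append_left _ he)
    have hTf := hT.child (fst c) (by simp [hxb]) w
    have hTg := hT.child c.dropLast (by simp [hxb]) w
    have hfresh := hR.fresh_le hk hS
    have h3 := hT.fresh
    have hle : ∀ d, code (base ++ (new ++ added)) d ≤ s'.var 3 := fun d => by
      rw [h3]; exact code_le _ d
    have hle18 : s'.var 18 + n ≤ s'.var 3 := by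
      rw [hcode18, h3]
      exact code_add_le (by rw [← List.append_assoc]; exact List.mem_append_left _ he)
    have h0' := hT.stride
    have h7' : s'.var 7 = code (base ++ (new ++ added)) c := by
      rw [hv 7 (by decide) (by decide) (by decide) (by decide), h7, ← List.append_assoc, hcode hcb]
    have h8' : s'.var 8 = code (base ++ (new ++ added)) (fst c) := by
      rw [hv 8 (by decide) (by decide) (by decide) (by decide), h8, ← List.append_assoc,
        hcode hxb.1]
    have h16' : s'.var 16 = code (base ++ (new ++ added)) c.dropLast := by
      rw [hv 16 (by decide) (by decide) (by decide) (by decide), h16, ← List.append_assoc,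
        hcode hxb.2]
    have hcl_iff : code (base ++ (new ++ added)) (w :: fst c) ≠ 0 →
        code (base ++ (new ++ added)) (w :: c.dropLast) ≠ 0 → IsCl G (w :: c) := by
      intro h1 h2
      rw [Ne, code_eq_zero w.pos, not_not] at h1 h2
      have h1 := hT.isCl _ h1
      have h2 := hT.isCl _ h2
      rw [hfst, isCl_cons] at h1
      rw [isCl_cons] at h2 ⊢
      refine ⟨fun u hu => ?_, h.done_isCl c hcd⟩
      rw [← hsplit, List.mem_append] at hu
      rcases hu with hu | hu
      exacts [h2.1 u hu, h1.1 u hu]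
    -- Both cliques have at most `k` vertices, because `k ≥ 2`, so they were stored in earlier
    -- stages.
    have hcl_code : IsCl G (w :: c) → code (base ++ (new ++ added)) (w :: fst c) ≠ 0 ∧
        code (base ++ (new ++ added)) (w :: c.dropLast) ≠ 0 := by
      intro hcl
      rw [Ne, code_eq_zero w.pos, not_not, Ne, code_eq_zero w.pos, not_not]
      have h1 : 2 ≤ k := by
        rw [← h.done_length c hcd]
        have := List.length_pos_iff.2 hcn
        rw [List.length_dropLast] at this
        omega
      refine ⟨List.mem_append_left _ ((h.mem_base _).2 ⟨hcl.sublist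
        (List.cons_sublist_cons.2 (List.drop_sublist _ _)), by simp, by simpa [hfst] using h1⟩),
        List.mem_append_left _ (h.suffix_mem hcd hcl)⟩
    have hnotin : w :: x ∉ chd := by
      have h1 : base ++ new = l₁ ++ (chd ++ (w :: x) :: (cht ++ l₂)) := by rw [hnd]; simp
      rw [h1] at hnodup
      have h2 := List.disjoint_of_nodup_append (List.nodup_append.1 hnodup).2.1
      exact fun h3 => h2 h3 (by simp)
    have hwnew : w :: c ∉ new ++ added := by
      rw [List.mem_append, not_or]
      refine ⟨hnew w, fun h1 => ?_⟩
      obtain ⟨w', h2, h3⟩ := hadd _ h1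
      cases h2
      exact hnotin h3
    have hne7 : s'.arr 7 (s'.var 18) = w := by rw [hcode18]; exact hL
    have hnext : (l₁.length + chd.length + 1) * n + n =
        (l₁.length + (chd ++ [w :: x]).length + 1) * n := by simp; ring
    -- The common continuation of the two branches that reject `w`.
    have hskip : ∀ s'' τ'', s''.arr = s'.arr →
        (∀ y, y ≠ 9 → y ≠ 10 → s''.var y = s'.var y) → ¬ IsCl G (w :: c) → τ'' ≤ τ' + 30 →
        WP W (.setVar 18 (.add (.var 18) (.var 0))) (fun s' τ' => ∃ r' < r, I r' s' τ') s'' τ'' := by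
      intro s'' τ'' ha'' hv'' hncl hτ''
      refine WP.setVar (by simp [hv'']; omega) ⟨cht.length, by simp at hr; omega, chd ++ [w :: x],
        cht, added, wk', by simp, rfl, ?_, hwk, ?_, ?_, ?_, ?_, ?_, ?_⟩
      · exact hS.congr (by simp [hv'']) (by simp [hv'']) (by simp [hv'']) (by simp [ha''])
      · intro e he
        obtain ⟨w', h1, h2⟩ := hadd e he
        exact ⟨w', h1, by simp [h2]⟩
      · intro w' hw' hmem
        rcases List.mem_append.1 hmem with h1 | h1
        · exact hadd' w' hw' h1
        · simp at h1; subst h1; exact absurd hw' hncl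
      · intro y h1 h2 h3 h4; simp [h1, h2, h3, h4, hv'', hv]
      · simpa [ha''] using ha
      · simp only [Expr.eval, State.setVar_var, Function.update_self,
          hv'' 18 (by decide) (by decide), hv'' 0 (by decide) (by decide), hv18, h0', hnext]
      · simp; omega
    refine WP.seq (WP.setVar (by simp [hne7]; omega) (WP.seq (WP.ite (fun hne => ?_) fun he => ?_)))
    · refine WP.seq (WP.setVar ?_ (WP.ite (fun hne' => ?_) fun he => ?_))
      · simp [hne7, h16', hTg]; have := hle (w :: c.dropLast); omega
      · have hne1 : code (base ++ (new ++ added)) (w :: fst c) ≠ 0 := by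
          simpa [hne7, h8', hTf] using hne
        have hne2 : code (base ++ (new ++ added)) (w :: c.dropLast) ≠ 0 := by
          simpa [hne7, h16', hTg] using hne'
        have hcl := hcl_iff hne1 hne2
        refine wp_create hG hR hk (hS.congr (by simp) (by simp) (by simp) (by simp)) hcl hwnew
          (by simp [h7']) (by simp [h8']) (by simp [hne7]) (by simp [hne7, h16', hTg]) ?_
        · intro s'' τ'' wk'' hS' hwk' hv' ha' hτ'
          have hfresh' := hR.fresh_le hk hS'
          have hv18' : s''.var 18 = s'.var 18 := by rw [hv' 18 (by decide)]; simp
          have hv0' : s''.var 0 = s'.var 0 := by rw [hv' 0 (by decide)]; simp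
          refine WP.setVar (by simp [hv18', hv0']; omega) ⟨cht.length, by simp at hr; omega,
            chd ++ [w :: x], cht, added ++ [w :: c], wk'', by simp, rfl, ?_, ?_, ?_, ?_, ?_, ?_,
            ?_, ?_⟩
          · rw [← List.append_assoc]
            exact hS'.congr (by simp) (by simp) (by simp) (by simp)
          · exact fun d hd => (hwk' d hd).trans (hwk d hd)
          · intro e he
            rcases List.mem_append.1 he with he | he
            · obtain ⟨w', h1, h2⟩ := hadd e he
              exact ⟨w', h1, by simp [h2]⟩
            · rw [List.mem_singleton] at he
              exact ⟨w, he, by simp⟩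
          · intro w' hw' hmem
            rcases List.mem_append.1 hmem with h1 | h1
            · exact List.mem_append_left _ (hadd' w' hw' h1)
            · simp at h1; subst h1; simp
          · intro y h1 h2 h3 h4
            simp [h1, h2, h3, h4, hv', hv]
          · intro a ha1
            rw [← ha a ha1]
            simp only [State.setVar_arr]
            rw [ha' a (by simp at ha1 ⊢; omega)]
            simp
          · simp only [Expr.eval, State.setVar_var, Function.update_self, hv18', hv0', hv18, h0',
              hnext]
          · simp only [Expr.cost] at hτ' ⊢
            simp; omega
      · refine WP.skip (hskip _ _ (by simp) (fun y h1 h2 => by simp [h1, h2]) ?_ (by simp))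
        intro hcl
        have he2 : code (base ++ (new ++ added)) (w :: c.dropLast) = 0 := by
          simpa [hne7, h16', hTg] using he
        exact (hcl_code hcl).2 he2
    · refine WP.skip (hskip _ _ (by simp) (fun y h1 h2 => by simp [h1]) ?_ (by simp))
      intro hcl
      have he2 : code (base ++ (new ++ added)) (w :: fst c) = 0 := by
        simpa [hne7, h8', hTf] using he
      exact (hcl_code hcl).1 he2

end Extend

end MaxClique

/-! ### Stages `k ≥ 2`. -/

namespace MaxClique

open DoubleThreshold WordRAM

local infixr:60 " ;; " => Prog.seq

attribute [local simp] Expr.eval Expr.cost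

section Extend

variable {n : ℕ} {G : Digraph (Fin n)} {K W : ℕ} {Q : State → ℕ → Prop} {s : State} {τ : ℕ}

/-- Extend the clique 7 by all possible vertices. -/
def expand : Prog :=
  updateBest ;;
  .setArr 14 (.var 7) (.var 3) ;;
  .setVar 8 (.get 8 (.var 7)) ;;
  .setVar 16 (.get 9 (.var 7)) ;;
  .ite (.sub (.sub (.get 15 (.var 8)) (.get 14 (.var 8)))
      (.sub (.get 15 (.var 16)) (.get 14 (.var 16))))
    (.setVar 17 (.var 16)) (.setVar 17 (.var 8)) ;;
  .setVar 18 (.get 14 (.var 17)) ;;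
  .setVar 19 (.get 15 (.var 17)) ;;
  .while (.sub (.var 19) (.var 18)) tryChild ;;
  .setArr 15 (.var 7) (.var 3) ;;
  .setVar 7 (.add (.var 7) (.var 0))

/-- `fst c` and `c.dropLast` have fewer than `k` vertices, so their blocks of children are complete;
the shorter block is scanned, which gives the minimum in the time bound. No other node is created
meanwhile, so the children of `c` occupy the addresses from the old to the new value of register 3,
and `c` becomes `Closed`. -/
theorem wp_expand (hG : IsDag G) (hR : Room G K W) {k : ℕ} (hk : k ≤ K)
    {base done new : List (List (Fin n))} {wk : List (Fin n) → List (Fin n)} {c : List (Fin n)}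
    (h : Stage G k base (done ++ [c]) new wk s) (hc : c ∉ done) (hcn : c.dropLast ≠ [])
    (hclosed : ∀ x ∈ base, x.length < k ∨ x ∈ done → Closed G (base ++ new) s x)
    (hnew : ∀ w, w :: c ∉ new)
    (h7 : s.var 7 = code (base ++ new) c) (hb : Best (base ++ new) done wk s)
    (hQ : ∀ s' τ' wk' new', Stage G k base (done ++ [c]) new' wk' s' →
      (∀ w d, w :: d ∈ new' → w :: d ∉ new → d = c) →
      (∀ x ∈ base, x.length < k ∨ x ∈ done ++ [c] → Closed G (base ++ new') s' x) →
      s'.var 7 = s.var 7 + n → s'.var 15 = s.var 15 →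
      Best (base ++ new') (done ++ [c]) wk' s' →
      τ' ≤ τ + 200 * (1 + min (nch G (fst c)) (nch G c.dropLast)) → Q s' τ') :
    WP W expand Q s τ := by
  have hcd : c ∈ done ++ [c] := by simp
  have hcb := h.done_mem hcd
  have hcb' : c ∈ base ++ new := List.mem_append_left _ hcb
  have hc0 : c ≠ [] := by rintro rfl; simp at hcn
  have hn : 0 < n := (c.head hc0).pos
  have hck := h.done_length c hcd
  have hsplit := List.dropLast_append_getLast hc0
  have hfst : fst c = [c.getLast hc0] := by
    conv_lhs => rw [← hsplit, fst_concat]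
  have hk2 : 2 ≤ k := by
    have := List.length_pos_iff.2 hcn
    rw [List.length_dropLast] at this
    omega
  have hfb : fst c ∈ base := (h.mem_base _).2 ⟨(h.done_isCl c hcd).sublist (List.drop_sublist _ _),
    by simp [hfst], by simp [hfst, h.pos]⟩
  have hgb : c.dropLast ∈ base := (h.mem_base _).2
    ⟨(h.done_isCl c hcd).sublist (List.dropLast_sublist _), hcn, by
      rw [List.length_dropLast]; omega⟩
  have hfl : (fst c).length < k := by simp [hfst]; omega
  have hgl : c.dropLast.length < k := by rw [List.length_dropLast]; omega
  have hfc : code (base ++ new) (fst c) ≠ code (base ++ new) c := fun he => by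
    rw [code_inj' hn (List.mem_append_left _ hfb) hcb' he] at hfl; omega
  have hgc : code (base ++ new) c.dropLast ≠ code (base ++ new) c := fun he => by
    rw [code_inj' hn (List.mem_append_left _ hgb) hcb' he] at hgl; omega
  obtain ⟨l₁, ch, l₂, hnd, h14, h15, hch, hch', hlen⟩ :=
    (hclosed _ hfb (.inl hfl)).exists_length_le h.tree.nodup h.tree.isCl
  obtain ⟨l₁', ch', l₂', hnd', h14', h15', hchg, hchg', hlen'⟩ :=
    (hclosed _ hgb (.inl hgl)).exists_length_le h.tree.nodup h.tree.isCl
  have hle : ∀ d, code (base ++ new) d ≤ s.var 3 := fun d => by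
    rw [h.tree.fresh]; exact code_le _ d
  have hfresh := hR.fresh_le hk h
  have h3 := h.tree.fresh
  obtain ⟨y, d, rfl⟩ := List.exists_cons_of_ne_nil hc0
  have hd0 : d ≠ [] := by rintro rfl; simp at hcn
  have hdl : (y :: d).dropLast = y :: d.dropLast := List.dropLast_cons_of_ne_nil hd0
  have hF : s.arr 8 (code (base ++ new) (y :: d)) = code (base ++ new) (fst (y :: d)) := by
    rw [h.tree.first y d hd0 hcb', fst_cons hd0]
  have hS : s.arr 9 (code (base ++ new) (y :: d)) = code (base ++ new) (y :: d).dropLast := by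
    rw [h.tree.suffix y d hd0 hcb', hdl]
  generalize y :: d = c at *
  refine WP.seq (wp_updateBest hG hR hk h h7 hb ?_)
  intro s₁ τ₁ ha₁ hv₁ hb₁ hτ₁
  have hv0 := hv₁ 0 (by decide) (by decide)
  have hv3 := hv₁ 3 (by decide) (by decide)
  have hv7 := hv₁ 7 (by decide) (by decide)
  have hv11 := hv₁ 11 (by decide) (by decide)
  have hv15 := hv₁ 15 (by decide) (by decide)
  refine WP.seq (WP.setArr (by simp [hv7, h7]; have := hle c; omega) (by simp [hv3]; omega) ?_)
  refine WP.seq (WP.setVar (by simp [ha₁, hv7, h7, hF]; have := hle (fst c); omega) ?_)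
  refine WP.seq (WP.setVar (by simp [ha₁, hv7, h7, hS]; have := hle c.dropLast; omega) ?_)
  have hbound : ∀ {l₁ ch l₂ : List (List (Fin n))}, base ++ new = l₁ ++ ch ++ l₂ →
      (l₁.length + 1) * n ≤ W ∧ (l₁.length + ch.length + 1) * n ≤ W := by
    intro l₁ ch l₂ he
    rw [h3, he] at hfresh
    have h1 : (l₁.length + 1) * n ≤ ((l₁ ++ ch ++ l₂).length + 1) * n :=
      Nat.mul_le_mul_right _ (by simp)
    have h2 : (l₁.length + ch.length + 1) * n ≤ ((l₁ ++ ch ++ l₂).length + 1) * n :=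
      Nat.mul_le_mul_right _ (by simp)
    omega
  -- the loop over the children of the node `x`
  have loop : ∀ (x : List (Fin n)) (l₁ ch l₂ : List (List (Fin n))) (s₂ : State) (τ₂ : ℕ),
      (x = fst c ∨ x = c.dropLast) → base ++ new = l₁ ++ ch ++ l₂ →
      s.arr 14 (code (base ++ new) x) = (l₁.length + 1) * n →
      s.arr 15 (code (base ++ new) x) = (l₁.length + ch.length + 1) * n →
      (∀ e ∈ ch, ∃ w, e = w :: x) → (∀ w, IsCl G (w :: x) → w :: x ∈ ch) →
      ch.length ≤ min (nch G (fst c)) (nch G c.dropLast) →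
      s₂.arr = Function.update s.arr 14
        (Function.update (s.arr 14) (code (base ++ new) c) (s.var 3)) →
      s₂.var 8 = code (base ++ new) (fst c) → s₂.var 16 = code (base ++ new) c.dropLast →
      s₂.var 17 = code (base ++ new) x →
      (∀ y, y ≠ 8 → y ≠ 16 → y ≠ 17 → s₂.var y = s₁.var y) → τ₂ ≤ τ + 50 →
      WP W (.setVar 18 (.get 14 (.var 17)) ;;
        .setVar 19 (.get 15 (.var 17)) ;;
        .while (.sub (.var 19) (.var 18)) tryChild ;;
        .setArr 15 (.var 7) (.var 3) ;;
        .setVar 7 (.add (.var 7) (.var 0))) Q s₂ τ₂ := by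
    intro x l₁ ch l₂ s₂ τ₂ hx hnd h14 h15 hch hch' hlen ha₂ h8 h16 h17 hv₂ hτ₂
    have hxc : code (base ++ new) x ≠ code (base ++ new) c := by
      rcases hx with rfl | rfl <;> assumption
    obtain ⟨hb1, hb2⟩ := hbound hnd
    have h14' : s₂.arr 14 (code (base ++ new) x) = (l₁.length + 1) * n := by
      rw [ha₂, Function.update_self, Function.update_of_ne hxc, h14]
    have h15' : s₂.arr 15 (code (base ++ new) x) = (l₁.length + ch.length + 1) * n := by
      rw [ha₂, Function.update_of_ne (by decide), h15]
    refine WP.seq (WP.setVar (by simp [h17, h14', hb1]) ?_)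
    refine WP.seq (WP.setVar (by simp [h17, h15', hb2]) ?_)
    refine WP.seq (wp_children hG hR hk (h.congr (by simp [hv₂, hv0]) (by simp [hv₂, hv3])
      (by simp [hv₂, hv11]) (by simp [ha₂])) hx hcn hnd hch hch' hnew (by simp [hv₂, hv7, h7])
      (by simp [h8]) (by simp [h16]) (by simp [h17, h14']) (by simp [h17, h15']) ?_)
    intro s₃ τ₃ wk' added hS₃ hwk' hadd hadd' hv₃ ha₃ hτ₃
    have hv7₃ : s₃.var 7 = s.var 7 := by
      rw [hv₃ 7 (by decide) (by decide) (by decide) (by decide)]; simp [hv₂, hv7]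
    have hv0₃ : s₃.var 0 = s.var 0 := by
      rw [hv₃ 0 (by decide) (by decide) (by decide) (by decide)]; simp [hv₂, hv0]
    have hfresh₃ := hR.fresh_le hk hS₃
    have h3₃ := hS₃.tree.fresh
    have hle7 := code_add_le hcb'
    have hss := h.tree.stride
    refine WP.seq (WP.setArr (by simp [hv7₃]; omega) (by simp; omega) ?_)
    refine WP.setVar (by simp [hv7₃, hv0₃]; omega) ?_
    have hcode : ∀ {d}, d ∈ base ++ new → code (base ++ (new ++ added)) d = code (base ++ new) d := by
      intro d hd
      rw [← List.append_assoc, code_append hd]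
    refine hQ _ _ wk' (new ++ added) (hS₃.congr (by simp) (by simp) (by simp) (by simp)) ?_ ?_ ?_ ?_
      ?_ ?_
    · intro w d hwd hwd'
      rcases List.mem_append.1 hwd with h1 | h1
      · exact absurd h1 hwd'
      · obtain ⟨w', h2⟩ := hadd _ h1
        cases h2; rfl
    · intro z hz hz'
      rw [← List.append_assoc]
      have ha14 : s₃.arr 14 = Function.update (s.arr 14) (code (base ++ new) c) (s.var 3) := by
        rw [ha₃ 14 (by simp)]; simp [ha₂]
      have ha15 : s₃.arr 15 = s.arr 15 := by rw [ha₃ 15 (by simp)]; simp [ha₂]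
      by_cases hzc : z = c
      · subst hzc
        refine ⟨base ++ new, added, [], by simp, ?_, ?_, hadd, hadd'⟩
        · rw [code_append hcb']
          simp only [State.setVar_arr, State.setArr_arr, Expr.eval]
          rw [Function.update_of_ne (by decide), ha14, Function.update_self, h3]
        · rw [code_append hcb']
          simp only [State.setVar_arr, State.setArr_arr, Expr.eval, hv7₃, h7, Function.update_self,
            h3₃]
          rw [← List.append_assoc, List.length_append (as := base ++ new)]
      · have hcl : Closed G (base ++ new) s z := by
          refine hclosed z hz (hz'.imp_right fun h1 => ?_)
          rcases List.mem_append.1 h1 with h2 | h2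
          · exact h2
          · exact absurd (List.mem_singleton.1 h2) hzc
        refine (hcl.update hn (List.mem_append_left _ hz) hcb' hzc (i := s.var 3) (j := s₃.var 3)
          ?_ ?_).append (List.mem_append_left _ hz)
        · simp [ha14]
        · simp [ha15, hv7₃, h7]
    · simp [hv7₃, hv0₃, hss]
    · simp [hv₃, hv₂, hv15]
    · have h12 : s₃.var 12 = s₁.var 12 := by
        rw [hv₃ 12 (by decide) (by decide) (by decide) (by decide)]; simp [hv₂]
      have h13 : s₃.var 13 = s₁.var 13 := by
        rw [hv₃ 13 (by decide) (by decide) (by decide) (by decide)]; simp [hv₂]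
      refine ⟨fun e he => ?_, .inr ?_⟩
      · rw [hwk' e he]
        simpa [h12] using hb₁.1 e he
      · rcases hb₁.2 with ⟨h1, -⟩ | ⟨b, hb, h1, h2⟩
        · simp at h1
        · refine ⟨b, hb, ?_, ?_⟩
          · rw [hcode (List.mem_append_left _ (h.done_mem hb)), ← h1]
            simp [h13]
          · rw [hwk' b hb, ← h2]
            simp [h12]
    · simp only [Expr.cost] at hτ₃ ⊢
      omega
  -- The difference of the two ends of a block is `n` times the number of children, so comparing
  -- differences compares the numbers without a division.
  have hsub : ∀ a b : ℕ, (a + b + 1) * n - (a + 1) * n = b * n := fun a b => by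
    rw [show (a + b + 1) * n = (a + 1) * n + b * n by ring, Nat.add_sub_cancel_left]
  have hev : (Expr.sub (.sub (.get 15 (.var 8)) (.get 14 (.var 8)))
      (.sub (.get 15 (.var 16)) (.get 14 (.var 16)))).eval
      (((s₁.setArr 14 (s₁.var 7) (s₁.var 3)).setVar 8 (code (base ++ new) (fst c))).setVar 16
      (code (base ++ new) c.dropLast)) = ch.length * n - ch'.length * n := by
    simp [ha₁, hv7, h7, Function.update_of_ne hfc, Function.update_of_ne hgc, h14, h15, h14', h15',
      hsub]
  simp only [Expr.eval, State.setVar_arr, State.setArr_arr, State.setVar_var, State.setArr_var,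
    ha₁, hv7, h7, ne_eq, show (8 : ℕ) ≠ 14 by decide, show (9 : ℕ) ≠ 14 by decide,
    show (7 : ℕ) ≠ 8 by decide, not_false_eq_true, Function.update_of_ne, hF, hS]
  refine WP.seq (WP.ite (fun hne => ?_) (fun he => ?_))
  · have hlt : ch'.length ≤ ch.length := by
      rw [hv7, h7] at hev
      rw [hev] at hne
      by_contra hh
      have := Nat.mul_le_mul_right n (not_le.1 hh).le
      omega
    refine WP.setVar (by simp; have := hle c.dropLast; omega) ?_
    exact loop c.dropLast l₁' ch' l₂' _ _ (.inr rfl) hnd' h14' h15' hchg hchg'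
      (le_min (hlt.trans hlen) hlen') (by simp [ha₁, hv3]) (by simp) (by simp) (by simp)
      (fun y h1 h2 h3 => by simp [h1, h2, h3]) (by simp; omega)
  · have hlt : ch.length ≤ ch'.length := by
      rw [hv7, h7] at hev
      rw [hev] at he
      exact Nat.le_of_mul_le_mul_right (by omega : ch.length * n ≤ ch'.length * n) hn
    refine WP.setVar (by simp; have := hle (fst c); omega) ?_
    exact loop (fst c) l₁ ch l₂ _ _ (.inl rfl) hnd h14 h15 hch hch'
      (le_min hlen (hlt.trans hlen')) (by simp [ha₁, hv3]) (by simp) (by simp) (by simp)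
      (fun y h1 h2 h3 => by simp [h1, h2, h3]) (by simp; omega)

/-- Extend all cliques of the current level. -/
def nextStage : Prog :=
  .setVar 11 (.add (.var 11) (.const 1)) ;;
  .setVar 7 (.var 15) ;;
  .setVar 15 (.var 3) ;;
  .setVar 12 (.const 0) ;;
  .while (.sub (.var 15) (.var 7)) expand

/-- The cliques of a level are stored consecutively in an admissible order, so the stage scans the
addresses from the start of the level in strides of `n`. The new level starts at the address that is
fresh when the stage begins. -/
theorem wp_nextStage (hG : IsDag G) (hR : Room G K W) {k : ℕ} (hk : k + 1 ≤ K)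
    {base done lev : List (List (Fin n))} {wk : List (Fin n) → List (Fin n)}
    (h : Finished G k base done lev wk s)
    (hQ : ∀ s' τ' wk' done' new, Finished G (k + 1) (base ++ lev) done' new wk' s' →
      τ' ≤ τ + 300 * (stageCost G (k + 1) + 1) → Q s' τ') :
    WP W nextStage Q s τ := by
  have hlev := hR.level
  have hT := h.stage.tree
  have hfresh := hR.fresh_le (by omega) h.stage
  have h3 := hT.fresh
  have h15le : s.var 15 ≤ s.var 3 := by
    rw [h.level_start, h3]
    exact Nat.mul_le_mul_right _ (by simp)
  have h11 := h.stage.level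
  refine WP.seq (WP.setVar (by simp; omega) ?_)
  refine WP.seq (WP.setVar (by simp; omega) ?_)
  refine WP.seq (WP.setVar (by simp; omega) ?_)
  refine WP.seq (WP.setVar (by simp) ?_)
  have hstart := h.start (s' := (((s.setVar 11 (s.var 11 + 1)).setVar 7 (s.var 15)).setVar 15
    (s.var 3)).setVar 12 0) rfl (by simp) (by simp) (by simp [h11])
  let cost : List (Fin n) → ℕ := fun c => 1 + min (nch G (fst c)) (nch G c.dropLast)
  refine WP.while (fun r s' τ' => ∃ done' todo new wk', lev = done' ++ todo ∧ todo.length = r ∧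
    Stage G (k + 1) (base ++ lev) done' new wk' s' ∧
    s'.var 7 = (base.length + done'.length + 1) * n ∧
    s'.var 15 = ((base ++ lev).length + 1) * n ∧
    (∀ x ∈ base ++ lev, x.length < k + 1 ∨ x ∈ done' → Closed G (base ++ lev ++ new) s' x) ∧
    Best (base ++ lev ++ new) done' wk' s' ∧
    τ' ≤ τ + 50 + 250 * (done'.map cost).sum) ?_ ?_ lev.length
    ⟨[], lev, [], id, rfl, rfl, hstart.congr (by simp) (by simp) (by simp) (by simp),
      by simp [h.level_start], by simp [h3], ?_, ⟨by simp, .inl ⟨rfl, by simp⟩⟩, by simp⟩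
  · rintro r s' τ' ⟨done', todo, new, wk', hl, hr, hS, h7, h15, hcl, hb, hτ⟩ h0
    have htodo : todo = [] := by
      by_contra hne
      have hn : 0 < n := by
        by_contra hn0
        obtain ⟨c, todo, rfl⟩ := List.exists_cons_of_ne_nil hne
        have hc : c ∈ base ++ lev := by simp [hl]
        exact hn0 (c.head (hT.ne_nil c hc)).pos
      have : 0 < todo.length := List.length_pos_iff.2 hne
      have h1 : (base.length + done'.length + 1 + 1) * n ≤ ((base ++ lev).length + 1) * n :=
        Nat.mul_le_mul_right _ (by simp [hl]; omega)
      rw [Nat.succ_mul] at h1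
      simp only [Expr.eval] at h0
      omega
    subst htodo
    rw [List.append_nil] at hl
    subst hl
    refine hQ _ _ wk' lev new ⟨hS, fun c hc hck => h.mem_new.2 ⟨hc, hck⟩, fun x hx => ?_, h15, hb⟩ ?_
    · refine hcl x hx ?_
      rcases List.mem_append.1 hx with hx | hx
      · have := ((h.stage.mem_base x).1 hx).2.2
        exact .inl (by omega)
      · exact .inr hx
    -- The level lists every `(k + 1)`-clique exactly once.
    · have hsum : (lev.map cost).sum = stageCost G (k + 1) := by
        classical
        have hnd : lev.Nodup := hT.nodup.sublist (List.sublist_append_right _ _)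
        rw [stageCost, ← List.sum_toFinset cost hnd]
        refine Finset.sum_congr ?_ fun _ _ => rfl
        ext c
        rw [List.mem_toFinset, h.mem_new, mem_cliq, and_comm]
      rw [hsum] at hτ
      simp only [Expr.cost]
      omega
  · rintro r s' τ' ⟨done', todo, new, wk', hl, hr, hS, h7, h15, hcl, hb, hτ⟩ h0
    simp only [Expr.eval] at h0
    obtain ⟨c, todo, rfl⟩ := List.exists_cons_of_ne_nil (l := todo) (by
      rintro rfl
      rw [List.append_nil] at hl
      subst hl
      rw [h7, h15, List.length_append] at h0
      simp at h0)
    have hlevnd : lev.Nodup := hT.nodup.sublist (List.sublist_append_right _ _)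
    have hclev : c ∈ lev := by simp [hl]
    obtain ⟨hcc, hck⟩ := h.mem_new.1 hclev
    have hbefore := h.stage.new_before
    rw [hl] at hbefore hlevnd
    have hcnd : c ∉ done' := fun hc => List.disjoint_of_nodup_append hlevnd hc (by simp)
    have hpop := hS.pop hcc hck fun d hd =>
      (List.pairwise_append.1 hbefore).2.2 d hd c (by simp)
    have hpos := h.stage.pos
    refine wp_expand hG hR hk hpop hcnd ?_ hcl ?_ ?_ hb ?_
    · rw [← List.length_pos_iff, List.length_dropLast]
      omega
    · intro w hw
      exact hcnd (hS.new_tail w c hw)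
    · have h1 : base ++ lev ++ new = (base ++ done') ++ c :: (todo ++ new) := by simp [hl]
      have h2 := hS.tree.nodup
      rw [h1] at h2 ⊢
      rw [code_split h2, h7, List.length_append]
    · intro s'' τ'' wk'' new' hS' hnew' hcl' h7' h15' hb' hτ'
      refine ⟨todo.length, by simp at hr; omega, done' ++ [c], todo, new', wk'', by simp [hl], rfl,
        hS', ?_, h15'.trans h15, hcl', hb', ?_⟩
      · rw [h7', h7]; simp; ring
      · rw [List.map_append, List.sum_append]
        have hc1 : ([c].map cost).sum = 1 + min (nch G (fst c)) (nch G c.dropLast) := by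
          simp [cost]
        simp only [Expr.cost] at hτ'
        rw [hc1]
        omega
  · intro x hx hx'
    rw [List.append_nil]
    rcases List.mem_append.1 hx with hx | hx
    · exact (h.closed x hx).congr (by simp) (by simp)
    · exfalso
      have := (h.mem_new.1 hx).2
      simp at hx'
      omega

end Extend

end MaxClique

/-! ### Initialisation: vertices, adjacency lists, in-degrees and the queue. -/

namespace MaxClique

open DoubleThreshold WordRAM

local infixr:60 " ;; " => Prog.seq

attribute [local simp] Expr.eval Expr.cost

section Start

variable {n : ℕ} {G : Digraph (Fin n)} {K W : ℕ} {Q : State → ℕ → Prop} {s : State} {τ : ℕ}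

/-- The cliques with one vertex. -/
def singles (n : ℕ) : List (List (Fin n)) := (List.finRange n).map fun u => [u]

theorem mem_singles {c : List (Fin n)} : c ∈ singles n ↔ ∃ u, c = [u] := by
  simp [singles, eq_comm]

theorem length_singles : (singles n).length = n := by simp [singles]

theorem nodup_singles : (singles n).Nodup :=
  (List.nodup_finRange n).map fun a b h => by simpa using h

theorem code_singles (u : Fin n) : code (singles n) [u] = (u + 1) * n := by
  have h : (singles n)[(u : ℕ)]'(by rw [length_singles]; exact u.2) = [u] := by simp [singles]
  rw [code, if_pos (mem_singles.2 ⟨u, rfl⟩)]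
  conv_lhs => rw [← h, nodup_singles.idxOf_getElem]

/-- Store the vertices as cliques. -/
def initVertices : Prog :=
  .setVar 2 (.const 0) ;;
  .setVar 3 (.var 0) ;;
  .while (.sub (.var 0) (.var 2))
    (.setArr 2 (.var 2) (.var 3) ;;
     .setArr 7 (.var 3) (.var 2) ;;
     .setArr 12 (.var 3) (.const 1) ;;
     .setVar 3 (.add (.var 3) (.var 0)) ;;
     .setVar 2 (.add (.var 2) (.const 1)))

theorem wp_initVertices (hW : (n + 2) * n + n + 1 ≤ W) (h0 : s.var 0 = n)
    (hQ : ∀ s' τ', (∀ x, x ≠ 2 → x ≠ 3 → s'.var x = s.var x) → s'.var 3 = (n + 1) * n →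
      (∀ a, a ≠ 2 → a ≠ 7 → a ≠ 12 → s'.arr a = s.arr a) →
      (∀ u < n, s'.arr 2 u = (u + 1) * n ∧ s'.arr 7 ((u + 1) * n) = u ∧
        s'.arr 12 ((u + 1) * n) = 1) →
      τ' ≤ τ + 10 + 30 * n → Q s' τ') :
    WP W initVertices Q s τ := by
  refine WP.seq (WP.setVar (by simp) ?_)
  refine WP.seq (WP.setVar (by simp [h0]; omega) ?_)
  refine WP.while (fun r s' τ' => r + s'.var 2 = n ∧
    (∀ x, x ≠ 2 → x ≠ 3 → s'.var x = s.var x) ∧ s'.var 3 = (s'.var 2 + 1) * n ∧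
      (∀ a, a ≠ 2 → a ≠ 7 → a ≠ 12 → s'.arr a = s.arr a) ∧
      (∀ u < s'.var 2, s'.arr 2 u = (u + 1) * n ∧ s'.arr 7 ((u + 1) * n) = u ∧
        s'.arr 12 ((u + 1) * n) = 1) ∧
      τ' ≤ τ + 5 + 30 * s'.var 2) ?_ ?_ n
    ⟨by simp, fun x h1 h2 => by simp [h1, h2], by simp [h0], by simp, by simp, by simp⟩
  · rintro r s' τ' ⟨hr, hv, h3, ha, hu, hτ⟩ he
    simp only [Expr.eval, hv 0 (by decide) (by decide), h0] at he
    have h2 : s'.var 2 = n := by omega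
    rw [h2] at h3 hu hτ
    exact hQ _ _ hv h3 ha hu (by simp; omega)
  · rintro r s' τ' ⟨hr, hv, h3, ha, hu, hτ⟩ he
    have hv0 := hv 0 (by decide) (by decide)
    simp only [Expr.eval, hv0, h0] at he
    generalize hi : s'.var 2 = i at *
    have hle : (i + 2) * n ≤ (n + 2) * n := Nat.mul_le_mul_right _ (by omega)
    have hadd : (i + 1) * n + n = (i + 1 + 1) * n := by ring
    have hadd' : (i + 2) * n = (i + 1 + 1) * n := by ring
    refine WP.seq (WP.setArr (by simp [hi]; omega) (by simp [h3]; omega) ?_)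
    refine WP.seq (WP.setArr (by simp [h3]; omega) (by simp [hi]; omega) ?_)
    refine WP.seq (WP.setArr (by simp [h3]; omega) (by simp; omega) ?_)
    refine WP.seq (WP.setVar (by simp [h3, hv0, h0]; omega) ?_)
    refine WP.setVar (by simp [hi]; omega) ⟨r - 1, by omega, ?_, ?_, ?_, ?_, ?_, ?_⟩
    · simp [hi]; omega
    · intro x h1 h2; simp [h1, h2, hv]
    · simp [hi, h3, hv0, h0, hadd]
    · intro a h1 h2 h3; simp [h1, h2, h3, ha]
    · intro u hu'
      simp [hi] at hu'
      have hn : 0 < n := by omega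
      simp only [Expr.eval, State.setVar_arr, State.setVar_var, State.setArr_var, State.setArr_arr,
        h3, hi]
      rcases Nat.lt_or_eq_of_le hu' with h1 | rfl
      · have hne : (u + 1) * n ≠ (i + 1) * n := fun h => by
          have := Nat.eq_of_mul_eq_mul_right hn h
          omega
        simpa [Function.update_of_ne hne, Function.update_of_ne h1.ne] using hu u h1
      · simp
    · simp [hi]; omega

/-- A linked list that starts at `e` and holds the elements of `l`. -/
def Links (nxt : ℕ → ℕ) : ℕ → List ℕ → Prop
  | e, [] => e = 0
  | e, i :: l => e = i + 1 ∧ Links nxt (nxt i) l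

/-- All the adjacency lists share one array of links, indexed by the edges. Pushing a new edge onto
one of them writes a cell that no list uses yet. -/
theorem Links.update {nxt : ℕ → ℕ} {l : List ℕ} {e i x : ℕ} (h : Links nxt e l) (hi : i ∉ l) :
    Links (Function.update nxt i x) e l := by
  induction l generalizing e with
  | nil => exact h
  | cons j l ih =>
    simp only [List.mem_cons, not_or] at hi
    refine ⟨h.1, ?_⟩
    rw [Function.update_of_ne (Ne.symm hi.1)]
    exact ih h.2 hi.2

/-- For each vertex, chain the edges with this tail, and count the edges with this head. -/
def initEdges : Prog :=
  .setVar 4 (.const 0) ;;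
  .while (.sub (.var 1) (.var 4))
    (.setArr 4 (.var 4) (.get 3 (.get 0 (.var 4))) ;;
     .setArr 3 (.get 0 (.var 4)) (.add (.var 4) (.const 1)) ;;
     .setArr 5 (.get 1 (.var 4)) (.add (.get 5 (.get 1 (.var 4))) (.const 1)) ;;
     .setVar 4 (.add (.var 4) (.const 1)))

theorem wp_initEdges {es : List (Fin n × Fin n)} (hes : es.Nodup) (hn : n ≤ W)
    (hm : es.length + 1 ≤ W) (h1 : s.var 1 = es.length)
    (h0 : ∀ i (u v : Fin n), es[i]? = some (u, v) → s.arr 0 i = u ∧ s.arr 1 i = v)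
    (h3 : ∀ u, s.arr 3 u = 0) (h5 : ∀ v, s.arr 5 v = 0)
    (hQ : ∀ s' τ', (∀ x, x ≠ 4 → s'.var x = s.var x) →
      (∀ a, a ≠ 3 → a ≠ 4 → a ≠ 5 → s'.arr a = s.arr a) →
      (∀ u : Fin n, ∃ l : List ℕ, Links (s'.arr 4) (s'.arr 3 u) l ∧ l.Nodup ∧
        ∀ i, i ∈ l ↔ ∃ v, es[i]? = some (u, v)) →
      (∀ v : Fin n, s'.arr 5 v = {u | (u, v) ∈ es}.ncard) →
      τ' ≤ τ + 10 + 40 * es.length → Q s' τ') :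
    WP W initEdges Q s τ := by
  refine WP.seq (WP.setVar (by simp) ?_)
  refine WP.while (fun r s' τ' => r + s'.var 4 = es.length ∧
    (∀ x, x ≠ 4 → s'.var x = s.var x) ∧
    (∀ a, a ≠ 3 → a ≠ 4 → a ≠ 5 → s'.arr a = s.arr a) ∧
    (∀ u : Fin n, s'.arr 3 u ≤ es.length ∧ ∃ l : List ℕ, Links (s'.arr 4) (s'.arr 3 u) l ∧
      l.Nodup ∧ ∀ i, i ∈ l ↔ i < s'.var 4 ∧ ∃ v, es[i]? = some (u, v)) ∧
    (∀ v : Fin n, s'.arr 5 v = {u | (u, v) ∈ es.take (s'.var 4)}.ncard) ∧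
    τ' ≤ τ + 5 + 40 * s'.var 4) ?_ ?_ es.length
    ⟨by simp, fun x h1 => by simp [h1], by simp, fun u => ⟨by simp [h3], [], by simp [Links, h3],
      by simp, by simp⟩, by simp [h5], by simp⟩
  · rintro r s' τ' ⟨hr, hv, ha, hl, hd, hτ⟩ he
    simp only [Expr.eval, hv 1 (by decide), h1] at he
    have h4 : s'.var 4 = es.length := by omega
    refine hQ _ _ hv ha (fun u => ?_) (fun v => ?_) (by simp; omega)
    · obtain ⟨-, l, hl1, hl2, hl3⟩ := hl u
      refine ⟨l, hl1, hl2, fun i => ?_⟩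
      rw [hl3, h4]
      exact ⟨fun h => h.2, fun ⟨v, h⟩ => ⟨(List.getElem?_eq_some_iff.1 h).1, v, h⟩⟩
    · rw [hd, h4, List.take_length]
  · rintro r s' τ' ⟨hr, hv, ha, hl, hd, hτ⟩ he
    simp only [Expr.eval, hv 1 (by decide), h1] at he
    generalize hi : s'.var 4 = i at *
    have hilt : i < es.length := by omega
    obtain ⟨⟨u, v⟩, huv⟩ : ∃ p, es[i]? = some p := ⟨es[i], by simp [hilt]⟩
    obtain ⟨htail, hhead⟩ := h0 i u v huv
    have ha0 := ha 0 (by decide) (by decide) (by decide)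
    have ha1 := ha 1 (by decide) (by decide) (by decide)
    have hult := u.2
    have hvlt := v.2
    have hle := (hl u).1
    have hdle : s'.arr 5 v + 1 ≤ W := by
      have h2 : {u | (u, v) ∈ es.take i}.ncard ≤ es.length := by
        classical
        have h4 : {u | (u, v) ∈ es.take i} ⊆ ((es.map Prod.fst).toFinset : Set (Fin n)) := by
          intro x hx
          simp only [List.coe_toFinset, List.mem_map, Set.mem_ofPred_eq]
          exact ⟨(x, v), List.mem_of_mem_take hx, rfl⟩
        refine (Set.ncard_le_ncard h4).trans ?_
        rw [Set.ncard_coe_finset]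
        exact (List.toFinset_card_le _).trans (by simp)
      rw [hd]
      omega
    refine WP.seq (WP.setArr (by simp [hi]; omega) (by simp [hi, ha0, htail]; omega) ?_)
    refine WP.seq (WP.setArr (by simp [hi, ha0, htail]; omega) (by simp [hi]; omega) ?_)
    refine WP.seq (WP.setArr (by simp [hi, ha1, hhead]; omega) (by simp [hi, ha1, hhead]; omega) ?_)
    refine WP.setVar (by simp [hi]; omega) ⟨r - 1, by omega, ?_, ?_, ?_, ?_, ?_, ?_⟩
    · simp [hi]; omega
    · intro x h1; simp [h1, hv]
    · intro a h1 h2 h3; simp [h1, h2, h3, ha]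
    · intro u'
      obtain ⟨-, l, hl1, hl2, hl3⟩ := hl u'
      have hil : i ∉ l := fun h => by
        have := ((hl3 i).1 h).1
        omega
      rcases eq_or_ne u' u with rfl | hne
      · refine ⟨by simp [hi, ha0, htail]; omega, i :: l, ⟨?_, ?_⟩, ?_, ?_⟩
        · simp [hi, ha0, htail]
        · simpa [hi, ha0, htail] using hl1.update hil
        · exact List.nodup_cons.2 ⟨hil, hl2⟩
        · intro j
          simp only [List.mem_cons, hl3, State.setVar_var, Expr.eval, State.setArr_var,
            Function.update_self, hi]
          constructor
          · rintro (rfl | ⟨h1, h2⟩)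
            · exact ⟨by omega, v, huv⟩
            · exact ⟨by omega, h2⟩
          · rintro ⟨h1, h2⟩
            rcases Nat.lt_succ_iff_lt_or_eq.1 h1 with h1 | h1
            · exact .inr ⟨h1, h2⟩
            · exact .inl h1
      · have hne' : (u' : ℕ) ≠ u := fun h => hne (Fin.ext h)
        refine ⟨by simpa [hi, ha0, htail, Function.update_of_ne hne'] using (hl u').1, l, ?_, hl2, ?_⟩
        · simpa [hi, ha0, htail, Function.update_of_ne hne'] using hl1.update hil
        · intro j
          simp only [hl3, State.setVar_var, Expr.eval, State.setArr_var, Function.update_self, hi]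
          refine and_congr_left fun ⟨v', h2⟩ => ⟨fun h => by omega, fun h => ?_⟩
          rcases Nat.lt_succ_iff_lt_or_eq.1 h with h1 | rfl
          · exact h1
          · rw [huv] at h2
            cases h2
            exact absurd rfl hne
    · intro v'
      have htake : es.take (i + 1) = es.take i ++ [(u, v)] := by
        rw [List.take_add_one, huv]; rfl
      have hnot : (u, v) ∉ es.take i := by
        have h2 : (es.take (i + 1)).Nodup := hes.sublist (List.take_sublist _ _)
        rw [htake] at h2
        exact fun h => List.disjoint_of_nodup_append h2 h (by simp)
      simp only [State.setVar_var, Expr.eval, State.setArr_var, Function.update_self, hi, htake,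
        State.setVar_arr, State.setArr_arr, ne_eq, show (1 : ℕ) ≠ 3 by decide,
        show (1 : ℕ) ≠ 4 by decide, show (5 : ℕ) ≠ 3 by decide, show (5 : ℕ) ≠ 4 by decide,
        not_false_eq_true, Function.update_of_ne, ha1, hhead]
      rcases eq_or_ne v' v with rfl | hne
      · rw [Function.update_self, hd]
        have : {x | (x, v') ∈ es.take i ++ [(u, v')]} = insert u {x | (x, v') ∈ es.take i} := by
          ext x; simp [or_comm]
        rw [this, Set.ncard_insert_of_notMem (by simpa using hnot)]
      · have hne' : (v' : ℕ) ≠ v := fun h => hne (Fin.ext h)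
        rw [Function.update_of_ne hne', hd]
        congr 1
        ext x
        simp [hne]
    · simp [hi]; omega

/-- The queue of the vertices all of whose predecessors have been processed. -/
structure Queue (G : Digraph (Fin n)) (new : List (List (Fin n))) (qs : List (Fin n))
    (s : State) : Prop where
  len : s.var 6 = qs.length
  get : ∀ j (v : Fin n), qs[j]? = some v → s.arr 6 j = v
  nodup : qs.Nodup
  -- An edge counts as treated once its 2-clique has been created, so this is the remaining
  -- in-degree of a topological sort.
  deg : ∀ v : Fin n, s.arr 5 v = {u | G.Adj u v ∧ [v, u] ∉ new}.ncard
  mem : ∀ v : Fin n, v ∈ qs ↔ s.arr 5 v = 0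

/-- Put the vertices without predecessors into the queue. -/
def initQueue : Prog :=
  .setVar 2 (.const 0) ;;
  .while (.sub (.var 0) (.var 2))
    (.ite (.get 5 (.var 2)) .skip
      (.setArr 6 (.var 6) (.var 2) ;; .setVar 6 (.add (.var 6) (.const 1))) ;;
     .setVar 2 (.add (.var 2) (.const 1)))

theorem wp_initQueue (hn : n + 1 ≤ W) (h0 : s.var 0 = n) (h6 : s.var 6 = 0)
    (hd : ∀ v : Fin n, s.arr 5 v = {u | G.Adj u v}.ncard)
    (hQ : ∀ s' τ' qs, (∀ x, x ≠ 2 → x ≠ 6 → s'.var x = s.var x) →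
      (∀ a, a ≠ 6 → s'.arr a = s.arr a) → Queue G [] qs s' →
      τ' ≤ τ + 10 + 30 * n → Q s' τ') :
    WP W initQueue Q s τ := by
  refine WP.seq (WP.setVar (by simp) ?_)
  refine WP.while (fun r s' τ' => r + s'.var 2 = n ∧
    (∀ x, x ≠ 2 → x ≠ 6 → s'.var x = s.var x) ∧ (∀ a, a ≠ 6 → s'.arr a = s.arr a) ∧
    (∃ qs : List (Fin n), s'.var 6 = qs.length ∧ (∀ j (v : Fin n), qs[j]? = some v → s'.arr 6 j = v) ∧
      qs.Nodup ∧ ∀ v : Fin n, v ∈ qs ↔ v < s'.var 2 ∧ s.arr 5 v = 0) ∧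
    τ' ≤ τ + 5 + 30 * s'.var 2) ?_ ?_ n
    ⟨by simp, fun x h1 h2 => by simp [h1], by simp, ⟨[], by simp [h6]⟩, by simp⟩
  · rintro r s' τ' ⟨hr, hv, ha, ⟨qs, hq1, hq2, hq3, hq4⟩, hτ⟩ he
    simp only [Expr.eval, hv 0 (by decide) (by decide), h0] at he
    have h2 : s'.var 2 = n := by omega
    refine hQ _ _ qs hv ha ⟨hq1, hq2, hq3, ?_, ?_⟩ (by simp; omega)
    · intro v; rw [ha 5 (by decide), hd]; simp
    · intro v
      rw [ha 5 (by decide), hq4, h2]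
      exact and_iff_right v.2
  · rintro r s' τ' ⟨hr, hv, ha, ⟨qs, hq1, hq2, hq3, hq4⟩, hτ⟩ he
    simp only [Expr.eval, hv 0 (by decide) (by decide), h0] at he
    generalize hi : s'.var 2 = i at *
    have hin : i < n := by omega
    have hqn : qs.length ≤ n := by simpa using hq3.length_le_card
    refine WP.seq (WP.ite (fun hne => ?_) (fun he => ?_))
    · refine WP.skip (WP.setVar (by simp [hi]; omega) ⟨r - 1, by omega, ?_, ?_, ?_,
        ⟨qs, by simp [hq1], hq2, hq3, ?_⟩, ?_⟩)
      · simp [hi]; omega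
      · intro x h1 h2; simp [h1, hv x h1 h2]
      · simpa using ha
      · intro v
        rw [hq4]
        simp only [State.setVar_var, Expr.eval, Function.update_self, hi]
        refine and_congr_left fun h => ⟨fun h => by omega, fun h' => ?_⟩
        rcases Nat.lt_succ_iff_lt_or_eq.1 h' with h1 | rfl
        · exact h1
        · simp only [Expr.eval, hi, ha 5 (by decide)] at hne
          exact absurd h hne
      · simp [hi]; omega
    · refine WP.seq (WP.setArr (by simp [hq1]; omega) (by simp [hi]; omega) ?_)
      refine WP.setVar (by simp [hq1]; omega) ?_
      refine WP.setVar (by simp [hi]; omega) ⟨r - 1, by omega, ?_, ?_, ?_,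
        ⟨qs ++ [⟨i, hin⟩], by simp [hq1], ?_, ?_, ?_⟩, ?_⟩
      · simp [hi]; omega
      · intro x h1 h2; simp [h1, h2, hv x h1 h2]
      · intro a h1; simp [h1, ha]
      · intro j v hj
        simp only [State.setVar_arr, State.setArr_arr, Function.update_self, Expr.eval, hq1, hi]
        rcases lt_trichotomy j qs.length with h1 | rfl | h1
        · rw [Function.update_of_ne h1.ne]
          exact hq2 j v (by rwa [List.getElem?_append_left h1] at hj)
        · simp at hj
          simp [← hj]
        · have h2 := (List.getElem?_eq_some_iff.1 hj).1
          simp at h2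
          omega
      · refine List.nodup_append.2 ⟨hq3, by simp, ?_⟩
        intro a ha b hb hab
        simp only [List.mem_singleton] at hb
        have := ((hq4 a).1 ha).1
        rw [hab, hb] at this
        exact lt_irrefl _ this
      · intro v
        simp only [Expr.eval, hi, ha 5 (by decide)] at he
        simp only [State.setVar_var, Expr.eval, Function.update_self, hi, List.mem_append, hq4,
          List.mem_singleton, State.setArr_var, ne_eq, show (2 : ℕ) ≠ 6 by decide,
          not_false_eq_true, Function.update_of_ne]
        constructor
        · rintro (⟨h1, h2⟩ | rfl)
          · exact ⟨by omega, h2⟩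
          · exact ⟨by simp, he⟩
        · rintro ⟨h1, h2⟩
          rcases Nat.lt_succ_iff_lt_or_eq.1 h1 with h1 | h1
          · exact .inl ⟨h1, h2⟩
          · exact .inr (Fin.ext h1)
      · simp [hi]; omega

/-- The state before stage 1. -/
theorem stage_one (h0 : s.var 0 = n) (h3 : s.var 3 = (n + 1) * n) (h11 : s.var 11 = 1)
    (hu : ∀ u < n, s.arr 2 u = (u + 1) * n ∧ s.arr 7 ((u + 1) * n) = u ∧
        s.arr 12 ((u + 1) * n) = 1)
    (ha : ∀ a, a = 10 ∨ a = 11 ∨ a = 13 → ∀ i, s.arr a i = 0) :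
    Stage G 1 (singles n) [] [] id s where
  tree := by
    rw [List.append_nil]
    have hs : ∀ {w : Fin n} {c}, w :: c ∈ singles n → c = [] := by
      intro w c h
      obtain ⟨u, hu⟩ := mem_singles.1 h
      simp at hu
      exact hu.2
    refine ⟨nodup_singles, ?_, ?_, ?_, ?_, ?_, code_singles, h0, ?_, ?_, ?_, ?_, ?_, ?_, ?_, ?_⟩
    · intro c hc
      obtain ⟨u, rfl⟩ := mem_singles.1 hc
      simp [IsCl]
    · intro c hc
      obtain ⟨u, rfl⟩ := mem_singles.1 hc
      simp
    · exact fun w c h hc => absurd (hs h) hc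
    · exact fun w c hc h => absurd (hs h) hc
    · exact fun u => mem_singles.2 ⟨u, rfl⟩
    · rw [h3, length_singles]
    · exact fun u => (hu u u.2).1
    · intro w c h
      obtain rfl := hs h
      rw [code_singles]
      exact (hu w w.2).2.1
    · exact fun w c hc h => absurd (hs h) hc
    · exact fun w c hc h => absurd (hs h) hc
    · intro w c h
      obtain rfl := hs h
      rw [ha 10 (by simp), code_of_not_mem]
      simp [mem_singles]
    · intro c hc w
      obtain ⟨u, rfl⟩ := mem_singles.1 hc
      rw [ha 11 (by simp), code_of_not_mem]
      simp [mem_singles]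
    · exact fun i _ => ha 11 (by simp) i
  walks := by
    rw [List.append_nil]
    refine ⟨?_, ?_, ?_, ?_, ?_, ?_, ?_, ?_, ?_⟩
    · intro b hb hk
      obtain ⟨u, rfl⟩ := mem_singles.1 hb
      rw [code_singles]
      exact (hu u u.2).2.2
    · intro b hb hk
      obtain ⟨u, rfl⟩ := mem_singles.1 hb
      simp [KW]
    · exact fun b hb hk => List.take_of_length_le hk.le
    · exact fun b hb hk => .inl ⟨rfl, ha 13 (by simp) _⟩
    · intro w c hc hk
      obtain ⟨u, hu⟩ := mem_singles.1 hc
      simp at hu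
      simp [hu.2] at hk
    · intro w c hc hk
      obtain ⟨u, hu⟩ := mem_singles.1 hc
      simp at hu
      simp [hu.2] at hk
    · intro e he hk
      obtain ⟨u, rfl⟩ := mem_singles.1 he
      simp at hk
    · exact fun e he hk => ha 13 (by simp) _
    · exact fun i _ => ha 13 (by simp) i
  mem_base := by
    intro c
    rw [mem_singles]
    constructor
    · rintro ⟨u, rfl⟩
      simp [IsCl]
    · rintro ⟨-, h1, h2⟩
      exact List.length_eq_one_iff.1 (le_antisymm h2 (List.length_pos_iff.2 h1))
  done_isCl := by simp
  done_length := by simp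
  done_before := .nil
  new_isCl := by simp
  new_length := by simp
  new_tail := by simp
  new_before := .nil
  level := h11
  pos := le_rfl

end Start

end MaxClique

/-! ### Stage 1: topological sort, 2-cliques and longest walks of the dag. -/

namespace MaxClique

open DoubleThreshold WordRAM

local infixr:60 " ;; " => Prog.seq

attribute [local simp] Expr.eval Expr.cost

section StageOne

variable {n : ℕ} {G : Digraph (Fin n)} {K W : ℕ} {Q : State → ℕ → Prop} {s : State} {τ : ℕ}

/-- Process the edge 4 that leaves the vertex 7. -/
def processEdge : Prog :=
  .setVar 9 (.get 1 (.sub (.var 4) (.const 1))) ;;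
  .setVar 10 (.get 2 (.var 9)) ;;
  create ;;
  .setArr 5 (.var 9) (.sub (.get 5 (.var 9)) (.const 1)) ;;
  .ite (.get 5 (.var 9)) .skip
    (.setArr 6 (.var 6) (.var 9) ;; .setVar 6 (.add (.var 6) (.const 1))) ;;
  .setVar 4 (.get 4 (.sub (.var 4) (.const 1)))

theorem Queue.congr {new : List (List (Fin n))} {qs : List (Fin n)} {s' : State}
    (h : Queue G new qs s) (hv : s'.var 6 = s.var 6) (h5 : s'.arr 5 = s.arr 5)
    (h6 : s'.arr 6 = s.arr 6) : Queue G new qs s' where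
  len := hv.trans h.len
  get := by rw [h6]; exact h.get
  nodup := h.nodup
  deg := by rw [h5]; exact h.deg
  mem := by rw [h5]; exact h.mem

theorem Links.le {nxt : ℕ → ℕ} {l : List ℕ} {e b : ℕ} (h : Links nxt e l) (hl : ∀ i ∈ l, i < b) :
    e ≤ b := by
  cases l with
  | nil => rw [Links] at h; omega
  | cons i l =>
    have := hl i (by simp)
    have := h.1
    omega

/-- For `k = 1` the window that follows `[u]` along the edge is `[v]` itself, so `create` stores the
2-clique and relaxes the walk of `v`. In addition the remaining in-degree of `v` drops by one, and
`v` is queued when it reaches 0. -/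
theorem wp_processEdge (hG : IsDag G) (hR : Room G K W) (hK : 1 ≤ K)
    {es : List (Fin n × Fin n)} (hm : es.length ≤ W)
    {done new : List (List (Fin n))} {wk : List (Fin n) → List (Fin n)} {u v : Fin n}
    {qs : List (Fin n)} {i : ℕ} {l : List ℕ}
    (h : Stage G 1 (singles n) (done ++ [[u]]) new wk s) (huv : G.Adj u v)
    (hnew : [v, u] ∉ new) (hq : Queue G new qs s) (h7 : s.var 7 = (u + 1) * n)
    (h8 : s.var 8 = (u + 1) * n) (h1 : s.arr 1 i = v) (h4 : Links (s.arr 4) (s.var 4) (i :: l))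
    (hl : ∀ j ∈ l, j < es.length)
    (hQ : ∀ s' τ' wk' qs', Stage G 1 (singles n) (done ++ [[u]]) (new ++ [[v, u]]) wk' s' →
      (∀ d ∈ done ++ [[u]], wk' d = wk d) → qs <+: qs' →
      Queue G (new ++ [[v, u]]) qs' s' → Links (s'.arr 4) (s'.var 4) l →
      (∀ x, x ≠ 3 → x ≠ 4 → x ≠ 6 → x ≠ 9 → x ≠ 10 → s'.var x = s.var x) →
      (∀ a ∈ [1, 3, 4, 14, 15], s'.arr a = s.arr a) → τ' ≤ τ + 90 → Q s' τ') :
    WP W processEdge Q s τ := by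
  have hcard := hR.card
  have hfresh := hR.fresh_le hK h
  have h3 := h.tree.fresh
  have h4' : s.var 4 - 1 = i := by rw [h4.1]; omega
  have hult := u.2
  have hvlt := v.2
  have h2 := h.tree.base v
  have hcode : ∀ x : Fin n, code (singles n ++ new) [x] = (x + 1) * n := fun x => by
    rw [code_append (mem_singles.2 ⟨x, rfl⟩), code_singles]
  have hle : (v + 1) * n ≤ s.var 3 := by
    rw [h3, ← hcode]; exact code_le _ _
  refine WP.seq (WP.setVar (by simp [h4', h1]; omega) ?_)
  refine WP.seq (WP.setVar (by simp [h4', h1, h2]; omega) ?_)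
  refine WP.seq (wp_create hG hR hK (h.congr (by simp) (by simp) (by simp) (by simp))
    (isCl_pair.2 huv) hnew (by simp [h7, hcode]) (by simp [h8, fst, hcode]) (by simp [h4', h1])
    (by simp [h4', h1, h2, hcode]) ?_)
  intro s₁ τ₁ wk' hS hwk hv ha hτ
  have hv9 : s₁.var 9 = v := by rw [hv 9 (by decide)]; simp [h4', h1]
  have hv6 : s₁.var 6 = s.var 6 := by rw [hv 6 (by decide)]; simp
  have hv4 : s₁.var 4 = s.var 4 := by rw [hv 4 (by decide)]; simp
  have ha5 : s₁.arr 5 = s.arr 5 := by rw [ha 5 (by simp)]; simp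
  have ha6 : s₁.arr 6 = s.arr 6 := by rw [ha 6 (by simp)]; simp
  have ha4 : s₁.arr 4 = s.arr 4 := by rw [ha 4 (by simp)]; simp
  have hmem : u ∈ {x | G.Adj x v ∧ [v, x] ∉ new} := ⟨huv, hnew⟩
  have hset : ∀ x : Fin n, {y | G.Adj y x ∧ [x, y] ∉ new ++ [[v, u]]} =
      if x = v then {y | G.Adj y v ∧ [v, y] ∉ new} \ {u} else {y | G.Adj y x ∧ [x, y] ∉ new} := by
    intro x
    split_ifs with hx
    · subst hx
      ext y
      simp [and_assoc]
    · ext y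
      simp [hx]
  have hdeg : ∀ x : Fin n, Function.update (s.arr 5) v (s.arr 5 v - 1) x =
      {y | G.Adj y x ∧ [x, y] ∉ new ++ [[v, u]]}.ncard := by
    intro x
    rw [hset]
    split_ifs with hx
    · rw [hx, Function.update_self, Set.ncard_sdiff_singleton_of_mem hmem, hq.deg]
    · rw [Function.update_of_ne (fun h => hx (Fin.ext h)), hq.deg]
  have hdpos : s.arr 5 v ≠ 0 := by
    rw [hq.deg, Ne, Set.ncard_eq_zero (Set.toFinite _)]
    exact fun he => by rw [he] at hmem; exact hmem
  have hdle : s.arr 5 v ≤ n := by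
    rw [hq.deg]
    simpa using Set.ncard_le_card {x | G.Adj x v ∧ [v, x] ∉ new}
  have hqn : qs.length ≤ n := by simpa using hq.nodup.length_le_card
  have hvq : v ∉ qs := fun h => hdpos ((hq.mem v).1 h)
  have hnext : s.arr 4 i ≤ W := (h4.2.le hl).trans hm
  refine WP.seq (WP.setArr (by simp [hv9]; omega) (by simp [hv9, ha5]; omega) ?_)
  have hmemx : ∀ x : Fin n, x ≠ v →
      (x ∈ qs ↔ Function.update (s.arr 5) v (s.arr 5 v - 1) x = 0) := fun x hx => by
    rw [Function.update_of_ne (fun h => hx (Fin.ext h)), hq.mem]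
  refine WP.seq (WP.ite (fun hne => ?_) (fun he => ?_))
  · simp only [Expr.eval, State.setArr_arr, State.setArr_var, hv9, Function.update_self, ha5] at hne
    refine WP.skip (WP.setVar (by simp [ha4, hv4, h4', hnext]) ?_)
    refine hQ _ _ wk' qs (hS.congr (by simp) (by simp) (by simp) (by simp)) hwk
      (List.prefix_refl _) ⟨by simp [hv6, hq.len], ?_, hq.nodup, ?_, ?_⟩ ?_ ?_ ?_ ?_
    · simpa [ha6] using hq.get
    · intro x; simpa [hv9, ha5] using hdeg x
    · intro x
      simp only [State.setVar_arr, State.setArr_arr, Expr.eval, hv9, ha5, Function.update_self]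
      by_cases hx : x = v
      · subst hx
        rw [Function.update_self]
        exact ⟨fun h => absurd h hvq, fun h => absurd h hne⟩
      · exact hmemx x hx
    · simpa [ha4, hv4, h4'] using h4.2
    · intro x h1 h2 h3 h4 h5
      simp [h2, h4, h5, hv x h1]
    · intro a ha'
      simp only [List.mem_cons, List.not_mem_nil, or_false] at ha'
      rcases ha' with rfl | rfl | rfl | rfl | rfl <;> simp [ha]
    · simp only [Expr.cost] at hτ ⊢
      omega
  · simp only [Expr.eval, State.setArr_arr, State.setArr_var, hv9, Function.update_self, ha5] at he
    refine WP.seq (WP.setArr (by simp [hv6, hq.len]; omega) (by simp [hv9]; omega) ?_)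
    refine WP.setVar (by simp [hv6, hq.len]; omega) ?_
    refine WP.setVar (by simp [ha4, hv4, h4', hnext]) ?_
    refine hQ _ _ wk' (qs ++ [v]) (hS.congr (by simp) (by simp) (by simp) (by simp)) hwk
      (List.prefix_append _ _) ⟨by simp [hv6, hq.len], ?_, ?_, ?_, ?_⟩ ?_ ?_ ?_ ?_
    · intro j x hj
      simp only [State.setVar_arr, State.setArr_arr, Function.update_self, Expr.eval, ne_eq,
        show (6 : ℕ) ≠ 5 by decide, not_false_eq_true, Function.update_of_ne, State.setArr_var, hv6,
        hq.len, hv9, ha6]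
      rcases lt_trichotomy j qs.length with h1 | rfl | h1
      · rw [Function.update_of_ne h1.ne]
        exact hq.get j x (by rwa [List.getElem?_append_left h1] at hj)
      · simp at hj
        simp [← hj]
      · have h2 := (List.getElem?_eq_some_iff.1 hj).1
        simp at h2
        omega
    · refine List.nodup_append.2 ⟨hq.nodup, by simp, ?_⟩
      rintro a ha b hb rfl
      rw [List.mem_singleton] at hb
      exact hvq (hb ▸ ha)
    · intro x; simpa [hv9, ha5] using hdeg x
    · intro x
      simp only [State.setVar_arr, State.setArr_arr, Expr.eval, hv9, ha5, Function.update_self, ne_eq,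
        show (5 : ℕ) ≠ 6 by decide, not_false_eq_true, Function.update_of_ne, List.mem_append,
        List.mem_singleton]
      by_cases hx : x = v
      · subst hx
        rw [Function.update_self]
        exact ⟨fun _ => he, fun _ => .inr rfl⟩
      · rw [← hmemx x hx]
        simp [hx]
    · simpa [ha4, hv4, h4'] using h4.2
    · intro x h1 h2 h3 h4 h5
      simp [h2, h3, h4, h5, hv x h1]
    · intro a ha'
      simp only [List.mem_cons, List.not_mem_nil, or_false] at ha'
      rcases ha' with rfl | rfl | rfl | rfl | rfl <;> simp [ha]
    · simp only [Expr.cost] at hτ ⊢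
      omega

/-- Process the next vertex of the queue. -/
def processVertex : Prog :=
  .setVar 17 (.get 6 (.var 5)) ;;
  .setVar 5 (.add (.var 5) (.const 1)) ;;
  .setVar 7 (.get 2 (.var 17)) ;;
  .setVar 8 (.var 7) ;;
  updateBest ;;
  .setArr 14 (.var 7) (.var 3) ;;
  .setVar 4 (.get 3 (.var 17)) ;;
  .while (.var 4) processEdge ;;
  .setArr 15 (.var 7) (.var 3)

/-- The adjacency lists in memory. -/
structure Adjacency (es : List (Fin n × Fin n)) (s : State) : Prop where
  head : ∀ i (u v : Fin n), es[i]? = some (u, v) → s.arr 1 i = v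
  links : ∀ u : Fin n, ∃ l : List ℕ, Links (s.arr 4) (s.arr 3 u) l ∧ l.Nodup ∧
    ∀ i, i ∈ l ↔ ∃ v, es[i]? = some (u, v)

/-- The time bound is amortised: each edge that leaves `u` adds one clique to `new`, so the time
minus 100 per clique grows by at most a constant. -/
theorem wp_processVertex (hG : IsDag G) (hR : Room G K W) (hK : 1 ≤ K)
    {es : List (Fin n × Fin n)} (hm : es.length ≤ W) (hes : es.Nodup)
    (hadj : ∀ u v, (u, v) ∈ es ↔ G.Adj u v)
    {us rest : List (Fin n)} {new : List (List (Fin n))} {wk : List (Fin n) → List (Fin n)}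
    {u : Fin n} (h : Stage G 1 (singles n) (us.map fun u => [u]) new wk s)
    (hq : Queue G new (us ++ u :: rest) s) (hA : Adjacency es s) (h5 : s.var 5 = us.length)
    (hcl : ∀ x ∈ us, Closed G (singles n ++ new) s [x])
    (hb : Best (singles n ++ new) (us.map fun u => [u]) wk s)
    (hQ : ∀ s' τ' wk' rest' new',
      Stage G 1 (singles n) ((us ++ [u]).map fun u => [u]) new' wk' s' →
      Queue G new' (us ++ [u] ++ rest') s' → Adjacency es s' → s'.var 5 = us.length + 1 →
      (∀ x ∈ us ++ [u], Closed G (singles n ++ new') s' [x]) →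
      Best (singles n ++ new') ((us ++ [u]).map fun u => [u]) wk' s' → s'.var 15 = s.var 15 →
      τ' + 100 * new.length ≤ τ + 50 + 100 * new'.length → Q s' τ') :
    WP W processVertex Q s τ := by
  have hcard := hR.card
  have hfresh := hR.fresh_le hK h
  have h3 := h.tree.fresh
  have hult := u.2
  have hn : 0 < n := u.pos
  have h17 : s.arr 6 us.length = u := hq.get _ _ (by simp)
  have hqn : (us ++ u :: rest).length ≤ n := by simpa using hq.nodup.length_le_card
  simp only [List.length_append, List.length_cons] at hqn
  have hus : u ∉ us := fun hu => List.disjoint_of_nodup_append hq.nodup hu (by simp)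
  have hcode : ∀ {new : List (List (Fin n))} {x : Fin n},
      code (singles n ++ new) [x] = (x + 1) * n := fun {new x} => by
    rw [code_append (mem_singles.2 ⟨x, rfl⟩), code_singles]
  have hle : (u + 1) * n ≤ s.var 3 := by
    rw [h3, ← hcode (new := new)]; exact code_le _ _
  have hbase := h.tree.base u
  have hkid : ∀ x w, [w, x] ∈ new → x ∈ us := fun x w hx => by
    simpa using h.new_tail w [x] hx
  have hpop := h.pop (c := [u]) (by simp [IsCl]) rfl (by
    intro d hd
    obtain ⟨x, hx, rfl⟩ := List.mem_map.1 hd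
    simp only [Before, fst, List.length_singleton, Nat.sub_self, List.drop_zero,
      List.mem_singleton, forall_eq]
    intro hux
    have h0 := (hq.mem x).1 (by simp [hx])
    rw [hq.deg, Set.ncard_eq_zero (Set.toFinite _)] at h0
    have : u ∉ {y | G.Adj y x ∧ [x, y] ∉ new} := by rw [h0]; simp
    exact hus (hkid u x (by_contra fun h1 => this ⟨hux, h1⟩)))
  refine WP.seq (WP.setVar (by simp [h5, h17]; omega) ?_)
  refine WP.seq (WP.setVar (by simp [h5]; omega) ?_)
  refine WP.seq (WP.setVar (by simp [h5, h17, hbase]; omega) ?_)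
  refine WP.seq (WP.setVar (by simp [h5, h17, hbase]; omega) ?_)
  refine WP.seq (wp_updateBest hG hR hK (hpop.congr (by simp) (by simp) (by simp) (by simp))
    (by simp [h5, h17, hbase, hcode]) (by simpa [Best] using hb) ?_)
  intro s₁ τ₁ ha₁ hv₁ hb₁ hτ₁
  have hv0 : s₁.var 0 = s.var 0 := by rw [hv₁ 0 (by decide) (by decide)]; simp
  have hv3 : s₁.var 3 = s.var 3 := by rw [hv₁ 3 (by decide) (by decide)]; simp
  have hv5 : s₁.var 5 = us.length + 1 := by rw [hv₁ 5 (by decide) (by decide)]; simp [h5]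
  have hv6 : s₁.var 6 = s.var 6 := by rw [hv₁ 6 (by decide) (by decide)]; simp
  have hv7 : s₁.var 7 = (u + 1) * n := by
    rw [hv₁ 7 (by decide) (by decide)]; simp [h5, h17, hbase]
  have hv8 : s₁.var 8 = (u + 1) * n := by
    rw [hv₁ 8 (by decide) (by decide)]; simp [h5, h17, hbase]
  have hv11 : s₁.var 11 = s.var 11 := by rw [hv₁ 11 (by decide) (by decide)]; simp
  have hv15 : s₁.var 15 = s.var 15 := by rw [hv₁ 15 (by decide) (by decide)]; simp
  have hv17 : s₁.var 17 = u := by rw [hv₁ 17 (by decide) (by decide)]; simp [h5, h17]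
  have ha₁' : s₁.arr = s.arr := by rw [ha₁]; simp
  obtain ⟨l, hl1, hl2, hl3⟩ := hA.links u
  have hlm : ∀ i ∈ l, i < es.length := fun i hi => by
    obtain ⟨v, hv⟩ := (hl3 i).1 hi
    exact (List.getElem?_eq_some_iff.1 hv).1
  have hhead := hl1.le hlm
  refine WP.seq (WP.setArr (by simp [hv7]; omega) (by simp [hv3]; omega) ?_)
  refine WP.seq (WP.setVar (by simp [ha₁', hv17]; omega) ?_)
  refine WP.seq (WP.while (fun r s' τ' => ∃ ld lt added wk' rest', l = ld ++ lt ∧ lt.length = r ∧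
    Stage G 1 (singles n) ((us.map fun u => [u]) ++ [[u]]) (new ++ added) wk' s' ∧
    (∀ d ∈ (us.map fun u => [u]) ++ [[u]], wk' d = wk d) ∧
    (∀ e ∈ added, ∃ v, ∃ i ∈ ld, e = [v, u] ∧ es[i]? = some (u, v)) ∧
    (∀ v, ∀ i ∈ ld, es[i]? = some (u, v) → [v, u] ∈ added) ∧
    Queue G (new ++ added) (us ++ [u] ++ rest') s' ∧ Links (s'.arr 4) (s'.var 4) lt ∧
    (∀ x, x ≠ 3 → x ≠ 4 → x ≠ 6 → x ≠ 9 → x ≠ 10 → s'.var x = s₁.var x) ∧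
    (∀ a ∈ [1, 3, 4, 15], s'.arr a = s.arr a) ∧
    s'.arr 14 = Function.update (s.arr 14) ((u + 1) * n) (s.var 3) ∧
    τ' ≤ τ₁ + 10 + 100 * added.length) ?_ ?_ l.length
    ⟨[], l, [], wk, rest, rfl, rfl, ?_, fun _ _ => rfl, by simp, by simp, ?_, ?_, ?_, ?_, ?_, ?_⟩)
  · rintro r s' τ' ⟨ld, lt, added, wk', rest', rfl, -, hS, hwk, hadd, hadd', hq', hL, hv, ha, h14,
      hτ⟩ he
    have hlt : lt = [] := by
      cases lt with
      | nil => rfl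
      | cons i lt =>
        have := hL.1
        simp only [Expr.eval] at he
        omega
    subst hlt
    rw [List.append_nil] at hl3
    have hfresh' := hR.fresh_le hK hS
    have h3' := hS.tree.fresh
    have hle' : (u + 1) * n ≤ s'.var 3 := by
      rw [h3', ← hcode (new := new ++ added)]; exact code_le _ _
    have hv' : ∀ x ∈ [5, 7, 12, 13, 15], s'.var x = s₁.var x := by
      intro x hx
      simp at hx
      exact hv x (by omega) (by omega) (by omega) (by omega) (by omega)
    refine WP.setArr (by simp [hv', hv7]; omega) (by simp; omega) ?_
    have hd : (us.map fun u => [u]) ++ [[u]] = (us ++ [u]).map fun u => [u] := by simp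
    have ha15 : s'.arr 15 = s.arr 15 := ha 15 (by simp)
    refine hQ _ _ wk' rest' (new ++ added) (hd ▸ hS.congr (by simp) (by simp) (by simp) (by simp))
      (hq'.congr (by simp) (by simp) (by simp)) ⟨?_, ?_⟩ (by simp [hv', hv5]) ?_ ?_
      (by simp [hv', hv15]) ?_
    · simpa [ha] using hA.head
    · simpa [ha] using hA.links
    · intro x hx
      rw [← List.append_assoc]
      have hxm : [x] ∈ singles n ++ new := by simp [mem_singles]
      by_cases hxu : x = u
      · subst hxu
        refine ⟨singles n ++ new, added, [], by simp, ?_, ?_, ?_, ?_⟩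
        · rw [List.append_assoc, hcode]
          simp only [State.setArr_arr, ne_eq, show (14 : ℕ) ≠ 15 by decide, not_false_eq_true,
            Function.update_of_ne, h14, Function.update_self, h3]
        · rw [List.append_assoc, hcode]
          simp only [State.setArr_arr, Function.update_self, Expr.eval, hv' 7 (by simp), hv7, h3']
          rw [← List.append_assoc, List.length_append (as := singles n ++ new)]
        · intro e he
          obtain ⟨v, -, -, h1, -⟩ := hadd e he
          exact ⟨v, h1⟩
        · intro w hw
          obtain ⟨i, hi⟩ := List.mem_iff_getElem?.1 ((hadj x w).2 (isCl_pair.1 hw))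
          exact hadd' w i ((hl3 i).2 ⟨w, hi⟩) hi
      · have hxus : x ∈ us := by simpa [hxu] using hx
        refine ((hcl x hxus).update hn hxm (y := [u]) (by simp [mem_singles]) (by simpa using hxu)
          (i := s.var 3) (j := s'.var 3) ?_ ?_).append hxm
        · simp [h14, hcode]
        · simp [ha15, hv', hv7, hcode]
    · rw [← hd]
      refine ⟨fun e he => ?_, .inr ?_⟩
      · rw [hwk e he]
        simpa [hv'] using hb₁.1 e he
      · rcases hb₁.2 with ⟨h1, -⟩ | ⟨b, hb, h1, h2⟩
        · simp at h1
        · refine ⟨b, hb, ?_, ?_⟩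
          · have hbs : b ∈ singles n := by
              rw [hd] at hb
              obtain ⟨x, -, rfl⟩ := List.mem_map.1 hb
              simp [mem_singles]
            rw [code_append hbs]
            rw [code_append hbs] at h1
            simpa [hv'] using h1
          · rw [hwk b hb, ← h2]
            simp [hv']
    · simp only [Expr.cost, List.length_append] at hτ₁ ⊢
      omega
  · rintro r s' τ' ⟨ld, lt, added, wk', rest', rfl, hr, hS, hwk, hadd, hadd', hq', hL, hv, ha, h14,
      hτ⟩ he
    obtain ⟨i, lt, rfl⟩ : ∃ i lt', lt = i :: lt' := by
      cases lt with
      | nil => exact absurd hL he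
      | cons i lt => exact ⟨i, lt, rfl⟩
    obtain ⟨v, hi⟩ := (hl3 i).1 (by simp)
    have huv : G.Adj u v := (hadj u v).1 (List.mem_of_getElem? hi)
    have hild : i ∉ ld := fun h1 => List.disjoint_of_nodup_append hl2 h1 (by simp)
    refine wp_processEdge hG hR hK hm hS huv ?_ hq'
      (by rw [hv 7 (by decide) (by decide) (by decide) (by decide) (by decide), hv7])
      (by rw [hv 8 (by decide) (by decide) (by decide) (by decide) (by decide), hv8])
      (by rw [ha 1 (by simp)]; exact hA.head i u v hi) hL (fun j hj => hlm j (by simp [hj])) ?_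
    · rw [List.mem_append, not_or]
      refine ⟨fun h1 => hus (hkid u v h1), fun h1 => ?_⟩
      obtain ⟨v', j, hj, h2, h3⟩ := hadd _ h1
      cases h2
      obtain ⟨h4, h5⟩ := List.getElem?_eq_some_iff.1 h3
      obtain ⟨h6, h7⟩ := List.getElem?_eq_some_iff.1 hi
      rw [(hes.getElem_inj_iff).1 (h5.trans h7.symm)] at hj
      exact hild hj
    · intro s'' τ'' wk'' qs' hS' hwk' hpre hq'' hL' hv' ha' hτ'
      obtain ⟨r', rfl⟩ := hpre
      refine ⟨lt.length, by simp at hr; omega, ld ++ [i], lt, added ++ [[v, u]], wk'',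
        rest' ++ r', by simp, rfl, by rwa [← List.append_assoc],
        fun d hd => (hwk' d hd).trans (hwk d hd), ?_, ?_, ?_, hL', ?_, ?_, ?_, ?_⟩
      · intro e he
        rcases List.mem_append.1 he with h1 | h1
        · obtain ⟨v', j, hj, h2⟩ := hadd e h1
          exact ⟨v', j, by simp [hj], h2⟩
        · exact ⟨v, i, by simp, List.mem_singleton.1 h1, hi⟩
      · intro v' j hj hj'
        rcases List.mem_append.1 hj with h1 | h1
        · exact List.mem_append_left _ (hadd' v' j h1 hj')
        · rw [List.mem_singleton] at h1
          subst h1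
          rw [hi] at hj'
          cases hj'
          simp
      · rw [← List.append_assoc, ← List.append_assoc]
        exact hq''
      · exact fun x h1 h2 h3 h4 h5 => (hv' x h1 h2 h3 h4 h5).trans (hv x h1 h2 h3 h4 h5)
      · intro a h1
        rw [ha' a (by simp at h1 ⊢; omega), ha a h1]
      · rw [ha' 14 (by simp), h14]
      · simp only [Expr.cost, List.length_append, List.length_singleton] at hτ' ⊢
        omega
  · rw [List.append_nil]
    exact hpop.congr (by simp [hv0]) (by simp [hv3]) (by simp [hv11]) (by simp [ha₁'])
  · rw [List.append_nil, List.append_assoc]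
    exact hq.congr (by simp [hv6]) (by simp [ha₁']) (by simp [ha₁'])
  · simpa [ha₁', hv17] using hl1
  · intro x h1 h2 h3 h4 h5
    simp [h2]
  · simp [ha₁']
  · simp [ha₁', hv7, hv3]
  · simp

/-- Process the vertices in topological order. -/
def firstStage : Prog := .while (.sub (.var 6) (.var 5)) processVertex

theorem wp_firstStage (hG : IsDag G) (hR : Room G K W) (hK : 1 ≤ K)
    {es : List (Fin n × Fin n)} (hm : es.length ≤ W) (hes : es.Nodup)
    (hadj : ∀ u v, (u, v) ∈ es ↔ G.Adj u v) {qs : List (Fin n)}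
    (h : Stage G 1 (singles n) [] [] id s)
    (hq : Queue G [] qs s) (hA : Adjacency es s) (h5 : s.var 5 = 0)
    (h12 : s.var 12 = 0) (h15 : s.var 15 = (n + 1) * n)
    (hQ : ∀ s' τ' wk' done new, Finished G 1 (singles n) done new wk' s' →
      τ' ≤ τ + 10 + 60 * n + 100 * numEdges G → Q s' τ') :
    WP W firstStage Q s τ := by
  refine WP.while (fun r s' τ' => ∃ us rest new wk', r + us.length = n ∧
    Stage G 1 (singles n) (us.map fun u => [u]) new wk' s' ∧
    Queue G new (us ++ rest) s' ∧ Adjacency es s' ∧ s'.var 5 = us.length ∧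
    (∀ x ∈ us, Closed G (singles n ++ new) s' [x]) ∧
    Best (singles n ++ new) (us.map fun u => [u]) wk' s' ∧ s'.var 15 = (n + 1) * n ∧
    τ' ≤ τ + 60 * us.length + 100 * new.length) ?_ ?_ n
    ⟨[], qs, [], id, by simp, by simpa using h, by simpa using hq, hA, by simpa using h5, by simp,
      ⟨by simp, .inl ⟨rfl, h12⟩⟩, h15, by simp⟩
  · rintro r s' τ' ⟨us, rest, new, wk', hr, hS, hq, hA, h5, hcl, hb, h15, hτ⟩ he
    have hrest : rest = [] := by
      have := hq.len
      simp only [Expr.eval, this, h5, List.length_append] at he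
      exact List.length_eq_zero_iff.1 (by omega)
    subst hrest
    rw [List.append_nil] at hq
    -- When the queue is exhausted every vertex has been processed, by induction on the rank: the
    -- predecessors have been, so all edges into `v` are treated and `v` has been queued.
    have hall : ∀ N, ∀ v, rk G v < N → v ∈ us := by
      intro N
      induction N with
      | zero => intro v hv; omega
      | succ N ih =>
        intro v hv
        rw [hq.mem, hq.deg, Set.ncard_eq_zero (Set.toFinite _), Set.eq_empty_iff_forall_notMem]
        rintro u ⟨huv, hu⟩
        have hus := ih u (by have := rk_lt hG huv; omega)
        obtain ⟨l₁, ch, l₂, he, -, -, -, h3⟩ := hcl u hus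
        have h4 : [v, u] ∈ singles n ++ new := by
          rw [he]; simp [h3 v (isCl_pair.2 huv)]
        rcases List.mem_append.1 h4 with h4 | h4
        · simp [mem_singles] at h4
        · exact hu h4
    refine hQ _ _ wk' _ new ⟨hS, ?_, ?_, by rw [h15, length_singles], hb⟩ ?_
    · intro c _ hc
      obtain ⟨u, rfl⟩ := List.length_eq_one_iff.1 hc
      exact List.mem_map.2 ⟨u, hall _ u (Nat.lt_succ_self _), rfl⟩
    · intro x hx
      obtain ⟨u, rfl⟩ := mem_singles.1 hx
      exact hcl u (hall _ u (Nat.lt_succ_self _))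
    · have hnew : new.length ≤ numEdges G := by
        classical
        have hnd : new.Nodup := hS.tree.nodup.sublist (List.sublist_append_right _ _)
        rw [← List.toFinset_card_of_nodup hnd, ← card_cliq_two]
        refine Finset.card_le_card fun c hc => ?_
        rw [List.mem_toFinset] at hc
        exact mem_cliq.2 ⟨hS.new_length c hc, hS.new_isCl c hc⟩
      simp only [Expr.cost]
      omega
  · rintro r s' τ' ⟨us, rest, new, wk', hr, hS, hq, hA, h5, hcl, hb, h15, hτ⟩ he
    obtain ⟨u, rest, rfl⟩ := List.exists_cons_of_ne_nil (l := rest) (by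
      rintro rfl
      have := hq.len
      simp [this, h5] at he)
    have hqn : (us ++ u :: rest).length ≤ n := by simpa using hq.nodup.length_le_card
    simp only [List.length_append, List.length_cons] at hqn
    refine wp_processVertex hG hR hK hm hes hadj hS hq hA h5 hcl hb ?_
    intro s'' τ'' wk'' rest' new' hS' hq' hA' h5' hcl' hb' h15' hτ'
    refine ⟨r - 1, by omega, us ++ [u], rest', new', wk'', by simp; omega, hS', hq', hA',
      by simp [h5'], hcl', hb', h15'.trans h15, ?_⟩
    simp only [Expr.cost, List.length_append, List.length_singleton] at hτ' ⊢
    omega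

end StageOne

end MaxClique

/-! ### The whole algorithm and its bounds. -/

namespace MaxClique

open DoubleThreshold WordRAM

local infixr:60 " ;; " => Prog.seq

attribute [local simp] Expr.eval Expr.cost

section Main

variable {n : ℕ} {G : Digraph (Fin n)} {K W : ℕ} {Q : State → ℕ → Prop} {s : State} {τ : ℕ}

theorem Finished.congr {k : ℕ} {base done new : List (List (Fin n))}
    {wk : List (Fin n) → List (Fin n)} {s' : State} (h : Finished G k base done new wk s)
    (ha : ∀ a, a ≠ 0 → s'.arr a = s.arr a)
    (hv : ∀ x ∈ [0, 3, 11, 12, 13, 15], s'.var x = s.var x) :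
    Finished G k base done new wk s' where
  stage := h.stage.congr (hv 0 (by simp)) (hv 3 (by simp)) (hv 11 (by simp))
    fun a h => ha a (by rintro rfl; simp at h)
  all := h.all
  closed x hx := (h.closed x hx).congr (ha 14 (by decide)) (ha 15 (by decide))
  level_start := (hv 15 (by simp)).trans h.level_start
  best := by
    rw [Best, hv 12 (by simp), hv 13 (by simp)]
    exact h.best

/-- The clique in the memory is a maximum clique. -/
def Solved (G : Digraph (Fin n)) (s : State) : Prop :=
  ∃ q, IsCl G q ∧ (∀ p, IsCl G p → p.length ≤ q.length) ∧ Holds q s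

/-- The recorded walk is at least as long as every clique, so if it is a clique it is a maximum one.
Otherwise `k < K`, because `K`-walks are cliques, and a further stage follows; the `(k + 1)`-clique
guarantees that this stage again has a walk to record. -/
theorem wp_output (hG : IsDag G) (hR : Room G K W) (hK : ∀ q, KW G K q → IsCl G q)
    {k : ℕ} (hk : k ≤ K) {base done new : List (List (Fin n))}
    {wk : List (Fin n) → List (Fin n)} (h : Finished G k base done new wk s)
    (hne : ∃ c, IsCl G c ∧ c.length = k)
    (hQ : ∀ s' τ', (s'.var 22 = 1 ∧ Solved G s' ∨ s'.var 22 = 0 ∧ k < K ∧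
      Finished G k base done new wk s' ∧ ∃ c, IsCl G c ∧ c.length = k + 1) →
      τ' ≤ τ + 250 * (n + numEdges G + 1) → Q s' τ') :
    WP W (extract ;; check) Q s τ := by
  have hS := h.stage
  obtain ⟨c₀, hc₀, hc₀k⟩ := hne
  obtain ⟨b, hb, h13, h12⟩ : ∃ b ∈ done, s.var 13 = code (base ++ new) b ∧
      s.var 12 = (wk b).length := by
    rcases h.best.2 with ⟨h1, -⟩ | h1
    · have := h.all c₀ hc₀ hc₀k
      rw [h1] at this
      simp at this
    · exact h1
  have hbk := hS.done_length b hb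
  have hbm : b ∈ base ++ new := List.mem_append_left _ (hS.done_mem hb)
  have hwalk := hS.walks.walk b hbm hbk
  have hkb : k ≤ (wk b).length := by
    have := congrArg List.length (hS.walks.window b hbm hbk)
    rw [List.length_take] at this
    omega
  have hmax : ∀ p, IsCl G p → p.length ≤ (wk b).length := by
    intro p hp
    rcases Nat.lt_or_ge p.length k with hlt | hge
    · omega
    · have h1 := hp.length_le_of_step hS.pos (f := fun c => (wk c).length) ?_ ?_ hge
      · refine h1.trans ?_
        rw [← h12]
        exact h.best.1 _ (h.all _ (hp.sublist (List.take_sublist _ _)) (by simp [hge]))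
      · intro c hc hck
        have hcm := List.mem_append_left new (hS.done_mem (h.all c hc hck))
        have := congrArg List.length (hS.walks.window c hcm hck)
        rw [List.length_take] at this
        omega
      · intro w c hwc hck
        exact hS.walks.step w c (List.mem_append_right _ (h.mem_new.2 ⟨hwc, by simp [hck]⟩)) hck
  refine WP.seq (wp_extract hG hR hk hS hbm hbk h13 ?_)
  intro s₁ τ₁ ha₁ hv₁ hH hτ₁
  have hF₁ : Finished G k base done new wk s₁ := h.congr ha₁ fun x hx => by
    simp at hx; exact hv₁ x (by omega) (by omega)
  have hpair : ∀ u v, G.Adj u v → [v, u] ∈ base ++ new := by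
    intro u v huv
    exact h.mem_iff.2 ⟨isCl_pair.2 huv, by simp, by have := hS.pos; simp; omega⟩
  refine wp_check hG hR hF₁.stage.tree hpair hH (by simpa using hwalk.length_le hG hS.pos) ?_
  intro s₂ τ₂ ha₂ hv₂ hres hτ₂
  refine hQ _ _ ?_ (by omega)
  rcases hres with ⟨hcl, h22⟩ | ⟨hncl, h22⟩
  · refine .inl ⟨h22, wk b, hcl, hmax, ?_, ?_⟩
    · rw [hv₂ 20 (by decide) (by decide) (by decide), hH.1]
    · rw [ha₂, hH.2]
  · refine .inr ⟨h22, ?_, hF₁.congr (fun a _ => by rw [ha₂]) fun x hx => by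
      simp at hx; exact hv₂ x (by omega) (by omega) (by omega), ?_⟩
    · refine lt_of_le_of_ne hk ?_
      rintro rfl
      exact hncl (hK _ hwalk)
    -- A `k`-walk with at most `k + 1` vertices is a clique, so this walk is longer and its last `k
    -- + 1` vertices form the required clique.
    · refine ⟨(wk b).take (k + 1), (hwalk.take _).isCl (List.length_take_le _ _), ?_⟩
      rw [List.length_take, min_eq_left]
      by_contra hlt
      exact hncl (hwalk.isCl (by omega))

/-- The algorithm. -/
def maxCliqueProg : Prog :=
  initVertices ;;
  .setVar 11 (.const 1) ;;
  .setVar 15 (.var 3) ;;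
  initEdges ;;
  initQueue ;;
  firstStage ;;
  (extract ;; check) ;;
  .while (.sub (.const 1) (.var 22)) (nextStage ;; extract ;; check) ;;
  .setVar 0 (.var 20)

/-- A bound for the time of stage `k`. -/
noncomputable def stageTime (G : Digraph (Fin n)) (k : ℕ) : ℕ :=
  300 * (stageCost G k + 1) + 250 * (n + numEdges G + 1) + 10

theorem wp_maxCliqueProg (hG : IsDag G) (hR : Room G K W) (hK1 : 1 ≤ K)
    (hW : (n + 2) * n + n + 1 ≤ W)
    (hK : ∀ q, KW G K q → IsCl G q) (hn : 0 < n)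
    {es : List (Fin n × Fin n)} (hes : es.Nodup) (hadj : ∀ u v, (u, v) ∈ es ↔ G.Adj u v) :
    WP W maxCliqueProg (fun s t => (∃ q, IsCl G q ∧ (∀ p, IsCl G p → p.length ≤ q.length) ∧
      Holds q s ∧ s.var 0 = q.length) ∧
      t ≤ 1000 * (n + numEdges G + 1) + ∑ k ∈ Finset.Icc 2 K, stageTime G k)
      (edgeListInput n es) 0 := by
  have hm := numEdges_eq hes hadj
  have hmW := hR.edges
  have hcard := hR.card
  have hnn : (n + 1) * n ≤ W := by
    have : (n + 1) * n ≤ (n + 2) * n := Nat.mul_le_mul_right _ (by omega)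
    omega
  refine WP.seq (wp_initVertices hW (by simp [edgeListInput]) ?_)
  intro s₁ τ₁ hv₁ h3₁ ha₁ hu₁ hτ₁
  refine WP.seq (WP.setVar (by simp; omega) ?_)
  refine WP.seq (WP.setVar (by simp [h3₁]; omega) ?_)
  have hzero : ∀ a, a ≠ 0 → a ≠ 1 → a ≠ 2 → a ≠ 7 → a ≠ 12 → ∀ i, s₁.arr a i = 0 := by
    intro a h1 h2 h3 h4 h5 i
    rw [ha₁ a h3 h4 h5]
    simp [edgeListInput, h1, h2]
  have hvzero : ∀ x, x ≠ 0 → x ≠ 1 → x ≠ 2 → x ≠ 3 → s₁.var x = 0 := by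
    intro x h1 h2 h3 h4
    rw [hv₁ x h3 h4]
    simp [edgeListInput, h1, h2]
  have hinput : ∀ i (u v : Fin n), es[i]? = some (u, v) → s₁.arr 0 i = u ∧ s₁.arr 1 i = v := by
    intro i u v h
    rw [ha₁ 0 (by decide) (by decide) (by decide), ha₁ 1 (by decide) (by decide) (by decide)]
    simp [edgeListInput, List.getD_eq_getElem?_getD, h]
  refine WP.seq (wp_initEdges hes (by omega) (by omega) ?_ ?_ ?_ ?_ ?_)
  · simp [hv₁ 1, edgeListInput]
  · simpa using hinput
  · simpa using hzero 3 (by decide) (by decide) (by decide) (by decide) (by decide)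
  · simpa using hzero 5 (by decide) (by decide) (by decide) (by decide) (by decide)
  intro s₂ τ₂ hv₂ ha₂ hl₂ hd₂ hτ₂
  refine WP.seq (wp_initQueue (G := G) (by omega) ?_ ?_ ?_ ?_)
  · rw [hv₂ 0 (by decide)]; simp [hv₁ 0, edgeListInput]
  · rw [hv₂ 6 (by decide)]; simp [hvzero 6]
  · intro v
    rw [hd₂]
    congr 1
    ext u
    simp [hadj]
  intro s₃ τ₃ qs hv₃ ha₃ hq₃ hτ₃
  have hvar : ∀ x, x ≠ 2 → x ≠ 4 → x ≠ 6 → x ≠ 11 → x ≠ 15 → s₃.var x = s₁.var x := by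
    intro x h1 h2 h3 h4 h5
    rw [hv₃ x h1 h3, hv₂ x h2]
    simp [h4, h5]
  have harr : ∀ a, a ≠ 3 → a ≠ 4 → a ≠ 5 → a ≠ 6 → s₃.arr a = s₁.arr a := by
    intro a h1 h2 h3 h4
    rw [ha₃ a h4, ha₂ a h1 h2 h3]
    simp
  have hS : Stage G 1 (singles n) [] [] id s₃ := by
    refine stage_one ?_ ?_ ?_ ?_ ?_
    · rw [hvar 0 (by decide) (by decide) (by decide) (by decide) (by decide),
        hv₁ 0 (by decide) (by decide)]
      simp [edgeListInput]
    · rw [hvar 3 (by decide) (by decide) (by decide) (by decide) (by decide), h3₁]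
    · rw [hv₃ 11 (by decide) (by decide), hv₂ 11 (by decide)]
      simp
    · rw [harr 2 (by decide) (by decide) (by decide) (by decide),
        harr 7 (by decide) (by decide) (by decide) (by decide),
        harr 12 (by decide) (by decide) (by decide) (by decide)]
      exact hu₁
    · intro a ha i
      rw [harr a (by omega) (by omega) (by omega) (by omega)]
      exact hzero a (by omega) (by omega) (by omega) (by omega) (by omega) i
  refine WP.seq (wp_firstStage hG hR hK1 (by omega) hes hadj hS hq₃ ⟨?_, ?_⟩ ?_ ?_ ?_ ?_)
  · intro i u v h
    rw [harr 1 (by decide) (by decide) (by decide) (by decide)]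
    exact (hinput i u v h).2
  · rw [ha₃ 4 (by decide), ha₃ 3 (by decide)]
    exact hl₂
  · rw [hvar 5 (by decide) (by decide) (by decide) (by decide) (by decide)]
    exact hvzero 5 (by decide) (by decide) (by decide) (by decide)
  · rw [hvar 12 (by decide) (by decide) (by decide) (by decide) (by decide)]
    exact hvzero 12 (by decide) (by decide) (by decide) (by decide)
  · rw [hv₃ 15 (by decide) (by decide), hv₂ 15 (by decide)]
    simp [h3₁]
  intro s₄ τ₄ wk done new hF₄ hτ₄
  refine WP.seq (wp_output hG hR hK hK1 hF₄ ⟨[⟨0, hn⟩], by simp [IsCl], rfl⟩ ?_)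
  intro s₅ τ₅ hres hτ₅
  have hτ5 : τ₅ ≤ 900 * (n + numEdges G + 1) := by
    simp only [Expr.cost] at hτ₂
    linarith
  -- Register 22 tells whether the output is final. Otherwise stage `k < K` has just ended, and `r =
  -- K + 1 - k` decreases. `K` occurs only in this analysis, not in the program.
  let I : ℕ → State → ℕ → Prop := fun r s τ =>
    s.var 22 = 1 ∧ Solved G s ∧
      τ ≤ 900 * (n + numEdges G + 1) + ∑ k ∈ Finset.Icc 2 K, stageTime G k ∨
    s.var 22 = 0 ∧ ∃ k base done new wk, k < K ∧ r + k = K + 1 ∧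
      Finished G k base done new wk s ∧ (∃ c, IsCl G c ∧ c.length = k + 1) ∧
      τ ≤ 900 * (n + numEdges G + 1) + ∑ k ∈ Finset.Icc 2 k, stageTime G k
  refine WP.seq (WP.while I ?_ ?_ K ?_)
  · rintro r s τ (⟨h22, ⟨q, hq, hqmax, hH⟩, hτ⟩ | ⟨h22, -⟩) he
    · have h20 := hH.1
      have hle : q.length ≤ n := by simpa using (hq.nodup hG).length_le_card
      refine WP.setVar (by simp [h20]; omega) ⟨⟨q, hq, hqmax, ⟨by simp [h20], ?_⟩, by simp [h20]⟩, ?_⟩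
      · simpa using hH.2
      · simp only [Expr.cost]; omega
    · simp [h22] at he
  · rintro r s τ (⟨h22, -⟩ | ⟨h22, k, base, done, new, wk, hk, hr, hF, hne, hτ⟩) he
    · simp [h22] at he
    refine WP.seq (wp_nextStage hG hR hk hF ?_)
    intro s' τ' wk' done' new' hF' hτ'
    refine wp_output hG hR hK hk hF' hne ?_
    intro s'' τ'' hres hτ''
    have hk1 := hF.stage.pos
    have hsum : ∑ j ∈ Finset.Icc 2 (k + 1), stageTime G j =
        ∑ j ∈ Finset.Icc 2 k, stageTime G j + stageTime G (k + 1) :=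
      Finset.sum_Icc_succ_top (by omega) _
    have hle : ∑ j ∈ Finset.Icc 2 (k + 1), stageTime G j ≤ ∑ j ∈ Finset.Icc 2 K, stageTime G j :=
      Finset.sum_le_sum_of_subset (Finset.Icc_subset_Icc_right hk)
    have hst : stageTime G (k + 1) =
      300 * (stageCost G (k + 1) + 1) + 250 * (n + numEdges G + 1) + 10 := rfl
    simp only [Expr.cost] at hτ'
    refine ⟨r - 1, by omega, ?_⟩
    rcases hres with ⟨h1, h2⟩ | ⟨h1, h2, h3, h4⟩
    · exact .inl ⟨h1, h2, by omega⟩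
    · exact .inr ⟨h1, k + 1, _, _, _, _, h2, by omega, h3, h4, by omega⟩
  · rcases hres with ⟨h1, h2⟩ | ⟨h1, h2, h3, h4⟩
    · exact .inl ⟨h1, h2, by omega⟩
    · exact .inr ⟨h1, 1, _, _, _, _, h2, rfl, h3, h4, by simpa using hτ5⟩

/-- The number of cliques with at most `K + 1` vertices. -/
noncomputable def numCliques (G : Digraph (Fin n)) (K : ℕ) : ℕ :=
  ∑ k ∈ Finset.range (K + 2), (cliq G k).card

theorem room_of_le (hW : (numCliques G K + 2) * n + (n + 2) * n + n + numEdges G + K + 2 ≤ W) :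
    Room G K W := by
  classical
  have h0 : ∀ a b c d e f : ℕ, a + b + c + d + e + f ≤ W → 2 ≤ f → a ≤ W ∧ c + 1 ≤ W ∧
      d + 1 ≤ W ∧ e + 2 ≤ W := by
    intros; omega
  obtain ⟨h1, h2, h3, h4⟩ := h0 _ _ _ _ _ _ hW le_rfl
  refine ⟨fun l hl hc => le_trans (Nat.mul_le_mul_right _ ?_) h1, h2, h3, h4⟩
  refine Nat.add_le_add_right ?_ 2
  rw [← List.toFinset_card_of_nodup hl]
  refine le_trans (Finset.card_le_card ?_) (Finset.card_biUnion_le (s := Finset.range (K + 2))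
    (t := fun k => cliq G k))
  intro c hcl
  rw [List.mem_toFinset] at hcl
  obtain ⟨h5, h6⟩ := hc c hcl
  exact Finset.mem_biUnion.2 ⟨c.length, by simp; omega, by simp [h5]⟩

/-- The induction needs `4 + s ≤ 4 s`, that is `s ≥ 4 / 3`; for `s = √m` this holds because `m ≥ 2`.
The constant 8 in `numCliques_le` comes from the same inequality, doubled. -/
theorem sum_pow_le {s : ℝ} (hs : 4 / 3 ≤ s) (K : ℕ) :
    ∑ k ∈ Finset.Icc 2 K, s ^ (k + 1) ≤ 4 * s ^ (K + 1) := by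
  have hpos : 0 < s := by linarith
  induction K with
  | zero => simp; positivity
  | succ K ih =>
    rcases Nat.eq_zero_or_pos K with rfl | hK
    · simp; positivity
    · rw [Finset.sum_Icc_succ_top (by omega)]
      have h1 : 0 < s ^ (K + 1) := by positivity
      have h2 : s ^ (K + 1 + 1) = s * s ^ (K + 1) := by ring
      rw [h2]
      nlinarith

theorem numCliques_le {s : ℝ} (hs : 4 / 3 ≤ s) (hm : s ^ 2 = numEdges G) (K : ℕ) :
    (numCliques G K : ℝ) ≤ 1 + n + 8 * s ^ (K + 1) := by
  have h0 : (cliq G 0).card ≤ 1 := by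
    refine Finset.card_le_one.2 fun a ha b hb => ?_
    rw [mem_cliq] at ha hb
    rw [List.length_eq_zero_iff.1 ha.1, List.length_eq_zero_iff.1 hb.1]
  have h1 : (cliq G 1).card ≤ n := by
    classical
    have : cliq G 1 ⊆ (singles n).toFinset := by
      intro c hc
      rw [mem_cliq] at hc
      rw [List.mem_toFinset, mem_singles]
      exact List.length_eq_one_iff.1 hc.1
    exact (Finset.card_le_card this).trans ((List.toFinset_card_le _).trans length_singles.le)
  have h2 : ∀ K, (numCliques G K : ℝ) ≤ 1 + n + 8 * s ^ (K + 1) := by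
    intro K
    induction K with
    | zero =>
      have : numCliques G 0 = (cliq G 0).card + (cliq G 1).card := by
        simp [numCliques, Finset.sum_range_succ]
      have h3 : (numCliques G 0 : ℝ) ≤ 1 + n := by
        rw [this]; push_cast
        exact add_le_add (by exact_mod_cast h0) (by exact_mod_cast h1)
      have : 0 ≤ s ^ (0 + 1) := by positivity
      linarith
    | succ K ih =>
      have h3 : numCliques G (K + 1) = numCliques G K + (cliq G (K + 2)).card := by
        rw [numCliques, Finset.sum_range_succ, numCliques]
      have h4 := card_cliq_le (by linarith) hm (K + 2) (by omega)
      have h5 : s ^ (K + 2) = s * s ^ (K + 1) := by ring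
      have h6 : 0 < s ^ (K + 1) := by positivity
      rw [h3]
      push_cast
      rw [show K + 1 + 1 = K + 2 by ring]
      rw [h5] at h4 ⊢
      nlinarith
  exact h2 K

end Main

end MaxClique

/-! ### The theorem. -/

open MaxClique in
theorem mainTheorem7 :
    ∃ (P : WordRAM.Prog) (C : ℝ) (d : ℕ), 0 < C ∧
      ∀ (n : ℕ) (G : Digraph (Fin n)),
        DoubleThreshold.IsDag G →
        G.toSimpleGraphInclusive.Connected →
        ¬ DoubleThreshold.IsDegenerate G →
        ∀ es : List (Fin n × Fin n), es.Nodup → (∀ u v, (u, v) ∈ es ↔ G.Adj u v) →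
          ∃ (W t : ℕ) (s : WordRAM.State) (K : Finset (Fin n)),
            WordRAM.Exec W P (WordRAM.edgeListInput n es) t s ∧
            WordRAM.OutputsSet s K ∧
            G.toSimpleGraphInclusive.IsMaximumClique K ∧
            (t : ℝ) ≤ C * (DoubleThreshold.lam G *
              (DoubleThreshold.numEdges G : ℝ) ^
                ((⌊DoubleThreshold.lam G + 1⌋ : ℝ) / 2)) ∧
            (W : ℝ) ≤ C * (DoubleThreshold.lam G *
              (DoubleThreshold.numEdges G : ℝ) ^
                ((⌊DoubleThreshold.lam G + 1⌋ : ℝ) / 2)) ^ d := by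
  -- The exponent 2 arises because addresses go up to `n` times the number of stored cliques, and
  -- both factors are bounded by a multiple of the time bound.
  refine ⟨maxCliqueProg, 20000, 2, by norm_num, ?_⟩
  intro n G hG hconn hdeg es hes hadj
  have hlam := one_le_lam hG hdeg
  have hm2 := two_le_numEdges hG hconn hdeg
  have hnm := card_le_numEdges hconn
  rw [Fintype.card_fin] at hnm
  have hn : 0 < n := by
    obtain ⟨v⟩ := hconn.nonempty
    exact v.pos
  set K := ⌊DoubleThreshold.lam G⌋₊ with hKdef
  have hK1 : 1 ≤ K := (Nat.one_le_floor_iff _).2 hlam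
  have hKW : ∀ q, KW G K q → IsCl G q := by
    obtain ⟨α, t₁, t₂, ht, hα, hlt⟩ := exists_satisfying hG hdeg
    exact fun q hq => hq.isCl_of_satisfying hK1 ht hα hlt
  obtain ⟨W, hW⟩ : ∃ W, W = (numCliques G K + 2) * n + (n + 2) * n + n +
    DoubleThreshold.numEdges G + K + 2 := ⟨_, rfl⟩
  have hR : Room G K W := room_of_le hW.ge
  obtain ⟨t, s, hexec, ⟨q, hq, hqmax, hH, hv0⟩, ht⟩ :=
    wp_maxCliqueProg hG hR hK1 (by rw [hW]; omega) hKW hn hes hadj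
  rw [Nat.zero_add] at ht
  refine ⟨W, t, s, q.toFinset, hexec, ⟨?_, q, hq.nodup hG, rfl, ?_⟩, ⟨hq.isClique, ?_⟩, ?_⟩
  · rw [hv0, List.toFinset_card_of_nodup (hq.nodup hG)]
  · rw [hv0, hH.2]
    simp [List.map_eq_flatMap]
  · intro c hc
    obtain ⟨p, hp, hpc⟩ := exists_isCl_of_isClique hG hc
    rw [← hpc, List.toFinset_card_of_nodup (hq.nodup hG)]
    exact hqmax p hp
  set m := DoubleThreshold.numEdges G with hmdef
  set l := DoubleThreshold.lam G with hldef
  obtain ⟨r, hr⟩ : ∃ r : ℝ, r = Real.sqrt m := ⟨_, rfl⟩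
  have hr0 : 0 ≤ r := hr ▸ Real.sqrt_nonneg _
  have hrm : r ^ 2 = m := by rw [hr, Real.sq_sqrt (Nat.cast_nonneg _)]
  have hm2' : (2 : ℝ) ≤ m := by exact_mod_cast hm2
  have hr43 : 4 / 3 ≤ r := by nlinarith
  have hexp : (m : ℝ) ^ ((⌊l + 1⌋ : ℝ) / 2) = r ^ (K + 1) := by
    have h1 : (⌊l + 1⌋ : ℝ) = (K + 1 : ℕ) := by
      rw [Int.floor_add_one, hKdef, ← Int.natCast_floor_eq_floor (by linarith : (0 : ℝ) ≤ l)]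
      push_cast
      rfl
    rw [h1, ← hrm, ← Real.rpow_natCast r 2, ← Real.rpow_mul hr0]
    rw [show ((2 : ℕ) : ℝ) * (((K + 1 : ℕ) : ℝ) / 2) = ((K + 1 : ℕ) : ℝ) by push_cast; ring,
      Real.rpow_natCast]
  rw [hexp]
  have hT1 : r ^ 2 ≤ r ^ (K + 1) := pow_le_pow_right₀ (by linarith) (by omega)
  obtain ⟨T, hT⟩ : ∃ T, T = r ^ (K + 1) := ⟨_, rfl⟩
  rw [← hT] at hT1 ⊢
  have hmT : (m : ℝ) ≤ T := hrm ▸ hT1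
  have hT2 : 2 ≤ T := hm2'.trans hmT
  -- The number of steps is in fact bounded by a multiple of `T`; the factor `λ ≥ 1` is only added
  -- here.
  have hTl : T ≤ l * T := by nlinarith
  have hnm' : (n : ℝ) ≤ m + 1 := by exact_mod_cast hnm
  constructor
  · have hstage : ∀ k ∈ Finset.Icc 2 K, (stageTime G k : ℝ) ≤ 2500 * r ^ (k + 1) := by
      intro k hk
      have h2k := (Finset.mem_Icc.1 hk).1
      have h1 := stageCost_le (by linarith) hrm k h2k
      have h2 : r ^ 2 ≤ r ^ (k + 1) := pow_le_pow_right₀ (by linarith) (by omega)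
      rw [stageTime]
      push_cast
      rw [hrm] at h2
      linarith
    have hsum : ((∑ k ∈ Finset.Icc 2 K, stageTime G k : ℕ) : ℝ) ≤ 2500 * (4 * T) := by
      rw [Nat.cast_sum]
      refine (Finset.sum_le_sum hstage).trans ?_
      rw [← Finset.mul_sum, hT]
      exact mul_le_mul_of_nonneg_left (sum_pow_le hr43 K) (by norm_num)
    have ht' : (t : ℝ) ≤ 1000 * (n + m + 1) + ((∑ k ∈ Finset.Icc 2 K, stageTime G k : ℕ) : ℝ) := by
      exact_mod_cast ht
    linarith
  · have hN := numCliques_le hr43 hrm K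
    rw [← hT] at hN
    have hKl : (K : ℝ) ≤ l := Nat.floor_le (by linarith)
    have hlT : l ≤ l * T := by nlinarith
    rw [hW]
    push_cast
    obtain ⟨X, hX⟩ : ∃ X, X = l * T := ⟨_, rfl⟩
    rw [← hX] at hTl hlT ⊢
    have hX2 : 2 ≤ X := hT2.trans hTl
    have h1 : (numCliques G K : ℝ) + 2 ≤ 12 * X := by linarith
    have h2 : (n : ℝ) ≤ 2 * X := by linarith
    have h3 : (numCliques G K + 2 : ℝ) * n ≤ 12 * X * (2 * X) :=
      mul_le_mul h1 h2 (Nat.cast_nonneg _) (by linarith)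
    have h4 : ((n : ℝ) + 2) * n ≤ 3 * X * (2 * X) :=
      mul_le_mul (by linarith) h2 (Nat.cast_nonneg _) (by linarith)
    nlinarith
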